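/- All graphs are finite and simple. For a graph $G$ write $\Delta(G)$ and $\delta(G)$ for its maximum and minimum degree and $\overline{G}$ for its complement. Write $G\longrightarrow H$ if for every coloring of $V(G)$ with exactly $|V(H)|$ colors (every color being used) there is an induced subgraph of $G$ isomorphic to $H$ whose vertices have pairwise distinct colors. A graph $G$ on $n$ vertices is bounded by a graph $H$ on $k$ vertices if $\Delta(G)=\Delta(H)$ and $\delta(G)=n-k+\delta(H)$. A graph $H$ has consecutive degrees if every integer $i$ with $\delta(H)\le i\le\Delta(H)$ is the degree of some vertex of $H$. Let $\mathcal{F}_\infty$ consist of the complete graphs $K_k$ ($k\ge 2$), the stars $S_k$ on $k$ vertices ($k\ge 3$), the disjoint union $\Lambda$ of a three-vertex path and an isolated vertex, and the complements of all these graphs. Let $P$ and $\Theta$ be the Petersen and the Hoffman–Singleton graph, and let $P'$ and $\Theta'$ be the graphs obtained by deleting two nonadjacent vertices from $P$ and $\Theta$, respectively. Graphs, and pairs of graphs, are considered up to isomorphism. The graphs $\overline{P}$ and $\overline{\Theta}$ are edge-transitive (any edge can be mapped to any other edge by an automorphism); consequently, up to isomorphism, $P'$ and $\Theta'$ do not depend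 on the choice of the two nonadjacent vertices. Moreover, let $Q$ be the set of pairs $(G,H)$ of graphs such that $|V(H)|=k$ for some $k\geq 3$, $|V(G)|\ge k+2$, $G\longrightarrow H$, $G$ is bounded by $H$, $H\notin\mathcal{F}_\infty$, $H$ has consecutive degrees, and $G$ is $d$-regular for some $d\ge 2$. Then $$Q=\left\{(P,P'),\ (\overline{P},\overline{P'}),\ (\Theta,\Theta'),\ (\overline{\Theta},\overline{\Theta'})\right\}.$$ -/

import Mathlib

namespace RainbowInduced

open SimpleGraph

/-- `G` arrows `H`: for every coloring of the vertices of `G` with exactly `|V(H)|` colors (every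
color is used), there is an induced copy of `H` in `G` whose vertices have distinct colors.
A graph embedding `H ↪g G` preserves and reflects adjacency, so its image is an induced copy. -/
def Arrows {V W : Type*} [Fintype W] (G : SimpleGraph V) (H : SimpleGraph W) : Prop :=
  ∀ c : V → Fin (Fintype.card W), Function.Surjective c →
    ∃ f : H ↪g G, Function.Injective (c ∘ f)

/-- `G` (on `n` vertices) is bounded by `H` (on `k` vertices): `Δ(G) = Δ(H)` and
`δ(G) = n - k + δ(H)`, the latter being written without subtraction. -/
def BoundedBy {V W : Type*} [Fintype V] [Fintype W] (G : SimpleGraph V) (H : SimpleGraph W)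
    [DecidableRel G.Adj] [DecidableRel H.Adj] : Prop :=
  G.maxDegree = H.maxDegree ∧
    G.minDegree + Fintype.card W = Fintype.card V + H.minDegree

/-- The degree sequence of `H` is consecutive: every integer between the minimum and the maximum
degree is the degree of some vertex. -/
def HasConsecutiveDegrees {W : Type*} [Fintype W] (H : SimpleGraph W) [DecidableRel H.Adj] :
    Prop :=
  ∀ i : ℕ, H.minDegree ≤ i → i ≤ H.maxDegree → ∃ v : W, H.degree v = i

/-- The graph `Λ = P₃ + K₁`: the disjoint union of a path on three vertices and a vertex. -/
def lambdaGraph : SimpleGraph (Fin 3 ⊕ Fin 1) :=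
  pathGraph 3 ⊕g (⊤ : SimpleGraph (Fin 1))

/-- Membership, up to isomorphism, in the class `F_∞`: the complete graphs `K_k` with `k ≥ 2`, the
stars `S_k` on `k ≥ 3` vertices, the graph `Λ`, and the complements of all of these.
(A star on `k ≥ 3` vertices is written as a star on `m + 1` vertices with `m ≥ 2`.) -/
def InFInfty {W : Type*} (H : SimpleGraph W) : Prop :=
  (∃ k : ℕ, 2 ≤ k ∧
    (Nonempty (H ≃g (⊤ : SimpleGraph (Fin k))) ∨ Nonempty (H ≃g (⊤ : SimpleGraph (Fin k))ᶜ))) ∨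
  (∃ m : ℕ, 2 ≤ m ∧
    (Nonempty (H ≃g starGraph (0 : Fin (m + 1))) ∨
      Nonempty (H ≃g (starGraph (0 : Fin (m + 1)))ᶜ))) ∨
  Nonempty (H ≃g lambdaGraph) ∨ Nonempty (H ≃g lambdaGraphᶜ)

/-- A graph is edge-transitive if any edge can be mapped to any edge by an automorphism. -/
def IsEdgeTransitive {V : Type*} (G : SimpleGraph V) : Prop :=
  ∀ x₁ y₁ x₂ y₂ : V, G.Adj x₁ y₁ → G.Adj x₂ y₂ →
    ∃ φ : G ≃g G, (φ x₁ = x₂ ∧ φ y₁ = y₂) ∨ (φ x₁ = y₂ ∧ φ y₁ = x₂)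

/-- The graph obtained from `G` by deleting the vertices `u` and `v`. -/
abbrev deletePair {V : Type*} (G : SimpleGraph V) (u v : V) :
    SimpleGraph ({u, v}ᶜ : Set V) :=
  G.induce ({u, v}ᶜ : Set V)

/-- The Petersen graph `P`, as the Kneser graph of the 2-element subsets of a 5-element set, two
of them being adjacent if they are disjoint. -/
def petersen : SimpleGraph {s : Finset (Fin 5) // s.card = 2} where
  Adj s t := Disjoint s.1 t.1
  symm := ⟨fun _ _ h => h.symm⟩
  loopless := ⟨fun s h => by
    have h0 : s.1 = ∅ := by simpa using h
    have h2 := s.2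
    simp [h0] at h2⟩

/-- Adjacency of the Hoffman–Singleton graph. The vertex `inl (h, j)` is the vertex `j` of the
pentagon `P_h` (where `j` is adjacent to `j ± 1`), the vertex `inr (i, j)` is the vertex `j` of the
pentagram `Q_i` (where `j` is adjacent to `j ± 2`), and the vertex `j` of `P_h` is adjacent to the
vertex `h * i + j` of `Q_i`, all modulo 5. -/
def hoffmanSingletonAdj : (ZMod 5 × ZMod 5) ⊕ (ZMod 5 × ZMod 5) →
    (ZMod 5 × ZMod 5) ⊕ (ZMod 5 × ZMod 5) → Prop
  | Sum.inl (h, j), Sum.inl (h', j') => h = h' ∧ (j' = j + 1 ∨ j = j' + 1)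
  | Sum.inr (i, j), Sum.inr (i', j') => i = i' ∧ (j' = j + 2 ∨ j = j' + 2)
  | Sum.inl (h, j), Sum.inr (i, j') => j' = h * i + j
  | Sum.inr (i, j'), Sum.inl (h, j) => j' = h * i + j

/-- The Hoffman–Singleton graph `Θ` (five pentagons and five pentagrams). -/
def hoffmanSingleton : SimpleGraph ((ZMod 5 × ZMod 5) ⊕ (ZMod 5 × ZMod 5)) where
  Adj := hoffmanSingletonAdj
  symm := ⟨by
    rintro (⟨h, j⟩ | ⟨h, j⟩) (⟨h', j'⟩ | ⟨h', j'⟩) hadj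
    · exact ⟨hadj.1.symm, hadj.2.symm⟩
    · exact hadj
    · exact hadj
    · exact ⟨hadj.1.symm, hadj.2.symm⟩⟩
  loopless := ⟨by
    have h1 : ∀ j : ZMod 5, ¬ (j = j + 1 ∨ j = j + 1) := by decide
    have h2 : ∀ j : ZMod 5, ¬ (j = j + 2 ∨ j = j + 2) := by decide
    rintro (⟨h, j⟩ | ⟨h, j⟩) hadj
    · exact h1 j hadj.2
    · exact h2 j hadj.2⟩

/-- The graph `P'`: the Petersen graph with two nonadjacent vertices (here `{0, 1}` and `{0, 2}`)
deleted. -/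
abbrev petersen' :=
  deletePair petersen ⟨{0, 1}, by decide⟩ ⟨{0, 2}, by decide⟩

/-- The graph `Θ'`: the Hoffman–Singleton graph with two nonadjacent vertices (here the vertices
`0` and `2` of the pentagon `P_0`) deleted. -/
abbrev hoffmanSingleton' :=
  deletePair hoffmanSingleton (Sum.inl (0, 0)) (Sum.inl (0, 2))

end RainbowInduced

namespace RainbowInduced

open SimpleGraph

/-! Write n = k + m with m ≥ 2 and call a set T of m vertices deletable if G - T is isomorphic to H.
Arrowing means that every coloring with exactly k colors leaves some deletable set whose complement
is rainbow. Two kinds of colorings suffice. Merging m + 1 vertices into one color puts a deletable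
set inside any (m + 1)-set. Merging an m-set C and, separately, a pair x, y gives a deletable set
obtained from C by exchanging one vertex for x or y. Since G is regular, all deletable sets span the
same number of edges. Boundedness and consecutive degrees say that for each i ≤ m some vertex
outside T has exactly i neighbors in T. These conditions are invariant under complementation
(`GoodFamily`).

Counting edges in such exchanges forces m = 2 (`GoodFamily.card_lt_three`). Up to complementation
the deletable pairs are then exactly the nonadjacent pairs, and G has no triangle, no 4-cycle and
diameter two (`GoodFamily.isMoore`). The Hoffman–Singleton eigenvalue argument leaves d = 2, 3, 7,
57 (`IsMoore.degree_cases`).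

All deletions of nonadjacent pairs are copies of H, and an isomorphism between two of them extends
to an automorphism of G (`IsMoore.extend`). Hence Aut(G) is transitive on nonadjacent pairs and
their number (d² + 1)(d² - d)/2 divides |Aut(G)|. This symmetry settles every degree. For d = 2, H
has three vertices and is exceptional. For d = 57, 4 divides |Aut(G)|, so some involution is an even
permutation, whereas every involution has 56 fixed points and 1597 transpositions. For d = 3 and 7
there is an automorphism of prime order d; it describes G by shift maps between its orbits, and
these are unique up to relabelling, by hand for 3 and by exhaustive search for 7.

Conversely, P and Θ are Moore graphs with edge-transitive complement, checked with explicit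
automorphisms. In such a graph a pigeonhole argument finds a nonadjacent pair whose deletion keeps
all colors (`IsMoore.arrows`). -/

lemma card_triple_iff {V : Type*} [DecidableEq V] {a b c : V} :
    ({a, b, c} : Finset V).card = 3 ↔ a ≠ b ∧ a ≠ c ∧ b ≠ c := by
  refine ⟨fun h => ?_, fun h => Finset.card_eq_three.2 ⟨a, b, c, h.1, h.2.1, h.2.2, rfl⟩⟩
  have h1 := Finset.card_le_two (a := a) (b := b)
  have h2 := Finset.card_le_two (a := a) (b := c)
  refine ⟨?_, ?_, ?_⟩
  · rintro rfl
    simp only [Finset.insert_idem] at h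
    omega
  · rintro rfl
    rw [Finset.insert_comm, Finset.pair_eq_singleton, Finset.pair_comm] at h
    omega
  · rintro rfl
    rw [Finset.pair_eq_singleton] at h
    omega

/-! ### Degrees into a vertex set and edge counts -/

section DegIn

variable {V : Type*} [DecidableEq V] (G : SimpleGraph V) [DecidableRel G.Adj]

/-- The number of neighbors of `v` in `T`. -/
def degIn (T : Finset V) (v : V) : ℕ := (T.filter (G.Adj v)).card

/-- Twice the number of edges inside `T`. -/
def degSum (T : Finset V) : ℕ := ∑ u ∈ T, degIn G T u

lemma degIn_insert {T : Finset V} {x : V} (hx : x ∉ T) (v : V) :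
    degIn G (insert x T) v = degIn G T v + if G.Adj v x then 1 else 0 := by
  unfold degIn
  rw [Finset.filter_insert]
  split_ifs with h
  · rw [Finset.card_insert_of_notMem (by simp [hx])]
  · rfl

lemma degIn_insert_self (T : Finset V) (x : V) : degIn G (insert x T) x = degIn G T x := by
  unfold degIn
  rw [Finset.filter_insert, if_neg (G.irrefl)]

omit [DecidableEq V] in
lemma degIn_eq_sum (T : Finset V) (x : V) :
    degIn G T x = ∑ u ∈ T, if G.Adj u x then 1 else 0 := by
  unfold degIn
  rw [Finset.card_filter]
  exact Finset.sum_congr rfl fun u _ => by simp only [G.adj_comm]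

lemma degSum_insert {T : Finset V} {x : V} (hx : x ∉ T) :
    degSum G (insert x T) = degSum G T + 2 * degIn G T x := by
  unfold degSum
  rw [Finset.sum_insert hx, degIn_insert_self,
    Finset.sum_congr rfl (fun v _ => degIn_insert G hx v), Finset.sum_add_distrib,
    ← degIn_eq_sum]
  ring

omit [DecidableEq V] in
lemma degIn_le_card (T : Finset V) (x : V) : degIn G T x ≤ T.card :=
  Finset.card_filter_le _ _

lemma degIn_erase_self (T : Finset V) (x : V) : degIn G (T.erase x) x = degIn G T x := by
  by_cases hx : x ∈ T
  · conv_rhs => rw [← Finset.insert_erase hx]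
    rw [degIn_insert_self]
  · rw [Finset.erase_eq_of_notMem hx]

lemma degSum_erase {T : Finset V} {x : V} (hx : x ∈ T) :
    degSum G T = degSum G (T.erase x) + 2 * degIn G T x := by
  conv_lhs => rw [← Finset.insert_erase hx]
  rw [degSum_insert G (Finset.notMem_erase x T), degIn_erase_self]

lemma degIn_erase {T : Finset V} {x : V} (hx : x ∈ T) (v : V) :
    degIn G T v = degIn G (T.erase x) v + if G.Adj v x then 1 else 0 := by
  conv_lhs => rw [← Finset.insert_erase hx]
  rw [degIn_insert G (Finset.notMem_erase x T)]

lemma degIn_lt_card {T : Finset V} {x : V} (hx : x ∈ T) : degIn G T x < T.card := by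
  rw [← degIn_erase_self]
  exact (degIn_le_card G _ x).trans_lt (Finset.card_erase_lt_of_mem hx)

omit [DecidableEq V] in
lemma degIn_eq_card_iff {T : Finset V} {x : V} :
    degIn G T x = T.card ↔ ∀ u ∈ T, G.Adj x u := by
  unfold degIn
  rw [Finset.card_filter_eq_iff]

omit [DecidableEq V] in
lemma degIn_eq_zero_iff {T : Finset V} {x : V} :
    degIn G T x = 0 ↔ ∀ u ∈ T, ¬ G.Adj x u := by
  unfold degIn
  rw [Finset.card_filter_eq_zero_iff]

lemma degIn_compl_of_notMem {T : Finset V} {x : V} (hx : x ∉ T) :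
    degIn Gᶜ T x + degIn G T x = T.card := by
  unfold degIn
  rw [add_comm, ← Finset.card_filter_add_card_filter_not (s := T) (G.Adj x)]
  congr 2
  refine Finset.filter_congr fun u hu => ?_
  simp only [compl_adj]
  exact ⟨fun h => h.2, fun h => ⟨fun h' => hx (h' ▸ hu), h⟩⟩

lemma degIn_compl_of_mem {T : Finset V} {x : V} (hx : x ∈ T) :
    degIn Gᶜ T x + degIn G T x + 1 = T.card := by
  rw [← degIn_erase_self, ← degIn_erase_self G,
    degIn_compl_of_notMem G (Finset.notMem_erase x T), Finset.card_erase_add_one hx]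

lemma degSum_compl (T : Finset V) :
    degSum Gᶜ T + degSum G T + T.card = T.card * T.card := by
  unfold degSum
  have : ∑ u ∈ T, (degIn Gᶜ T u + degIn G T u + 1) = ∑ u ∈ T, T.card :=
    Finset.sum_congr rfl fun u hu => degIn_compl_of_mem G hu
  simpa [Finset.sum_add_distrib] using this

end DegIn

/-! ### Families of deletable sets: excluding m ≥ 3 -/

/-- The combinatorial properties of the family of vertex sets whose deletion from a regular graph
`G` yields `H`, when `G ⟶ H` and `G` is bounded by `H`. -/
structure GoodFamily {V : Type*} [Fintype V] [DecidableEq V] (G : SimpleGraph V)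
    [DecidableRel G.Adj] (m τ : ℕ) (F : Finset V → Prop) : Prop where
  card_eq : ∀ T, F T → T.card = m
  exists_subset : ∀ S : Finset V, S.card = m + 1 → ∃ T ⊆ S, F T
  exists_swap : ∀ (x y : V) (C : Finset V), x ≠ y → x ∉ C → y ∉ C → C.card = m →
    ∃ u ∈ C, F (insert x (C.erase u)) ∨ F (insert y (C.erase u))
  degSum_eq : ∀ T, F T → degSum G T = τ
  exists_degIn : ∀ T, F T → ∀ i ≤ m, ∃ x ∉ T, degIn G T x = i
  le_degree : ∀ v, m ≤ G.degree v
  le_degree_compl : ∀ v, m ≤ Gᶜ.degree v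

namespace GoodFamily

variable {V : Type*} [Fintype V] [DecidableEq V] {G : SimpleGraph V} [DecidableRel G.Adj]
  {m τ : ℕ} {F : Finset V → Prop}

/-- Passing to the complement replaces i neighbors in T by m - i and the degree sum τ by m(m - 1) -
τ, so the conditions are self-dual. An argument about an isolated vertex of T therefore also covers
a dominating one. -/
lemma compl (h : GoodFamily G m τ F) : GoodFamily Gᶜ m (m * m - m - τ) F where
  card_eq := h.card_eq
  exists_subset := h.exists_subset
  exists_swap := h.exists_swap
  degSum_eq T hT := by
    have := degSum_compl G T
    rw [h.degSum_eq T hT, h.card_eq T hT] at this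
    omega
  exists_degIn T hT i hi := by
    obtain ⟨x, hx, hd⟩ := h.exists_degIn T hT (m - i) (Nat.sub_le _ _)
    refine ⟨x, hx, ?_⟩
    have := degIn_compl_of_notMem G hx
    rw [h.card_eq T hT] at this
    omega
  le_degree := h.le_degree_compl
  le_degree_compl v := by
    convert h.le_degree v
    exact compl_compl G

/-- If `T` is good, `u₀` is isolated in `T` and `z` is adjacent to all of `T`, then every vertex
has at most one neighbor in `T - u₀ + z`. -/
lemma degIn_le_one (h : GoodFamily G m τ F) (hm : 2 ≤ m) {T : Finset V} (hT : F T) {u₀ z x : V}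
    (hu₀ : u₀ ∈ T) (hu : degIn G T u₀ = 0) (hzT : z ∉ T) (hz : degIn G T z = m)
    (hx : x ∉ insert z (T.erase u₀)) : degIn G (insert z (T.erase u₀)) x ≤ 1 := by
  have hzE : z ∉ T.erase u₀ := fun hh => hzT (Finset.mem_of_mem_erase hh)
  have hcE : (T.erase u₀).card + 1 = m := by
    rw [Finset.card_erase_add_one hu₀, h.card_eq T hT]
  have hK : degSum G (insert z (T.erase u₀)) = τ + 2 * (m - 1) := by
    rw [degSum_insert G hzE]
    have h1 := degSum_erase G hu₀
    rw [h.degSum_eq T hT, hu] at h1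
    have h2 := degIn_erase G hu₀ z
    have h3 : G.Adj z u₀ := (degIn_eq_card_iff G).1 (by rw [hz, h.card_eq T hT]) u₀ hu₀
    rw [hz, if_pos h3] at h2
    omega
  generalize hKd : insert z (T.erase u₀) = K at *
  have hcK : K.card = m := by rw [← hKd, Finset.card_insert_of_notMem hzE, hcE]
  have hcS : (insert x K).card = m + 1 := by rw [Finset.card_insert_of_notMem hx, hcK]
  obtain ⟨T', hT'S, hT'⟩ := h.exists_subset _ hcS
  obtain ⟨v, hv, rfl⟩ : ∃ v ∈ insert x K, T' = (insert x K).erase v := by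
    have h1 : ((insert x K) \ T').card = 1 := by
      rw [Finset.card_sdiff_of_subset hT'S, hcS, h.card_eq _ hT']; omega
    obtain ⟨v, hv⟩ := Finset.card_eq_one.1 h1
    have hv' : v ∈ insert x K \ T' := by rw [hv]; simp
    refine ⟨v, (Finset.mem_sdiff.1 hv').1, ?_⟩
    rw [← Finset.sdiff_singleton_eq_erase, ← hv, Finset.sdiff_sdiff_eq_self hT'S]
  -- K has m - 1 more edges than a deletable set. The vertex v omitted from K + x must make up for
  -- this and for the edges at x; v ≠ x since m ≥ 2, and inside K it has at most m - 1 neighbors.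
  -- Only the possible edge from v to x is left to pay for the neighbors of x.
  have h1 := degSum_erase G hv
  rw [h.degSum_eq _ hT', degSum_insert G hx, hK] at h1
  rcases Finset.mem_insert.1 hv with rfl | hvK
  · rw [degIn_insert_self] at h1; omega
  · rw [degIn_insert G hx] at h1
    have h2 := degIn_lt_card G hvK
    split_ifs at h1 <;> omega

end GoodFamily

/-- Three vertices with exactly one edge between them and with a common neighbor. -/
def GoodTriple {V : Type*} (G : SimpleGraph V) (a b c : V) : Prop :=
  ((G.Adj a b ∧ ¬ G.Adj a c ∧ ¬ G.Adj b c) ∨ (¬ G.Adj a b ∧ G.Adj a c ∧ ¬ G.Adj b c) ∨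
    (¬ G.Adj a b ∧ ¬ G.Adj a c ∧ G.Adj b c)) ∧ ∃ p, G.Adj p a ∧ G.Adj p b ∧ G.Adj p c

lemma exists_two_of_card_le {V : Type*} [DecidableEq V] {s : Finset V} (hs : 3 ≤ s.card)
    (a b : V) : ∃ c ∈ s, c ≠ a ∧ c ≠ b := by
  have h1 : 0 < ((s.erase a).erase b).card := by
    have h1 := Finset.pred_card_le_card_erase (s := s) (a := a)
    have h2 := Finset.pred_card_le_card_erase (s := s.erase a) (a := b)
    omega
  obtain ⟨c, hc⟩ := Finset.card_pos.1 h1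
  simp only [Finset.mem_erase] at hc
  exact ⟨c, hc.2.2, hc.2.1, hc.1⟩

/-- Any three vertices of a 4-cycle span at least two edges, so there are no 4-cycles. Take a
further neighbor c of u₁ and e of u₂. The only edge among z, u₀, c, e is then zu₀, so a good triple
consists of z, u₀ and one of c, e, and its common neighbor closes a 4-cycle through z and u₁ or u₂.
-/
lemma false_of_goodTriple {V : Type*} [Fintype V] [DecidableEq V] (G : SimpleGraph V)
    [DecidableRel G.Adj] (hd : ∀ v, 3 ≤ G.degree v)
    (hq : ∀ a b c e : V, a ≠ b → a ≠ c → a ≠ e → b ≠ c → b ≠ e → c ≠ e →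
      GoodTriple G a b c ∨ GoodTriple G a b e ∨ GoodTriple G a c e ∨ GoodTriple G b c e)
    {u₀ u₁ u₂ z : V} (h01 : ¬ G.Adj u₀ u₁) (h02 : ¬ G.Adj u₀ u₂) (h12 : G.Adj u₁ u₂)
    (hz0 : G.Adj z u₀) (hz1 : G.Adj z u₁) (hz2 : G.Adj z u₂) : False := by
  have hC4 : ∀ a b c e : V, G.Adj a b → G.Adj b c → G.Adj c e → G.Adj e a → a ≠ c → b ≠ e →
      False := by
    intro a b c e hab hbc hce hea hac hbe
    have := hq a b c e hab.ne hac hea.ne.symm hbc.ne hbe hce.ne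
    simp only [GoodTriple] at this
    have h1 := hab.symm; have h2 := hbc.symm; have h3 := hce.symm; have h4 := hea.symm
    tauto
  obtain ⟨c, hc, hcz, hcu⟩ := exists_two_of_card_le (s := G.neighborFinset u₁)
    (by simpa using hd u₁) z u₂
  obtain ⟨e, he, hez, heu⟩ := exists_two_of_card_le (s := G.neighborFinset u₂)
    (by simpa using hd u₂) z u₁
  rw [mem_neighborFinset] at hc he
  have s1 := h12.symm; have s2 := hz0.symm; have s3 := hz1.symm; have s4 := hz2.symm
  have s5 := hc.symm; have s6 := he.symm
  have hcz' : ¬ G.Adj z c := fun hh => hC4 z u₂ u₁ c hz2 s1 hc hh.symm hz1.ne (Ne.symm hcu)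
  have hcu' : ¬ G.Adj u₂ c := fun hh => hC4 u₂ z u₁ c s4 hz1 hc hh.symm s1.ne (Ne.symm hcz)
  have hez' : ¬ G.Adj z e := fun hh => hC4 z u₁ u₂ e hz1 h12 he hh.symm hz2.ne (Ne.symm heu)
  have hcu0 : u₀ ≠ c := by rintro rfl; exact h01 s5
  have heu0 : u₀ ≠ e := by rintro rfl; exact h02 s6
  have h01' : u₀ ≠ u₁ := by rintro rfl; exact h02 h12
  have h02' : u₀ ≠ u₂ := by rintro rfl; exact h01 s1
  have hce' : c ≠ e := by rintro rfl; exact hcu' he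
  have hc0 : ¬ G.Adj c u₀ := fun hh => hC4 z u₁ c u₀ hz1 hc hh s2 (Ne.symm hcz) h01'.symm
  have he0 : ¬ G.Adj e u₀ := fun hh => hC4 z u₂ e u₀ hz2 he hh s2 (Ne.symm hez) h02'.symm
  have hce : ¬ G.Adj c e := fun hh => hC4 u₁ c e u₂ hc hh s6 s1 (Ne.symm heu) hcu
  have key : ∀ p, G.Adj p z → G.Adj p u₀ → ¬ G.Adj p c ∧ ¬ G.Adj p e := by
    intro p hpz hp0
    have hp1 : p ≠ u₁ := by rintro rfl; exact h01 hp0.symm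
    have hp2 : p ≠ u₂ := by rintro rfl; exact h02 hp0.symm
    exact ⟨fun hpc => hC4 z u₁ c p hz1 hc hpc.symm hpz (Ne.symm hcz) hp1.symm,
      fun hpe => hC4 z u₂ e p hz2 he hpe.symm hpz (Ne.symm hez) hp2.symm⟩
  have hq' := hq z u₀ c e hz0.ne (Ne.symm hcz) (Ne.symm hez) hcu0 heu0 hce'
  have t1 : ¬ G.Adj u₀ c := fun hh => hc0 hh.symm
  have t2 : ¬ G.Adj u₀ e := fun hh => he0 hh.symm
  rcases hq' with ⟨-, p, h1, h2, h3⟩ | ⟨-, p, h1, h2, h3⟩ | ⟨h, -⟩ | ⟨h, -⟩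
  · exact (key p h1 h2).1 h3
  · exact (key p h1 h2).2 h3
  · tauto
  · tauto

namespace GoodFamily

variable {V : Type*} [Fintype V] [DecidableEq V] {G : SimpleGraph V} [DecidableRel G.Adj]
  {m τ : ℕ} {F : Finset V → Prop}

lemma goodTriple_of_card_three (h : GoodFamily G 3 2 F) {a b c : V} (hT : F {a, b, c}) :
    GoodTriple G a b c := by
  have hc := h.card_eq _ hT
  obtain ⟨hab, hac, hbc⟩ := card_triple_iff.1 hc
  have hs := h.degSum_eq _ hT
  obtain ⟨p, hp, hpd⟩ := h.exists_degIn _ hT 3 le_rfl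
  have hp' := (degIn_eq_card_iff G).1 (hpd.trans hc.symm)
  refine ⟨?_, p, hp' a (by simp), hp' b (by simp), hp' c (by simp)⟩
  rw [degSum_insert G (by simp [hab, hac]), degSum_insert G (by simp [hbc]),
    degIn_insert G (by simp [hbc])] at hs
  simp only [degSum, degIn_eq_sum, Finset.sum_singleton, SimpleGraph.irrefl, if_false] at hs
  have := G.adj_comm a b
  have := G.adj_comm a c
  have := G.adj_comm b c
  split_ifs at hs <;> first | omega | tauto

/-- The set T - u₀ + z meets every outside neighborhood in at most one vertex, yet some x has m - 1
neighbors in T. This leaves m = 3 with T spanning exactly one edge, which `false_of_goodTriple`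
excludes. -/
lemma false_of_isolated (h : GoodFamily G m τ F) (hm : 3 ≤ m) {T : Finset V} (hT : F T) {u₀ : V}
    (hu₀ : u₀ ∈ T) (hu : degIn G T u₀ = 0) : False := by
  obtain ⟨z, hzT, hz⟩ := h.exists_degIn T hT m le_rfl
  obtain ⟨x, hxT, hx⟩ := h.exists_degIn T hT (m - 1) (Nat.sub_le _ _)
  have hcT := h.card_eq T hT
  have hzx : z ≠ x := by rintro rfl; omega
  have hle := h.degIn_le_one (x := x) (by omega) hT hu₀ hu hzT hz (by
    simp only [Finset.mem_insert, Finset.mem_erase, not_or, not_and]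
    exact ⟨hzx.symm, fun _ => hxT⟩)
  rw [degIn_insert G (fun hh => hzT (Finset.mem_of_mem_erase hh))] at hle
  have hxe := degIn_erase G hu₀ x
  -- x keeps at least m - 2 neighbors after u₀ is removed, and at most one is allowed.
  obtain rfl : m = 3 := by
    split_ifs at hxe <;> omega
  have hdeg : ∀ u ∈ T, degIn G T u < 2 := by
    intro u huT
    by_contra hcon
    have h1 := degIn_lt_card G huT
    have h2 : u ≠ u₀ := by rintro rfl; omega
    have h3 := degIn_erase G hu₀ u
    have h4 := degIn_lt_card G (Finset.mem_erase.2 ⟨h2, huT⟩)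
    rw [Finset.card_erase_of_mem hu₀] at h4
    have h5 : ¬ G.Adj u u₀ := fun hh => (degIn_eq_zero_iff G).1 hu u huT hh.symm
    rw [if_neg h5] at h3
    omega
  -- An exchange preserves the edge count, so the vertex u removed from T has as many neighbors in T
  -- - u as the vertex replacing it. Both z and x have at least two neighbors in T, hence one in T -
  -- u.
  obtain ⟨u₁, hu₁, hpos⟩ : ∃ u ∈ T, 0 < degIn G T u := by
    obtain ⟨u, huT, hF⟩ := h.exists_swap z x T hzx hzT hxT hcT
    have hse := degSum_erase G huT
    rw [h.degSum_eq T hT] at hse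
    refine ⟨u, huT, ?_⟩
    rcases hF with hF | hF
    · have h1 := h.degSum_eq _ hF
      rw [degSum_insert G (fun hh => hzT (Finset.mem_of_mem_erase hh))] at h1
      have h2 := degIn_erase G huT z
      have := hdeg u huT
      split_ifs at h2 <;> omega
    · have h1 := h.degSum_eq _ hF
      rw [degSum_insert G (fun hh => hxT (Finset.mem_of_mem_erase hh))] at h1
      have h2 := degIn_erase G huT x
      split_ifs at h2 <;> omega
  obtain ⟨u₂, hu₂⟩ := Finset.card_pos.1 hpos
  obtain ⟨hu₂, h12⟩ := Finset.mem_filter.1 hu₂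
  have hu0 := (degIn_eq_zero_iff G).1 hu
  have hzadj := (degIn_eq_card_iff G).1 (hz.trans hcT.symm)
  have h01 : u₀ ≠ u₁ := by rintro rfl; omega
  have h02 : u₀ ≠ u₂ := by rintro rfl; exact hu0 _ hu₁ h12.symm
  have hTeq : ({u₀, u₁, u₂} : Finset V) = T := by
    refine Finset.eq_of_subset_of_card_le ?_ ?_
    · intro w hw
      simp only [Finset.mem_insert, Finset.mem_singleton] at hw
      rcases hw with rfl | rfl | rfl <;> assumption
    · rw [hcT, card_triple_iff.2 ⟨h01, h02, h12.ne⟩]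
  have hτ : τ = 2 := by
    rw [← h.degSum_eq T hT, ← hTeq, degSum_insert G (by simp [h01, h02]),
      degSum_insert G (by simp [h12.ne])]
    have e1 := hu0 _ hu₁
    have e2 := hu0 _ hu₂
    simp only [degSum, degIn_eq_sum, Finset.sum_singleton, SimpleGraph.irrefl, if_false,
      Finset.sum_pair h12.ne, if_pos h12.symm, G.adj_comm _ u₀, if_neg e1, if_neg e2]
    norm_num
  subst hτ
  refine false_of_goodTriple G h.le_degree ?_ (hu0 _ hu₁) (hu0 _ hu₂) h12 (hzadj _ hu₀)
    (hzadj _ hu₁) (hzadj _ hu₂)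
  intro a b c e hab hac hae hbc hbe hce
  have hcS : ({a, b, c, e} : Finset V).card = 4 := by
    rw [Finset.card_insert_of_notMem (by simp [hab, hac, hae]),
      card_triple_iff.2 ⟨hbc, hbe, hce⟩]
  obtain ⟨T', hT'S, hT'⟩ := h.exists_subset _ hcS
  have hcT' := h.card_eq _ hT'
  by_cases ha : a ∈ T'
  · by_cases hb : b ∈ T'
    · by_cases hc : c ∈ T'
      · left
        refine h.goodTriple_of_card_three ?_
        convert hT'
        refine Finset.eq_of_subset_of_card_le ?_ ?_
        · intro w hw
          simp only [Finset.mem_insert, Finset.mem_singleton] at hw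
          rcases hw with rfl | rfl | rfl <;> assumption
        · rw [hcT', card_triple_iff.2 ⟨hab, hac, hbc⟩]
      · right; left
        refine h.goodTriple_of_card_three ?_
        convert hT'
        refine (Finset.eq_of_subset_of_card_le ?_ ?_).symm
        · intro w hw
          have := hT'S hw
          simp only [Finset.mem_insert, Finset.mem_singleton] at this ⊢
          rcases this with rfl | rfl | rfl | rfl <;> simp_all
        · rw [hcT', card_triple_iff.2 ⟨hab, hae, hbe⟩]
    · right; right; left
      refine h.goodTriple_of_card_three ?_
      convert hT'
      refine (Finset.eq_of_subset_of_card_le ?_ ?_).symm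
      · intro w hw
        have := hT'S hw
        simp only [Finset.mem_insert, Finset.mem_singleton] at this ⊢
        rcases this with rfl | rfl | rfl | rfl <;> simp_all
      · rw [hcT', card_triple_iff.2 ⟨hac, hae, hce⟩]
  · right; right; right
    refine h.goodTriple_of_card_three ?_
    convert hT'
    refine (Finset.eq_of_subset_of_card_le ?_ ?_).symm
    · intro w hw
      have := hT'S hw
      simp only [Finset.mem_insert, Finset.mem_singleton] at this ⊢
      rcases this with rfl | rfl | rfl | rfl <;> simp_all
    · rw [hcT', card_triple_iff.2 ⟨hbc, hbe, hce⟩]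

/-- Exchange a vertex u of T for a vertex z adjacent to all of T or a vertex w adjacent to none. As
the edge count is preserved, u has m - 1 or 0 neighbors in T, respectively. -/
lemma exists_isolated_or_dominating (h : GoodFamily G m τ F) (hm : 2 ≤ m) {T : Finset V}
    (hT : F T) : (∃ u ∈ T, degIn G T u = 0) ∨ ∃ u ∈ T, degIn Gᶜ T u = 0 := by
  obtain ⟨z, hzT, hz⟩ := h.exists_degIn T hT m le_rfl
  obtain ⟨w, hwT, hw⟩ := h.exists_degIn T hT 0 (Nat.zero_le _)
  have hcT := h.card_eq T hT
  have hzw : z ≠ w := by rintro rfl; omega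
  obtain ⟨u, huT, hF⟩ := h.exists_swap z w T hzw hzT hwT hcT
  have hse := degSum_erase G huT
  rw [h.degSum_eq T hT] at hse
  rcases hF with hF | hF
  · have h1 := h.degSum_eq _ hF
    rw [degSum_insert G (fun hh => hzT (Finset.mem_of_mem_erase hh))] at h1
    have h2 := degIn_erase G huT z
    rw [if_pos ((degIn_eq_card_iff G).1 (hz.trans hcT.symm) u huT)] at h2
    have h3 := degIn_compl_of_mem G huT
    exact Or.inr ⟨u, huT, by omega⟩
  · have h1 := h.degSum_eq _ hF
    rw [degSum_insert G (fun hh => hwT (Finset.mem_of_mem_erase hh))] at h1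
    have h2 := degIn_erase G huT w
    rw [if_neg ((degIn_eq_zero_iff G).1 hw u huT)] at h2
    exact Or.inl ⟨u, huT, by omega⟩

lemma card_lt_three (h : GoodFamily G m τ F) {T : Finset V} (hT : F T) : m < 3 := by
  by_contra! hm
  rcases h.exists_isolated_or_dominating (by omega) hT with ⟨u, hu, hd⟩ | ⟨u, hu, hd⟩
  · exact h.false_of_isolated hm hT hu hd
  · exact h.compl.false_of_isolated hm hT hu hd

end GoodFamily

/-! ### The case m = 2: Moore graphs -/

/-- Graphs of diameter two and girth at least five: no triangles, and any two distinct
nonadjacent vertices have a unique common neighbor. -/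
structure IsMoore {V : Type*} (G : SimpleGraph V) : Prop where
  not_adj : ∀ a b c, G.Adj a b → G.Adj b c → ¬ G.Adj a c
  exists_common : ∀ a b, a ≠ b → ¬ G.Adj a b → ∃ c, G.Adj a c ∧ G.Adj b c
  common_unique : ∀ a b c c', a ≠ b → G.Adj a c → G.Adj b c → G.Adj a c' → G.Adj b c' → c = c'

namespace GoodFamily

variable {V : Type*} [Fintype V] [DecidableEq V] {G : SimpleGraph V} [DecidableRel G.Adj]
  {F : Finset V → Prop}

/-- For τ = 0 the members of F are nonadjacent pairs. Every triple contains one, which excludes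
triangles. Between any two disjoint pairs there is one, which excludes 4-cycles. A vertex with two
neighbors in a member is a common neighbor. It remains to see that every nonadjacent pair is a
member. -/
lemma isMoore (h : GoodFamily G 2 0 F) :
    IsMoore G ∧ ∀ a b, a ≠ b → ¬ G.Adj a b → F {a, b} := by
  have hadj : ∀ a b, G.Adj a b → ¬ F {a, b} := by
    intro a b hab hF
    have := h.degSum_eq _ hF
    rw [degSum_insert G (by simp [hab.ne])] at this
    simp [degIn_eq_sum, hab.symm] at this
  have htri : ∀ a b c, a ≠ b → a ≠ c → b ≠ c → F {a, b} ∨ F {a, c} ∨ F {b, c} := by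
    intro a b c hab hac hbc
    obtain ⟨T, hTS, hT⟩ := h.exists_subset {a, b, c} (card_triple_iff.2 ⟨hab, hac, hbc⟩)
    obtain ⟨x, y, hxy, rfl⟩ := Finset.card_eq_two.1 (h.card_eq T hT)
    have hx := hTS (Finset.mem_insert_self x {y})
    have hy := hTS (Finset.mem_insert_of_mem (Finset.mem_singleton_self y) : y ∈ {x, y})
    simp only [Finset.mem_insert, Finset.mem_singleton] at hx hy
    rcases hx with rfl | rfl | rfl <;> rcases hy with rfl | rfl | rfl <;>
      simp_all [Finset.pair_comm]
  have hfour : ∀ a b c d, a ≠ b → c ≠ d → a ≠ c → a ≠ d → b ≠ c → b ≠ d →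
      F {a, c} ∨ F {a, d} ∨ F {b, c} ∨ F {b, d} := by
    intro a b c d hab hcd hac had hbc hbd
    obtain ⟨u, hu, hF⟩ := h.exists_swap a b {c, d} hab (by simp [hac, had]) (by simp [hbc, hbd])
      (Finset.card_pair hcd)
    simp only [Finset.mem_insert, Finset.mem_singleton] at hu
    rcases hu with rfl | rfl
    · rw [Finset.erase_insert (by simpa using hcd)] at hF
      tauto
    · rw [Finset.pair_comm, Finset.erase_insert (by simpa using hcd.symm)] at hF
      tauto
  have hcommon : ∀ a b, F {a, b} → ∃ c, G.Adj a c ∧ G.Adj b c := by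
    intro a b hF
    obtain ⟨c, hc, hd⟩ := h.exists_degIn _ hF 2 le_rfl
    have := (degIn_eq_card_iff G).1 (hd.trans (h.card_eq _ hF).symm)
    exact ⟨c, (this a (by simp)).symm, (this b (by simp)).symm⟩
  have hgood : ∀ a b, a ≠ b → ¬ G.Adj a b → F {a, b} := by
    intro a b hab hnadj
    by_contra hF
    -- If ab is nonadjacent but not a member and b' is a neighbor of b, then ab' is a member and has
    -- a common neighbor c. No cross pair between {a, b'} and {c, b} is now a member: three are
    -- edges and the fourth is ab.
    obtain ⟨b', hb'⟩ : (G.neighborFinset b).Nonempty := by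
      rw [← Finset.card_pos, card_neighborFinset_eq_degree]
      exact (by norm_num : 0 < 2).trans_le (h.le_degree b)
    rw [mem_neighborFinset] at hb'
    have hab' : a ≠ b' := by rintro rfl; exact hnadj hb'.symm
    have hF' : F {a, b'} := by
      have := htri a b b' hab hab' hb'.ne
      have := hadj b b' hb'
      tauto
    obtain ⟨c, hac, hbc⟩ := hcommon _ _ hF'
    have hcb : c ≠ b := by rintro rfl; exact hnadj hac
    have h4 := hfour a b' c b hab' hcb hac.ne hab hbc.ne hb'.ne.symm
    have := hadj _ _ hac
    have := hadj _ _ hbc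
    have := hadj _ _ hb'.symm
    tauto
  refine ⟨⟨?_, fun a b hab hn => hcommon a b (hgood a b hab hn), ?_⟩, hgood⟩
  · intro a b c hab hbc hac
    have := htri a b c hab.ne hac.ne hbc.ne
    have := hadj _ _ hab
    have := hadj _ _ hac
    have := hadj _ _ hbc
    tauto
  · intro a b c c' hab hac hbc hac' hbc'
    by_contra hcc
    have := hfour a b c c' hab hcc hac.ne hac'.ne hbc.ne hbc'.ne
    have := hadj _ _ hac
    have := hadj _ _ hbc
    have := hadj _ _ hac'
    have := hadj _ _ hbc'
    tauto

end GoodFamily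

/-! ### From colorings to deletable sets -/

/-- Deleting `T` from `G` yields a copy of `H`. -/
def IsDeletion {V W : Type*} (G : SimpleGraph V) (H : SimpleGraph W) (T : Finset V) : Prop :=
  Nonempty (G.induce ((T : Set V)ᶜ) ≃g H)

section

variable {V W : Type*} {G : SimpleGraph V} {H : SimpleGraph W}

/-- An isomorphism is also an isomorphism of the complements. -/
def complIso (e : G ≃g H) : Gᶜ ≃g Hᶜ where
  toEquiv := e.toEquiv
  map_rel_iff' := by
    intro a b
    simp only [compl_adj]
    exact and_congr (e.injective.ne_iff) (not_congr e.map_adj_iff)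

lemma induce_compl (s : Set V) : Gᶜ.induce s = (G.induce s)ᶜ := by
  ext a b
  simp [Subtype.ext_iff]

lemma IsDeletion.compl {T : Finset V} (h : IsDeletion G H T) : IsDeletion Gᶜ Hᶜ T := by
  obtain ⟨e⟩ := h
  unfold IsDeletion
  rw [induce_compl]
  exact ⟨complIso e⟩

lemma Arrows.compl [Fintype W] (h : Arrows G H) : Arrows Gᶜ Hᶜ := by
  intro c hc
  obtain ⟨f, hf⟩ := h c hc
  refine ⟨⟨f.toEmbedding, ?_⟩, hf⟩
  intro a b
  simp only [compl_adj]
  exact and_congr (f.injective.ne_iff) (not_congr f.map_adj_iff)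

lemma IsDeletion.card_add [Fintype V] [Fintype W] {T : Finset V} (h : IsDeletion G H T) :
    T.card + Fintype.card W = Fintype.card V := by
  classical
  obtain ⟨e⟩ := h
  rw [← Fintype.card_congr e.toEquiv, Fintype.card_compl_set]
  simp only [Fintype.card_coe, Finset.coe_sort_coe]
  have := Finset.card_le_univ T
  omega

/-- Colors may be taken from V itself, so that a coloring is a map collapsing vertices onto
representatives. T is the complement of the rainbow copy, hence the coloring is injective off T. -/
lemma Arrows.exists_isDeletion [Fintype V] [Fintype W] [DecidableEq V] (h : Arrows G H)
    (c : V → V) (hc : (Finset.univ.image c).card = Fintype.card W) :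
    ∃ T, IsDeletion G H T ∧ ∀ x ∉ T, ∀ y ∉ T, c x = c y → x = y := by
  have e := Finset.equivFinOfCardEq hc
  obtain ⟨f, hf⟩ := h (fun v => e ⟨c v, Finset.mem_image_of_mem c (Finset.mem_univ v)⟩) (by
    intro i
    obtain ⟨v, -, hv⟩ := Finset.mem_image.1 (e.symm i).2
    exact ⟨v, by simp [hv]⟩)
  refine ⟨(Finset.univ.image f)ᶜ, ⟨?_⟩, ?_⟩
  · refine RelIso.symm ⟨Equiv.ofBijective (fun w => ⟨f w, by simp⟩) ⟨?_, ?_⟩, ?_⟩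
    · intro a b hab
      exact f.injective (congrArg Subtype.val hab)
    · rintro ⟨v, hv⟩
      simp only [Finset.coe_compl, Finset.coe_image, Finset.coe_univ, Set.image_univ,
        compl_compl, Set.mem_range] at hv
      obtain ⟨w, hw⟩ := hv
      exact ⟨w, Subtype.ext hw⟩
    · intro a b
      exact f.map_adj_iff
  · intro x hx y hy hxy
    simp only [Finset.mem_compl, Finset.mem_image, Finset.mem_univ, true_and, not_not] at hx hy
    obtain ⟨a, rfl⟩ := hx
    obtain ⟨b, rfl⟩ := hy
    refine congrArg f (hf ?_)
    simpa using hxy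

end

section

variable {V W : Type*} [Fintype V] [Fintype W] [DecidableEq V] {G : SimpleGraph V}
  {H : SimpleGraph W} {m : ℕ}

/-- Give S one color and every other vertex its own. At most one vertex of S survives, so the m
vertices of T are all in S. -/
lemma Arrows.exists_isDeletion_subset (h : Arrows G H)
    (hcard : Fintype.card V = Fintype.card W + m) (S : Finset V) (hS : S.card = m + 1) :
    ∃ T ⊆ S, IsDeletion G H T := by
  obtain ⟨s₀, hs₀⟩ : S.Nonempty := Finset.card_pos.1 (by omega)
  have himg : Finset.univ.image (fun v => if v ∈ S then s₀ else v) = (S.erase s₀)ᶜ := by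
    ext v
    simp only [Finset.mem_image, Finset.mem_univ, true_and, Finset.mem_compl, Finset.mem_erase,
      not_and]
    constructor
    · rintro ⟨w, rfl⟩
      split_ifs with hw <;> tauto
    · intro hv
      by_cases hvS : v ∈ S
      · have : v = s₀ := by tauto
        exact ⟨v, by simp [this, hs₀]⟩
      · exact ⟨v, by simp [hvS]⟩
  obtain ⟨T, hT, hinj⟩ := h.exists_isDeletion (fun v => if v ∈ S then s₀ else v) (by
    rw [himg, Finset.card_compl, Finset.card_erase_of_mem hs₀]; omega)
  refine ⟨T, ?_, hT⟩
  have hTc := hT.card_add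
  have h1 : (S \ T).card ≤ 1 := by
    rw [Finset.card_le_one]
    intro a ha b hb
    rw [Finset.mem_sdiff] at ha hb
    exact hinj a ha.2 b hb.2 (by simp [ha.1, hb.1])
  have h2 := Finset.card_sdiff_add_card_inter S T
  have h3 : S ∩ T = T := Finset.eq_of_subset_of_card_le Finset.inter_subset_right (by omega)
  exact Finset.inter_eq_right.1 h3

/-- Give C one color, x and y another, and every other vertex its own; this uses n - (m - 1) - 1 = k
colors. T contains all of C but at most one vertex, and also x or y, which already accounts for its
m elements. -/
lemma Arrows.exists_isDeletion_swap (h : Arrows G H)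
    (hcard : Fintype.card V = Fintype.card W + m) (hm : 1 ≤ m) (x y : V) (C : Finset V)
    (hxy : x ≠ y) (hx : x ∉ C) (hy : y ∉ C) (hC : C.card = m) :
    ∃ u ∈ C, IsDeletion G H (insert x (C.erase u)) ∨ IsDeletion G H (insert y (C.erase u)) := by
  obtain ⟨s₀, hs₀⟩ : C.Nonempty := Finset.card_pos.1 (by omega)
  have himg : Finset.univ.image (fun v => if v = y then x else if v ∈ C then s₀ else v) =
      (insert y (C.erase s₀))ᶜ := by
    ext v
    simp only [Finset.mem_image, Finset.mem_univ, true_and, Finset.mem_compl, Finset.mem_erase,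
      Finset.mem_insert, not_and, not_or]
    constructor
    · rintro ⟨w, rfl⟩
      split_ifs with hw hw2
      · exact ⟨hxy, fun _ => hx⟩
      · exact ⟨fun hh => hy (hh ▸ hs₀), fun hh => absurd rfl hh⟩
      · exact ⟨hw, fun _ => hw2⟩
    · rintro ⟨hvy, hv⟩
      refine ⟨v, ?_⟩
      rw [if_neg hvy]
      split_ifs with hvC
      · by_contra hne
        exact hv (fun hh => hne hh.symm) hvC
      · rfl
  obtain ⟨T, hT, hinj⟩ := h.exists_isDeletion _ (by
    rw [himg, Finset.card_compl, Finset.card_insert_of_notMem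
      (fun hh => hy (Finset.mem_of_mem_erase hh)), Finset.card_erase_of_mem hs₀]
    omega)
  have hTc := hT.card_add
  have h1 : (C \ T).card ≤ 1 := by
    rw [Finset.card_le_one]
    intro a ha b hb
    rw [Finset.mem_sdiff] at ha hb
    have hay : a ≠ y := by rintro rfl; exact hy ha.1
    have hby : b ≠ y := by rintro rfl; exact hy hb.1
    exact hinj a ha.2 b hb.2 (by simp [ha.1, hb.1, hay, hby])
  obtain ⟨x', hx', hx'T⟩ : ∃ x', (x' = x ∨ x' = y) ∧ x' ∈ T := by
    by_cases hxT : x ∈ T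
    · exact ⟨x, Or.inl rfl, hxT⟩
    · by_cases hyT : y ∈ T
      · exact ⟨y, Or.inr rfl, hyT⟩
      · exact absurd (hinj x hxT y hyT (by simp [hx])) hxy
  have hx'C : x' ∉ C := by rcases hx' with rfl | rfl <;> assumption
  have h2 := Finset.card_sdiff_add_card_inter C T
  have h3 : C ∩ T = T.erase x' := by
    refine Finset.eq_of_subset_of_card_le ?_ ?_
    · intro w hw
      rw [Finset.mem_inter] at hw
      exact Finset.mem_erase.2 ⟨fun hh => hx'C (hh ▸ hw.1), hw.2⟩
    · rw [Finset.card_erase_of_mem hx'T]; omega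
  have h4 : (C ∩ T).card = m - 1 := by
    rw [h3, Finset.card_erase_of_mem hx'T]; omega
  obtain ⟨u, hu⟩ := Finset.card_eq_one.1 (by omega : (C \ T).card = 1)
  have huC : u ∈ C \ T := by rw [hu]; simp
  have h5 : insert x' (C.erase u) = T := by
    rw [← Finset.sdiff_singleton_eq_erase, ← hu, Finset.sdiff_sdiff_self_left, h3,
      Finset.insert_erase hx'T]
  refine ⟨u, (Finset.mem_sdiff.1 huC).1, ?_⟩
  rcases hx' with rfl | rfl
  · exact Or.inl (h5 ▸ hT)
  · exact Or.inr (h5 ▸ hT)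

variable [DecidableRel G.Adj] [DecidableRel H.Adj]

lemma degree_eq_degIn_add (T : Finset V) (v : V) :
    G.degree v = degIn G T v + degIn G Tᶜ v := by
  unfold degIn
  rw [← card_neighborFinset_eq_degree, ← Finset.card_union_of_disjoint]
  · congr 1
    ext w
    simp only [mem_neighborFinset, Finset.mem_union, Finset.mem_filter, Finset.mem_compl]
    tauto
  · exact Finset.disjoint_filter_filter disjoint_compl_right

lemma degree_apply_isDeletion {T : Finset V} (e : G.induce ((T : Set V)ᶜ) ≃g H)
    (x : ((T : Set V)ᶜ : Set V)) : H.degree (e x) = degIn G Tᶜ x := by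
  unfold degIn
  rw [← card_neighborFinset_eq_degree]
  symm
  refine Finset.card_bij (fun w hw => e ⟨w, ?_⟩) ?_ ?_ ?_
  · simp only [Finset.mem_filter, Finset.mem_compl] at hw
    simpa using hw.1
  · intro w hw
    simp only [Finset.mem_filter] at hw
    rw [mem_neighborFinset, e.map_adj_iff]
    exact hw.2
  · intro a _ b _ hab
    simpa using hab
  · intro w hw
    rw [mem_neighborFinset] at hw
    obtain ⟨w, rfl⟩ := e.surjective w
    rw [e.map_adj_iff] at hw
    refine ⟨w, ?_, rfl⟩
    simp only [Finset.mem_filter, Finset.mem_compl]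
    exact ⟨fun hh => w.2 (Finset.mem_coe.2 hh), hw⟩

lemma IsDeletion.sum_degree {T : Finset V} (h : IsDeletion G H T) :
    ∑ w, H.degree w = ∑ x ∈ Tᶜ, degIn G Tᶜ x := by
  obtain ⟨e⟩ := h
  symm
  refine Finset.sum_bij (fun x hx => e ⟨x, by simpa using hx⟩) ?_ ?_ ?_ ?_
  · intros; simp
  · intro a _ b _ hab
    simpa using hab
  · intro w _
    refine ⟨e.symm w, ?_, by simp⟩
    exact Finset.mem_compl.2 fun hh => (e.symm w).2 (Finset.mem_coe.2 hh)
  · intro a ha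
    rw [degree_apply_isDeletion]

omit [Fintype V] [DecidableEq V] in
lemma sum_degIn_comm (S T : Finset V) :
    ∑ x ∈ S, degIn G T x = ∑ x ∈ T, degIn G S x := by
  simp only [degIn_eq_sum]
  rw [Finset.sum_comm]
  simp only [G.adj_comm]

/-- The sets whose deletion from `G` yields `H` form a good family. -/
lemma goodFamily_isDeletion {d : ℕ} (hcard : Fintype.card V = Fintype.card W + m) (hm : 1 ≤ m)
    (hW : 0 < Fintype.card W) (h : Arrows G H) (hb : BoundedBy G H)
    (hc : HasConsecutiveDegrees H) (hd : G.IsRegularOfDegree d) :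
    GoodFamily G m (m * d - (Fintype.card W * d - ∑ w, H.degree w)) (IsDeletion G H) := by
  have hVne : Nonempty V := Fintype.card_pos_iff.1 (by omega)
  have hWne : Nonempty W := Fintype.card_pos_iff.1 hW
  have hmin : G.minDegree = d := hd.minDegree_eq
  have hmax : G.maxDegree = d := hd.maxDegree_eq
  obtain ⟨hb1, hb2⟩ := hb
  rw [hmax] at hb1
  rw [hmin] at hb2
  refine ⟨fun T hT => ?_, h.exists_isDeletion_subset hcard, h.exists_isDeletion_swap hcard hm,
    fun T hT => ?_, ?_, fun v => ?_, fun v => ?_⟩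
  · have := hT.card_add
    omega
  -- The edges between T and its complement number kd minus the degree sum of H. Subtracting them
  -- from md leaves the degree sum inside T.
  · have hTc := hT.card_add
    have h1 : ∑ x ∈ Tᶜ, (degIn G T x + degIn G Tᶜ x) = ∑ x ∈ Tᶜ, d :=
      Finset.sum_congr rfl fun x _ => by rw [← degree_eq_degIn_add, hd x]
    have h2 : ∑ x ∈ T, (degIn G T x + degIn G Tᶜ x) = ∑ x ∈ T, d :=
      Finset.sum_congr rfl fun x _ => by rw [← degree_eq_degIn_add, hd x]
    rw [Finset.sum_add_distrib, Finset.sum_const, smul_eq_mul] at h1 h2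
    rw [sum_degIn_comm, ← hT.sum_degree, Finset.card_compl,
      show Fintype.card V - T.card = Fintype.card W by omega] at h1
    rw [show T.card = m by omega] at h2
    unfold degSum
    omega
  · rintro T ⟨e⟩ i hi
    -- A vertex of degree d - i in H has lost exactly i neighbors to T. Boundedness gives δ(H) = d -
    -- m and Δ(H) = d, so d - i is in range.
    obtain ⟨w, hw⟩ := hc (d - i) (by omega) (by omega)
    obtain ⟨x, rfl⟩ := e.surjective w
    rw [degree_apply_isDeletion] at hw
    refine ⟨x, fun hh => x.2 (Finset.mem_coe.2 hh), ?_⟩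
    have h1 := degree_eq_degIn_add (G := G) T x
    rw [hd] at h1
    omega
  · rw [hd v]; omega
  -- Since d = Δ(H) < k, the complementary degree n - 1 - d is at least n - k = m.
  · have := H.maxDegree_lt_card_verts
    rw [degree_compl, hd v]
    omega

/-- The first half of the classification: up to complementation, exactly two vertices are deleted,
and `G` has diameter two and girth five. -/
lemma isMoore_of_arrows {d : ℕ} (hW : 0 < Fintype.card W)
    (hcard : Fintype.card W + 2 ≤ Fintype.card V) (h : Arrows G H) (hb : BoundedBy G H)
    (hc : HasConsecutiveDegrees H) (hd : G.IsRegularOfDegree d) :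
    Fintype.card V = Fintype.card W + 2 ∧ (∀ v, 2 ≤ Gᶜ.degree v) ∧
    ((IsMoore G ∧ ∀ a b, a ≠ b → ¬ G.Adj a b → IsDeletion G H {a, b}) ∨
      (IsMoore Gᶜ ∧ ∀ a b, a ≠ b → ¬ Gᶜ.Adj a b → IsDeletion Gᶜ Hᶜ {a, b})) := by
  obtain ⟨m, hm⟩ := Nat.exists_eq_add_of_le hcard
  rw [add_assoc] at hm
  have hF := goodFamily_isDeletion hm (by omega) hW h hb hc hd
  generalize hτ : (2 + m) * d - (Fintype.card W * d - ∑ w, H.degree w) = τ at hF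
  obtain ⟨S, -, hS⟩ := Finset.exists_subset_card_eq (s := (Finset.univ : Finset V))
    (n := 2 + m + 1) (by rw [Finset.card_univ]; omega)
  obtain ⟨T, -, hT⟩ := hF.exists_subset S hS
  have hm3 := hF.card_lt_three hT
  obtain rfl : m = 0 := by omega
  refine ⟨by omega, hF.le_degree_compl, ?_⟩
  obtain ⟨x, y, hxy, rfl⟩ := Finset.card_eq_two.1 (hF.card_eq T hT)
  have h1 := hF.degSum_eq _ hT
  rw [degSum_insert G (by simp [hxy])] at h1
  simp only [degSum, degIn_eq_sum, Finset.sum_singleton, SimpleGraph.irrefl, if_false] at h1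
  have hF2 := hF.compl
  -- A deletable pair has degree sum 2 or 0; in the first case the complement has a family with 2 ·
  -- 2 - 2 - 2 = 0.
  by_cases hadj : G.Adj y x
  · rw [if_pos hadj] at h1
    norm_num at h1
    subst h1
    norm_num at hF2
    obtain ⟨h2, h3⟩ := hF2.isMoore
    exact Or.inr ⟨h2, fun a b hab hn => (h3 a b hab hn).compl⟩
  · rw [if_neg hadj] at h1
    norm_num at h1
    subst h1
    exact Or.inl hF.isMoore

end

/-! ### Eigenvalues: the Hoffman–Singleton theorem -/

/-- The trace of an idempotent real matrix is a natural number. -/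
lemma exists_nat_trace_of_idempotent {V : Type*} [Fintype V] [DecidableEq V] (E : Matrix V V ℝ)
    (hE : E * E = E) : ∃ r : ℕ, E.trace = r := by
  have h : IsIdempotentElem (Matrix.toLin' E) := by
    unfold IsIdempotentElem
    rw [Module.End.mul_eq_comp, ← Matrix.toLin'_mul, hE]
  have h2 := (LinearMap.IsIdempotentElem.isProj_range _ h).trace
  rw [Matrix.trace_toLin'_eq] at h2
  exact ⟨_, h2⟩

section

variable {V : Type*} [Fintype V] [DecidableEq V] {G : SimpleGraph V} [DecidableRel G.Adj] {d : ℕ}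

/-- Entries of A² count common neighbors: d on the diagonal, 0 for adjacent and 1 for nonadjacent
pairs. -/
lemma IsMoore.adjMatrix_sq (h : IsMoore G) (hd : G.IsRegularOfDegree d) :
    G.adjMatrix ℝ * G.adjMatrix ℝ =
      ((d : ℝ) - 1) • (1 : Matrix V V ℝ) + Matrix.of (fun _ _ => (1 : ℝ)) - G.adjMatrix ℝ := by
  ext i j
  rw [adjMatrix_mul_apply]
  simp only [Matrix.sub_apply, Matrix.add_apply, Matrix.smul_apply, Matrix.of_apply,
    adjMatrix_apply, Matrix.one_apply, smul_eq_mul]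
  rw [Finset.sum_boole]
  rcases eq_or_ne i j with rfl | hij
  · have : (G.neighborFinset i).filter (fun k => G.Adj k i) = G.neighborFinset i :=
      Finset.filter_true_of_mem fun k hk => ((mem_neighborFinset _ _ _).1 hk).symm
    rw [this, card_neighborFinset_eq_degree, hd i]
    simp
  · by_cases hadj : G.Adj i j
    · have : (G.neighborFinset i).filter (fun k => G.Adj k j) = ∅ :=
        Finset.filter_false_of_mem fun k hk hkj =>
          h.not_adj _ _ _ ((mem_neighborFinset _ _ _).1 hk) hkj hadj
      rw [this]
      simp [hij, hadj]
    · obtain ⟨k, hik, hjk⟩ := h.exists_common i j hij hadj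
      have : (G.neighborFinset i).filter (fun k => G.Adj k j) = {k} := by
        ext l
        simp only [Finset.mem_filter, mem_neighborFinset, Finset.mem_singleton]
        constructor
        · rintro ⟨h1, h2⟩
          exact h.common_unique i j l k hij h1 h2.symm hik hjk
        · rintro rfl
          exact ⟨hik, hjk.symm⟩
      rw [this]
      simp [hij, hadj]

lemma IsMoore.card_eq (h : IsMoore G) (hd : G.IsRegularOfDegree d) [Nonempty V] :
    Fintype.card V = d * d + 1 := by
  obtain ⟨i⟩ := ‹Nonempty V›
  have h1 := congrFun (congrArg (fun M => M.mulVec (fun _ : V => (1 : ℝ))) (h.adjMatrix_sq hd)) i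
  simp only [← Matrix.mulVec_mulVec, Matrix.sub_mulVec, Matrix.add_mulVec, Matrix.smul_mulVec,
    Matrix.one_mulVec] at h1
  have h2 : (G.adjMatrix ℝ).mulVec (fun _ : V => (1 : ℝ)) = fun _ => (d : ℝ) := by
    ext v
    exact (adjMatrix_mulVec_const_apply_of_regular hd).trans (mul_one _)
  have h3 : (G.adjMatrix ℝ).mulVec (fun _ : V => (d : ℝ)) = fun _ => (d : ℝ) * d := by
    ext v
    exact adjMatrix_mulVec_const_apply_of_regular hd
  rw [h2, h3] at h1
  simp [Matrix.mulVec, dotProduct] at h1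
  have : (Fintype.card V : ℝ) = d * d + 1 := by linarith
  exact_mod_cast this

/-- The projection onto the eigenspace of a nontrivial eigenvalue of a Moore graph. -/
noncomputable def mooreProj (G : SimpleGraph V) [DecidableRel G.Adj] (d : ℕ) (s : ℝ) :
    Matrix V V ℝ :=
  s⁻¹ • (G.adjMatrix ℝ + ((1 + s) / 2) • (1 : Matrix V V ℝ) -
    ((d + (1 + s) / 2) / (d * d + 1)) • Matrix.of (fun _ _ => (1 : ℝ)))

/-- Orthogonally to the constant vector, A satisfies θ² + θ = d - 1, with roots (-1 ± s)/2 differing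
by s. The matrix (A + (1 + s)/2 · I)/s is the interpolation projection onto the larger root there;
the J term removes its value on constants. -/
lemma IsMoore.mooreProj_mul_self (h : IsMoore G) (hd : G.IsRegularOfDegree d) [Nonempty V]
    {s : ℝ} (hs : s ≠ 0) (hs2 : s * s = 4 * d - 3) :
    mooreProj G d s * mooreProj G d s = mooreProj G d s := by
  have hn := h.card_eq hd
  have hsq := h.adjMatrix_sq hd
  have hAJ : G.adjMatrix ℝ * Matrix.of (fun _ _ => (1 : ℝ)) =
      (d : ℝ) • Matrix.of (fun _ _ => (1 : ℝ)) := by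
    ext i j
    simp [adjMatrix_mul_apply, hd i]
  have hJA : Matrix.of (fun _ _ => (1 : ℝ)) * G.adjMatrix ℝ =
      (d : ℝ) • Matrix.of (fun _ _ => (1 : ℝ)) := by
    ext i j
    simp [mul_adjMatrix_apply, hd j]
  have hJJ : Matrix.of (fun _ _ : V => (1 : ℝ)) * Matrix.of (fun _ _ => (1 : ℝ)) =
      ((d : ℝ) * d + 1) • Matrix.of (fun _ _ => (1 : ℝ)) := by
    ext i j
    simp [Matrix.mul_apply, hn]
  unfold mooreProj
  generalize G.adjMatrix ℝ = A at *
  generalize Matrix.of (fun _ _ : V => (1 : ℝ)) = J at *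
  rw [smul_mul_smul_comm]
  simp only [sub_mul, add_mul, mul_sub, mul_add, smul_mul_assoc, mul_smul_comm, hAJ, hJA, hJJ, hsq,
    one_mul, mul_one]
  have hpos : (d : ℝ) * d + 1 ≠ 0 := by positivity
  ext i j
  simp only [Matrix.sub_apply, Matrix.add_apply, Matrix.smul_apply, smul_eq_mul]
  generalize A i j = a
  generalize J i j = c
  generalize (1 : Matrix V V ℝ) i j = e
  have hdd : (d : ℝ) = (s * s + 3) / 4 := by linarith
  rw [hdd] at hpos ⊢
  field_simp
  ring

lemma IsMoore.trace_mooreProj (h : IsMoore G) (hd : G.IsRegularOfDegree d) [Nonempty V]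
    {s : ℝ} (hs : s ≠ 0) :
    2 * s * (mooreProj G d s).trace = (1 + s) * (d * d) - 2 * d := by
  have hn := h.card_eq hd
  unfold mooreProj
  rw [Matrix.trace_smul, Matrix.trace_sub, Matrix.trace_add, Matrix.trace_smul, Matrix.trace_smul,
    trace_adjMatrix, Matrix.trace_one, hn]
  have h1 : Matrix.trace (Matrix.of (fun _ _ : V => (1 : ℝ))) = d * d + 1 := by
    simp [Matrix.trace, hn]
  rw [h1]
  have hpos : (d : ℝ) * d + 1 ≠ 0 := by positivity
  simp only [smul_eq_mul]
  push_cast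
  field_simp
  ring

/-- The Hoffman–Singleton theorem. -/
theorem IsMoore.degree_cases (h : IsMoore G) (hd : G.IsRegularOfDegree d) [Nonempty V]
    (h2 : 2 ≤ d) : d = 2 ∨ d = 3 ∨ d = 7 ∨ d = 57 := by
  have hd2 : (2 : ℝ) ≤ d := by exact_mod_cast h2
  set s := Real.sqrt (4 * d - 3) with hsdef
  have hs2 : s * s = 4 * d - 3 := Real.mul_self_sqrt (by linarith)
  have hs : s ≠ 0 := by
    intro h0
    rw [h0] at hs2
    linarith
  obtain ⟨r, hr⟩ := exists_nat_trace_of_idempotent _ (h.mooreProj_mul_self hd hs hs2)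
  have htr := h.trace_mooreProj hd hs
  rw [hr] at htr
  have hkey : (d : ℝ) * d - 2 * d = s * (2 * r - d * d) := by linarith
  by_cases hdt : d = 2
  · exact Or.inl hdt
  have hsq : (((d * d - 2 * d : ℤ) : ℝ)) ^ 2 =
      ((4 * d - 3 : ℤ) : ℝ) * ((2 * r - d * d : ℤ) : ℝ) ^ 2 := by
    push_cast
    rw [hkey, mul_pow, sq s, hs2]
  have hsq' : (d * d - 2 * d : ℤ) ^ 2 = (4 * d - 3) * (2 * r - d * d) ^ 2 := by exact_mod_cast hsq
  -- Integrality: 2r - d² divides d² - 2d, and the quotient t is an integer square root of 4d - 3.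
  -- The case d = 2 was split off because both sides vanish there.
  obtain ⟨t, ht⟩ := (Int.pow_dvd_pow_iff two_ne_zero).1 (Dvd.intro_left _ hsq'.symm)
  have hX : (0 : ℤ) < d * d - 2 * d := by
    have : (3 : ℤ) ≤ d := by omega
    nlinarith
  have hY : (2 * r - d * d : ℤ) ≠ 0 := by
    intro h0
    rw [h0] at ht
    omega
  have htt : t ^ 2 = 4 * d - 3 := by
    rw [ht, mul_pow, mul_comm] at hsq'
    exact mul_right_cancel₀ (pow_ne_zero 2 hY) hsq'
  -- Substituting 4d = t² + 3 gives 16(d² - 2d) = t⁴ - 2t² - 15, and the left side is a multiple of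
  -- t.
  have hdvd : t ∣ 15 := by
    refine ⟨t ^ 3 - 2 * t - 16 * (2 * r - d * d), ?_⟩
    have h4 : (4 * d : ℤ) = t ^ 2 + 3 := by omega
    have h16 : 16 * ((d : ℤ) * d - 2 * d) = t ^ 4 - 2 * t ^ 2 - 15 := by
      have : 16 * ((d : ℤ) * d - 2 * d) = (4 * d) * (4 * d) - 8 * (4 * d) := by ring
      rw [this, h4]; ring
    rw [ht] at h16
    linarith [h16]
  have habs : t.natAbs ∣ 15 := by
    have := Int.natAbs_dvd_natAbs.2 hdvd
    simpa using this
  have hdiv : t.natAbs ∈ Nat.divisors 15 := Nat.mem_divisors.2 ⟨habs, by norm_num⟩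
  have hdl : Nat.divisors 15 = {1, 3, 5, 15} := by decide
  rw [hdl] at hdiv
  have htn : ((t.natAbs : ℤ)) ^ 2 = 4 * d - 3 := by rw [Int.natAbs_sq, htt]
  simp only [Finset.mem_insert, Finset.mem_singleton] at hdiv
  rcases hdiv with h0 | h0 | h0 | h0 <;> rw [h0] at htn <;> norm_num at htn <;> omega

/-- For an involutory automorphism `σ` of a Moore graph, the trace of `σ` on the eigenspace is an
integer. -/
lemma IsMoore.exists_int_involution (h : IsMoore G) (hd : G.IsRegularOfDegree d) [Nonempty V]
    {s : ℝ} (hs : s ≠ 0) (hs2 : s * s = 4 * d - 3) (σ : G ≃g G) (hσ : ∀ v, σ (σ v) = v) :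
    ∃ z : ℤ, s * z = (Finset.univ.filter fun v => G.Adj v (σ v)).card +
      (1 + s) / 2 * (Finset.univ.filter fun v => σ v = v).card - (d + (1 + s) / 2) := by
  have hE := h.mooreProj_mul_self hd hs hs2
  set E := mooreProj G d s with hEdef
  have hinv : ∀ i j, E (σ i) (σ j) = E i j := by
    intro i j
    simp only [hEdef, mooreProj, Matrix.smul_apply, Matrix.sub_apply, Matrix.add_apply,
      adjMatrix_apply, Matrix.one_apply, σ.injective.eq_iff, σ.map_adj_iff, Matrix.of_apply]
  have hEE : ∀ i j, ∑ k, E i k * E k j = E i j := by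
    intro i j
    rw [← Matrix.mul_apply, hE]
  -- F is E times the permutation matrix of σ. As σ is an involution commuting with E, (E + F)/2 is
  -- again idempotent, so the trace of F is 2q - r with natural numbers q and r.
  set F : Matrix V V ℝ := Matrix.of fun i j => E i (σ j) with hF
  set M : Matrix V V ℝ := (1 / 2 : ℝ) • (E + F) with hM
  have hEF : E * F = F := by
    ext i j
    simp only [Matrix.mul_apply, hF, Matrix.of_apply, hEE]
  have hFE : F * E = F := by
    ext i j
    simp only [Matrix.mul_apply, hF, Matrix.of_apply]
    refine (Finset.sum_congr rfl fun k _ => ?_).trans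
      ((Equiv.sum_comp σ.toEquiv fun k => E i k * E k (σ j)).trans (hEE i (σ j)))
    exact congrArg _ (hinv k j).symm
  have hFF : F * F = E := by
    ext i j
    simp only [Matrix.mul_apply, hF, Matrix.of_apply]
    refine (Finset.sum_congr rfl fun k _ => ?_).trans
      ((Equiv.sum_comp σ.toEquiv fun k => E i k * E k j).trans (hEE i j))
    have := hinv (σ k) j
    rw [hσ] at this
    exact congrArg _ this
  have hMM : M * M = M := by
    rw [hM, smul_mul_smul_comm, add_mul, mul_add, mul_add, hE, hEF, hFE, hFF]
    ext i j
    simp only [Matrix.smul_apply, Matrix.add_apply, smul_eq_mul]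
    ring
  obtain ⟨r, hr⟩ := exists_nat_trace_of_idempotent E hE
  obtain ⟨q, hq⟩ := exists_nat_trace_of_idempotent M hMM
  rw [hM, Matrix.trace_smul, Matrix.trace_add, hr] at hq
  have hn := h.card_eq hd
  have hFt : s * F.trace = (Finset.univ.filter fun v => G.Adj v (σ v)).card +
      (1 + s) / 2 * (Finset.univ.filter fun v => σ v = v).card - (d + (1 + s) / 2) := by
    have hpos : (d : ℝ) * d + 1 ≠ 0 := by positivity
    simp only [Matrix.trace, hF, Matrix.diag_apply, Matrix.of_apply, hEdef, mooreProj,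
      Matrix.smul_apply, Matrix.sub_apply, Matrix.add_apply, adjMatrix_apply, Matrix.one_apply,
      smul_eq_mul]
    rw [← Finset.mul_sum, ← mul_assoc, mul_inv_cancel₀ hs, one_mul, Finset.sum_sub_distrib,
      Finset.sum_add_distrib, Finset.sum_boole, ← Finset.mul_sum, Finset.sum_boole,
      Finset.sum_const, Finset.card_univ, hn]
    simp only [eq_comm (b := σ _)]
    simp only [nsmul_eq_mul]
    push_cast
    field_simp
  refine ⟨2 * q - r, ?_⟩
  rw [← hFt]
  push_cast
  congr 1
  simp only [smul_eq_mul] at hq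
  linarith

end

/-! ### Extending isomorphisms of deletions; counting nonadjacent pairs -/

section

variable {V : Type*} [Fintype V] [DecidableEq V] {G : SimpleGraph V} [DecidableRel G.Adj] {d : ℕ}

omit [Fintype V] in
lemma degIn_pair {x y : V} (hxy : x ≠ y) (u : V) :
    degIn G {x, y} u = (if G.Adj u x then 1 else 0) + if G.Adj u y then 1 else 0 := by
  rw [degIn_eq_sum, Finset.sum_pair hxy]
  simp only [G.adj_comm]

/-- Every vertex has degree d in G, so its degree after deletion determines how many neighbors it
lost, and isomorphisms preserve that degree. -/
lemma degIn_iso {T T' : Finset V} (hd : G.IsRegularOfDegree d)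
    (e : G.induce ((T : Set V)ᶜ) ≃g G.induce ((T' : Set V)ᶜ)) (u : ((T : Set V)ᶜ : Set V)) :
    degIn G T' (e u) = degIn G T u := by
  have h1 := degree_apply_isDeletion e u
  have h2 : (G.induce ((T' : Set V)ᶜ)).degree (e u) = degIn G T'ᶜ (e u) :=
    degree_apply_isDeletion (RelIso.refl (G.induce ((T' : Set V)ᶜ)).Adj) (e u)
  have h3 := degree_eq_degIn_add (G := G) T u
  have h4 := degree_eq_degIn_add (G := G) T' (e u)
  rw [hd] at h3 h4
  omega

/-- The number of deleted neighbors is preserved, so only vertices with exactly one could go wrong.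
Two vertices whose common neighbor is x have none left after deletion. Hence any u attached to x
alone must land on the same side as u₀, since otherwise the common neighbor of the images of u and
u₀ would survive. The separate T' allows the roles of x' and y' to be exchanged. -/
lemma IsMoore.extend_aux (h : IsMoore G) (hd : G.IsRegularOfDegree d) {x y x' y' : V}
    (hxy : x ≠ y) (hn : ¬ G.Adj x y) (hxy' : x' ≠ y') (hn' : ¬ G.Adj x' y')
    {T' : Finset V} (hT' : T' = {x', y'})
    (e : G.induce ((({x, y} : Finset V) : Set V)ᶜ) ≃g G.induce ((T' : Set V)ᶜ))
    (u₀ : ((({x, y} : Finset V) : Set V)ᶜ : Set V)) (hx0 : G.Adj u₀ x) (hy0 : ¬ G.Adj u₀ y)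
    (hx0' : G.Adj (e u₀) x') (hy0' : ¬ G.Adj (e u₀) y') :
    ∃ φ : G ≃g G, φ x = x' ∧ φ y = y' := by
  subst hT'
  have hne : ∀ u : ((({x, y} : Finset V) : Set V)ᶜ : Set V), (u : V) ≠ x ∧ (u : V) ≠ y := by
    intro u
    have := u.2
    simpa [not_or] using this
  have hne' : ∀ u : ((({x', y'} : Finset V) : Set V)ᶜ : Set V), (u : V) ≠ x' ∧ (u : V) ≠ y' := by
    intro u
    have := u.2
    simpa [not_or] using this
  have hadj : ∀ u v, G.Adj (e u) (e v) ↔ G.Adj u v := fun u v => e.map_adj_iff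
  have hinj : ∀ u v, (e u : V) = e v ↔ (u : V) = v := fun u v => by
    rw [← Subtype.ext_iff, e.injective.eq_iff, Subtype.ext_iff]
  have key : ∀ u : ((({x, y} : Finset V) : Set V)ᶜ : Set V), (G.Adj u x ↔ G.Adj (e u) x') ∧ (G.Adj u y ↔ G.Adj (e u) y') := by
    intro u
    have hdeg := degIn_iso hd e u
    rw [degIn_pair hxy, degIn_pair hxy'] at hdeg
    have c1 : ¬ (G.Adj u x ∧ ¬ G.Adj u y ∧ ¬ G.Adj (e u) x' ∧ G.Adj (e u) y') := by
      rintro ⟨h1, h2, h3, h4⟩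
      have hnadj : ¬ G.Adj u u₀ := h.not_adj _ _ _ h1 hx0.symm
      have huu : (e u : V) ≠ e u₀ := fun hh => h3 (hh ▸ hx0')
      obtain ⟨w, hw1, hw2⟩ := h.exists_common _ _ huu (by rwa [hadj])
      obtain ⟨w', hw'⟩ := e.surjective ⟨w, by
        simp only [Finset.coe_insert, Finset.coe_singleton, Set.mem_compl_iff, Set.mem_insert_iff,
          Set.mem_singleton_iff, not_or]
        exact ⟨fun hh => h3 (hh ▸ hw1), fun hh => hy0' (hh ▸ hw2)⟩⟩
      have hw'' : (e w' : V) = w := by rw [hw']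
      rw [← hw'', hadj] at hw1 hw2
      exact (hne w').1 (h.common_unique _ _ _ _ (fun hh => huu ((hinj _ _).2 hh)) hw1 hw2 h1 hx0)
    have c2 : ¬ (¬ G.Adj u x ∧ G.Adj u y ∧ G.Adj (e u) x' ∧ ¬ G.Adj (e u) y') := by
      rintro ⟨h1, h2, h3, h4⟩
      have hnadj : ¬ G.Adj (e u) (e u₀) := h.not_adj _ _ _ h3 hx0'.symm
      rw [hadj] at hnadj
      have huu : (u : V) ≠ u₀ := fun hh => h1 (hh ▸ hx0)
      obtain ⟨w, hw1, hw2⟩ := h.exists_common _ _ huu hnadj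
      have hwmem : w ∈ ((({x, y} : Finset V) : Set V)ᶜ : Set V) := by
        simp only [Finset.coe_insert, Finset.coe_singleton, Set.mem_compl_iff, Set.mem_insert_iff,
          Set.mem_singleton_iff, not_or]
        exact ⟨fun hh => h1 (hh ▸ hw1), fun hh => hy0 (hh ▸ hw2)⟩
      have hw1' := (hadj u ⟨w, hwmem⟩).2 hw1
      have hw2' := (hadj u₀ ⟨w, hwmem⟩).2 hw2
      exact (hne' _).1 (h.common_unique _ _ _ _ (fun hh => huu ((hinj _ _).1 hh)) hw1' hw2' h3 hx0')
    split_ifs at hdeg <;> first | omega | tauto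
  have hmem : ∀ v, v ≠ x → v ≠ y → v ∈ ((({x, y} : Finset V) : Set V)ᶜ : Set V) := by
    intro v h1 h2
    simp [h1, h2]
  obtain ⟨φ, hφ⟩ : ∃ φ : V → V, φ x = x' ∧ φ y = y' ∧
      ∀ v : ((({x, y} : Finset V) : Set V)ᶜ : Set V), φ v = e v := by
    refine ⟨fun v => if hx : v = x then x' else if hy : v = y then y' else
      e ⟨v, hmem v hx hy⟩, by simp, by simp [hxy.symm], fun v => ?_⟩
    simp [(hne v).1, (hne v).2]
  obtain ⟨hφx, hφy, hφe⟩ := hφ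
  have hcases : ∀ v, v = x ∨ v = y ∨ ∃ u : ((({x, y} : Finset V) : Set V)ᶜ : Set V), v = u := by
    intro v
    by_cases h1 : v = x
    · exact Or.inl h1
    by_cases h2 : v = y
    · exact Or.inr (Or.inl h2)
    · exact Or.inr (Or.inr ⟨⟨v, hmem v h1 h2⟩, rfl⟩)
  have hφinj : Function.Injective φ := by
    intro a b hab
    rcases hcases a with rfl | rfl | ⟨a, rfl⟩ <;> rcases hcases b with rfl | rfl | ⟨b, rfl⟩ <;>
      simp only [hφx, hφy, hφe] at hab
    · rfl
    · exact absurd hab hxy'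
    · exact absurd hab.symm (hne' _).1
    · exact absurd hab.symm hxy'
    · rfl
    · exact absurd hab.symm (hne' _).2
    · exact absurd hab (hne' _).1
    · exact absurd hab (hne' _).2
    · exact (hinj _ _).1 hab
  have hn2 : ¬ G.Adj y x := fun hh => hn hh.symm
  have hn2' : ¬ G.Adj y' x' := fun hh => hn' hh.symm
  refine ⟨⟨Equiv.ofBijective φ (Finite.injective_iff_bijective.1 hφinj), ?_⟩, hφx, hφy⟩
  intro a b
  simp only [Equiv.ofBijective_apply]
  rcases hcases a with rfl | rfl | ⟨a, rfl⟩ <;> rcases hcases b with rfl | rfl | ⟨b, rfl⟩ <;>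
    simp only [hφx, hφy, hφe, SimpleGraph.irrefl, hn, hn', hn2, hn2', hadj]
  · rw [G.adj_comm, ← (key b).1, G.adj_comm]
  · rw [G.adj_comm, ← (key b).2, G.adj_comm]
  · rw [← (key a).1]
  · rw [← (key a).2]

/-- An isomorphism between two subgraphs of a Moore graph obtained by deleting nonadjacent pairs
extends to an automorphism. -/
lemma IsMoore.extend (h : IsMoore G) (hd : G.IsRegularOfDegree d) (h2 : 2 ≤ d) {x y x' y' : V}
    (hxy : x ≠ y) (hn : ¬ G.Adj x y) (hxy' : x' ≠ y') (hn' : ¬ G.Adj x' y')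
    (e : G.induce ((({x, y} : Finset V) : Set V)ᶜ) ≃g
      G.induce ((({x', y'} : Finset V) : Set V)ᶜ)) :
    ∃ φ : G ≃g G, (φ x = x' ∧ φ y = y') ∨ (φ x = y' ∧ φ y = x') := by
  obtain ⟨z, hz1, hz2⟩ := h.exists_common x y hxy hn
  -- Since d ≥ 2, x has a neighbor other than its common neighbor with y; it is attached to x alone
  -- and decides which of x', y' is the image of x.
  obtain ⟨u, hu, huz⟩ : ∃ u ∈ G.neighborFinset x, u ≠ z := by
    refine Finset.exists_mem_ne ?_ z
    rw [card_neighborFinset_eq_degree, hd]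
    omega
  rw [mem_neighborFinset] at hu
  have huy : ¬ G.Adj u y := fun hh => huz (h.common_unique x y u z hxy hu hh.symm hz1 hz2)
  have hmem : u ∈ ((({x, y} : Finset V) : Set V)ᶜ : Set V) := by
    simp only [Finset.coe_insert, Finset.coe_singleton, Set.mem_compl_iff, Set.mem_insert_iff,
      Set.mem_singleton_iff, not_or]
    exact ⟨hu.ne.symm, fun hh => hn (hh ▸ hu)⟩
  have hdeg := degIn_iso hd e ⟨u, hmem⟩
  rw [degIn_pair hxy, degIn_pair hxy', if_pos hu.symm, if_neg huy] at hdeg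
  by_cases hx' : G.Adj (e ⟨u, hmem⟩) x'
  · have hy' : ¬ G.Adj (e ⟨u, hmem⟩) y' := by
      intro hh
      rw [if_pos hx', if_pos hh] at hdeg
      omega
    obtain ⟨φ, hφ⟩ := h.extend_aux hd hxy hn hxy' hn' rfl e ⟨u, hmem⟩ hu.symm huy hx' hy'
    exact ⟨φ, Or.inl hφ⟩
  · have hy' : G.Adj (e ⟨u, hmem⟩) y' := by
      by_contra hh
      rw [if_neg hx', if_neg hh] at hdeg
      omega
    obtain ⟨φ, hφ⟩ := h.extend_aux hd hxy hn hxy'.symm (fun hh => hn' hh.symm)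
      (Finset.pair_comm x' y') e ⟨u, hmem⟩ hu.symm huy hy' hx'
    exact ⟨φ, Or.inr hφ⟩

/-- The automorphism group of a graph acts on pairs of vertices. -/
instance autMulAction (G : SimpleGraph V) : MulAction (G ≃g G) (Sym2 V) where
  smul φ e := e.map φ
  one_smul e := by
    change e.map id = e
    rw [Sym2.map_id]; rfl
  mul_smul φ ψ e := by
    change e.map (φ ∘ ψ) = (e.map ψ).map φ
    rw [Sym2.map_map]

/-- If the automorphism group is transitive on nonadjacent pairs, then their number divides the
order of the group. -/
lemma card_edgeFinset_compl_dvd (ht : IsEdgeTransitive Gᶜ) (hne : Gᶜ ≠ ⊥) :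
    Gᶜ.edgeFinset.card ∣ Nat.card (G ≃g G) := by
  obtain ⟨x, y, hxy⟩ := ne_bot_iff_exists_adj.1 hne
  have horb : MulAction.orbit (G ≃g G) s(x, y) = Gᶜ.edgeSet := by
    ext e
    induction e using Sym2.ind with
    | _ a b =>
      rw [mem_edgeSet]
      constructor
      · rintro ⟨φ, hφ⟩
        have hφ' : s(φ x, φ y) = s(a, b) := hφ
        rw [← mem_edgeSet, ← hφ', mem_edgeSet]
        exact (complIso φ).map_adj_iff.2 hxy
      · intro hab
        obtain ⟨φ, hφ⟩ := ht x y a b hxy hab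
        refine ⟨⟨φ.toEquiv, ?_⟩, ?_⟩
        · intro u v
          have h1 : Gᶜᶜ.Adj (φ u) (φ v) ↔ Gᶜᶜ.Adj u v := (complIso φ).map_adj_iff
          rwa [compl_compl] at h1
        · change s(φ x, φ y) = s(a, b)
          rw [Sym2.eq_iff]
          exact hφ
  have h1 := MulAction.index_stabilizer (G ≃g G) s(x, y)
  rw [horb, ← coe_edgeFinset, Set.ncard_coe_finset] at h1
  rw [← h1]
  exact Subgroup.index_dvd_card _

lemma IsMoore.two_mul_card_edgeFinset_compl (h : IsMoore G) (hd : G.IsRegularOfDegree d)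
    [Nonempty V] : 2 * Gᶜ.edgeFinset.card = (d * d + 1) * (d * d - d) := by
  rw [← sum_degrees_eq_twice_card_edges, ← h.card_eq hd]
  simp only [degree_compl, hd.degree_eq, h.card_eq hd]
  rw [Finset.sum_const, Finset.card_univ, h.card_eq hd, smul_eq_mul]
  rfl

lemma IsMoore.card_edges_dvd (h : IsMoore G) (hd : G.IsRegularOfDegree d) [Nonempty V]
    (h2 : 2 ≤ d) (ht : IsEdgeTransitive Gᶜ) :
    (d * d + 1) * (d * d - d) / 2 ∣ Nat.card (G ≃g G) := by
  have h1 := h.two_mul_card_edgeFinset_compl hd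
  rw [← h1, Nat.mul_div_cancel_left _ (by norm_num)]
  refine card_edgeFinset_compl_dvd ht ?_
  intro hbot
  have h3 : Gᶜ.edgeFinset.card = 0 := by
    rw [Finset.card_eq_zero, edgeFinset_eq_empty]
    exact hbot
  rw [h3] at h1
  have h4 : 0 < d * d - d := Nat.sub_pos_of_lt (by nlinarith)
  have := Nat.mul_pos (Nat.succ_pos (d * d)) h4
  exact absurd h1 (by simpa using this.ne)

/-- If all deletions of nonadjacent pairs from a Moore graph are isomorphic, then the complement
is edge-transitive. -/
lemma IsMoore.isEdgeTransitive_compl (h : IsMoore G) (hd : G.IsRegularOfDegree d) (h2 : 2 ≤ d)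
    {W : Type*} {H : SimpleGraph W} (hdel : ∀ a b, a ≠ b → ¬ G.Adj a b → IsDeletion G H {a, b}) :
    IsEdgeTransitive Gᶜ := by
  intro x₁ y₁ x₂ y₂ h1 h2'
  rw [compl_adj] at h1 h2'
  obtain ⟨e₁⟩ := hdel _ _ h1.1 h1.2
  obtain ⟨e₂⟩ := hdel _ _ h2'.1 h2'.2
  obtain ⟨φ, hφ⟩ := h.extend hd h2 h1.1 h1.2 h2'.1 h2'.2 (e₁.trans e₂.symm)
  exact ⟨complIso φ, hφ⟩

end

/-! ### Involutions of Moore graphs; excluding degree 57 -/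

section

variable {V : Type*} [Fintype V] [DecidableEq V] {G : SimpleGraph V} [DecidableRel G.Adj] {d : ℕ}

lemma card_eq_of_unique {α β : Type*} (r : α → β → Prop) {s : Finset α}
    {t : Finset β} (hs : ∀ a ∈ s, ∃! b, b ∈ t ∧ r a b) (ht : ∀ b ∈ t, ∃! a, a ∈ s ∧ r a b) :
    s.card = t.card := by
  classical
  have h := Finset.card_mul_eq_card_mul r (s := s) (t := t) (m := 1) (n := 1)
    (fun a ha => by
      obtain ⟨b, hb, hu⟩ := hs a ha
      refine Finset.card_eq_one.2 ⟨b, ?_⟩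
      ext c
      simp only [Finset.bipartiteAbove, Finset.mem_filter, Finset.mem_singleton]
      exact ⟨hu c, fun hh => hh ▸ hb⟩)
    (fun b hb => by
      obtain ⟨a, ha, hu⟩ := ht b hb
      refine Finset.card_eq_one.2 ⟨a, ?_⟩
      ext c
      simp only [Finset.bipartiteBelow, Finset.mem_filter, Finset.mem_singleton]
      exact ⟨hu c, fun hh => hh ▸ ha⟩)
  simpa using h

omit [Fintype V] [DecidableEq V] [DecidableRel G.Adj] in
/-- A vertex that an involution moves to a nonadjacent vertex has a unique fixed neighbor. -/
lemma IsMoore.exists_fixed_neighbor (h : IsMoore G) {σ : G ≃g G} (hσ : ∀ v, σ (σ v) = v) {u : V}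
    (h1 : σ u ≠ u) (h2 : ¬ G.Adj u (σ u)) :
    ∃ y, σ y = y ∧ G.Adj u y ∧ ∀ y', σ y' = y' → G.Adj u y' → y' = y := by
  obtain ⟨y, hy1, hy2⟩ := h.exists_common u (σ u) h1.symm h2
  have hs : ∀ w, G.Adj u w → G.Adj (σ u) (σ w) := fun w hw => σ.map_adj_iff.2 hw
  have hy3 := hs _ hy1
  have hy4 : G.Adj u (σ y) := by
    have := σ.map_adj_iff.2 hy2
    rwa [hσ] at this
  refine ⟨y, h.common_unique u (σ u) _ _ h1.symm hy4 hy3 hy1 hy2, hy1, ?_⟩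
  intro y' hf hy'
  have := hs _ hy'
  rw [hf] at this
  exact h.common_unique u (σ u) _ _ h1.symm hy' this hy1 hy2

/-- If an involution maps some vertex to a neighbor, then it has exactly `d - 1` fixed vertices. -/
lemma IsMoore.card_fixed_of_adj (h : IsMoore G) (hd : G.IsRegularOfDegree d) {σ : G ≃g G}
    (hσ : ∀ v, σ (σ v) = v) {x : V} (hx : G.Adj x (σ x)) :
    (Finset.univ.filter fun v => σ v = v).card = d - 1 := by
  have hcard : ((G.neighborFinset x).erase (σ x)).card = d - 1 := by
    rw [Finset.card_erase_of_mem (by rwa [mem_neighborFinset]), card_neighborFinset_eq_degree, hd]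
  have hsx : G.Adj (σ x) x := hx.symm
  rw [← hcard]
  symm
  -- Adjacency matches the neighbors of x other than σ x with the fixed vertices: such a neighbor is
  -- moved to a nonadjacent vertex, so it has one fixed neighbor, and a fixed vertex has one common
  -- neighbor with x.
  refine card_eq_of_unique G.Adj ?_ ?_
  · intro u hu
    rw [Finset.mem_erase, mem_neighborFinset] at hu
    obtain ⟨hux, hxu⟩ := hu
    have hsu : G.Adj (σ x) (σ u) := σ.map_adj_iff.2 hxu
    have hmove : σ u ≠ u := by
      intro hh
      rw [hh] at hsu
      exact h.not_adj _ _ _ hx hsu hxu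
    have hxsu : x ≠ σ u := by
      intro hh
      apply hux
      rw [hh, hσ]
    have hnadj : ¬ G.Adj u (σ u) := by
      intro hh
      exact hux (h.common_unique x (σ u) u (σ x) hxsu hxu hh.symm hx hsu.symm)
    obtain ⟨y, hy1, hy2, hy3⟩ := h.exists_fixed_neighbor hσ hmove hnadj
    refine ⟨y, ⟨by simpa using hy1, hy2⟩, ?_⟩
    rintro y' ⟨hf, hy'⟩
    exact hy3 y' (by simpa using hf) hy'
  · intro y hy
    have hy : σ y = y := by simpa using hy
    have hyx : x ≠ y := by
      rintro rfl
      rw [hy] at hx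
      exact G.irrefl hx
    have hnsx : ¬ G.Adj (σ x) y := by
      intro hh
      have h3 := σ.map_adj_iff.2 hh
      rw [hσ, hy] at h3
      exact h.not_adj _ _ _ hx hh h3
    have hnx : ¬ G.Adj x y := by
      intro hh
      have h3 := σ.map_adj_iff.2 hh
      rw [hy] at h3
      exact hnsx h3
    obtain ⟨u, hu1, hu2⟩ := h.exists_common x y hyx hnx
    refine ⟨u, ⟨?_, hu2.symm⟩, ?_⟩
    · rw [Finset.mem_erase, mem_neighborFinset]
      refine ⟨?_, hu1⟩
      rintro rfl
      exact hnsx hu2.symm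
    · rintro u' ⟨hu', hu''⟩
      rw [Finset.mem_erase, mem_neighborFinset] at hu'
      exact h.common_unique x y u' u hyx hu'.2 hu''.symm hu1 hu2

/-- If an involution maps no vertex to a neighbor, and `y` is a fixed vertex with a moved neighbor,
then there are `d - 1` fixed vertices outside the closed neighborhood of `y`. -/
lemma IsMoore.card_fixed_of_not_adj (h : IsMoore G) (hd : G.IsRegularOfDegree d) {σ : G ≃g G}
    (hσ : ∀ v, σ (σ v) = v) (hno : ∀ v, ¬ G.Adj v (σ v)) {y u : V} (hy : σ y = y) (hu : σ u ≠ u)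
    (hyu : G.Adj y u) :
    (Finset.univ.filter fun v => σ v = v ∧ v ≠ y ∧ ¬ G.Adj y v).card = d - 1 := by
  have hcard : ((G.neighborFinset u).erase y).card = d - 1 := by
    rw [Finset.card_erase_of_mem (by rw [mem_neighborFinset]; exact hyu.symm),
      card_neighborFinset_eq_degree, hd]
  obtain ⟨y₀, hy1, hy2, hy3⟩ := h.exists_fixed_neighbor hσ hu (hno u)
  obtain rfl := hy3 y hy hyu.symm
  rw [← hcard]
  symm
  -- Adjacency matches the neighbors of u other than y with the fixed vertices outside the closed
  -- neighborhood of y: y is the only fixed neighbor of u, so the others are moved and have one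
  -- fixed neighbor each.
  refine card_eq_of_unique G.Adj ?_ ?_
  · intro w hw
    rw [Finset.mem_erase, mem_neighborFinset] at hw
    obtain ⟨hwy, huw⟩ := hw
    have hmove : σ w ≠ w := fun hh => hwy (hy3 w hh huw)
    obtain ⟨v, hv1, hv2, hv3⟩ := h.exists_fixed_neighbor hσ hmove (hno w)
    refine ⟨v, ⟨?_, hv2⟩, ?_⟩
    · simp only [Finset.mem_filter, Finset.mem_univ, true_and]
      refine ⟨hv1, ?_, ?_⟩
      · rintro rfl
        exact h.not_adj _ _ _ hyu huw hv2.symm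
      · intro hh
        refine hwy (h.common_unique u v w y ?_ huw hv2.symm hyu.symm hh.symm)
        rintro rfl
        exact hu hv1
    · rintro v' ⟨hv', hwv'⟩
      exact hv3 v' (Finset.mem_filter.1 hv').2.1 hwv'
  · intro v hv
    obtain ⟨hv1, hv2, hv3⟩ := (Finset.mem_filter.1 hv).2
    have huv : u ≠ v := by
      rintro rfl
      exact hu hv1
    have hnuv : ¬ G.Adj u v := fun hh => hv2 (hy3 v hv1 hh)
    obtain ⟨w, hw1, hw2⟩ := h.exists_common u v huv hnuv
    refine ⟨w, ⟨?_, hw2.symm⟩, ?_⟩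
    · rw [Finset.mem_erase, mem_neighborFinset]
      refine ⟨?_, hw1⟩
      rintro rfl
      exact hv3 hw2.symm
    · rintro w' ⟨hw', hw''⟩
      rw [Finset.mem_erase, mem_neighborFinset] at hw'
      exact h.common_unique u v w' w huv hw'.2 hw''.symm hw1 hw2

lemma card_filter_fixed_split (σ : V → V) {y : V} (hy : σ y = y) :
    (Finset.univ.filter fun v => σ v = v).card =
      (Finset.univ.filter fun v => σ v = v ∧ v ≠ y ∧ ¬ G.Adj y v).card +
      (Finset.univ.filter fun v => σ v = v ∧ G.Adj y v).card + 1 := by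
  have h1 : (Finset.univ.filter fun v => σ v = v) =
      (Finset.univ.filter fun v => σ v = v ∧ v ≠ y ∧ ¬ G.Adj y v) ∪
      (Finset.univ.filter fun v => σ v = v ∧ G.Adj y v) ∪ {y} := by
    ext v
    simp only [Finset.mem_filter, Finset.mem_univ, true_and, Finset.mem_union,
      Finset.mem_singleton]
    constructor
    · intro hv
      tauto
    · rintro ((hv | hv) | rfl)
      · exact hv.1
      · exact hv.1
      · exact hy
  rw [h1, Finset.card_union_of_disjoint, Finset.card_union_of_disjoint, Finset.card_singleton]
  · rw [Finset.disjoint_left]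
    intro v hv hv'
    simp only [Finset.mem_filter, Finset.mem_univ, true_and] at hv hv'
    exact hv.2.2 hv'.2
  · rw [Finset.disjoint_singleton_right]
    simp

/-- If an involution maps no vertex to a neighbor, then a fixed vertex with a moved neighbor has
few fixed neighbors. -/
lemma IsMoore.fixed_degree_le (h : IsMoore G) (hd : G.IsRegularOfDegree d) {σ : G ≃g G}
    (hσ : ∀ v, σ (σ v) = v) (hno : ∀ v, ¬ G.Adj v (σ v)) {y u : V} (hy : σ y = y) (hu : σ u ≠ u)
    (hyu : G.Adj y u) (j : ℕ) (hj : (Finset.univ.filter fun v => σ v = v ∧ G.Adj y v).card = j) :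
    j * (j - 1) ≤ d - 1 := by
  have hA := h.card_fixed_of_not_adj hd hσ hno hy hu hyu
  have hsplit := card_filter_fixed_split (G := G) σ hy
  have hjd : j ≤ d := by
    rw [← hj, ← hd y, ← card_neighborFinset_eq_degree]
    refine Finset.card_le_card fun v hv => ?_
    rw [mem_neighborFinset]
    exact (Finset.mem_filter.1 hv).2.2
  -- Every fixed vertex with a moved neighbor has the same number of fixed neighbors, namely the
  -- total minus d; a fixed vertex without one has all d neighbors fixed.
  have hlow : ∀ y', σ y' = y' → j ≤ (Finset.univ.filter fun v => σ v = v ∧ G.Adj y' v).card := by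
    intro y' hy'
    by_cases hm : ∃ u', G.Adj y' u' ∧ σ u' ≠ u'
    · obtain ⟨u', hu1, hu2⟩ := hm
      have h1 := h.card_fixed_of_not_adj hd hσ hno hy' hu2 hu1
      have h2 := card_filter_fixed_split (G := G) σ hy'
      omega
    · push Not at hm
      refine hjd.trans ?_
      rw [← hd y', ← card_neighborFinset_eq_degree]
      refine Finset.card_le_card fun v hv => ?_
      rw [mem_neighborFinset] at hv
      simp [hv, hm v hv]
  rw [← hA]
  -- The j fixed neighbors of y contribute pairwise disjoint sets of at least j - 1 fixed vertices
  -- at distance two from y, of which there are only d - 1.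
  have hdisj : ((Finset.univ.filter fun v => σ v = v ∧ G.Adj y v) : Set V).PairwiseDisjoint
      fun y' => (Finset.univ.filter fun v => σ v = v ∧ G.Adj y' v).erase y := by
    intro a ha b hb hab
    rw [Function.onFun, Finset.disjoint_left]
    intro v hv hv'
    simp only [Finset.coe_filter, Set.mem_ofPred_eq, Finset.mem_univ, true_and] at ha hb
    simp only [Finset.mem_erase, Finset.mem_filter, Finset.mem_univ, true_and] at hv hv'
    exact hv.1 (h.common_unique a b v y hab hv.2.2 hv'.2.2 ha.2.symm hb.2.symm)
  have hsub : (Finset.univ.filter fun v => σ v = v ∧ G.Adj y v).biUnion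
      (fun y' => (Finset.univ.filter fun v => σ v = v ∧ G.Adj y' v).erase y) ⊆
      Finset.univ.filter fun v => σ v = v ∧ v ≠ y ∧ ¬ G.Adj y v := by
    intro v hv
    simp only [Finset.mem_biUnion, Finset.mem_erase, Finset.mem_filter, Finset.mem_univ,
      true_and] at hv ⊢
    obtain ⟨y', ⟨hy1, hy2⟩, hv1, hv2, hv3⟩ := hv
    exact ⟨hv2, hv1, h.not_adj _ _ _ hy2 hv3⟩
  refine le_trans ?_ (Finset.card_le_card hsub)
  rw [Finset.card_biUnion hdisj]
  conv_lhs => rw [← hj]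
  rw [hj]
  have : ∑ y' ∈ Finset.univ.filter (fun v => σ v = v ∧ G.Adj y v), (j - 1) = j * (j - 1) := by
    rw [Finset.sum_const, hj, smul_eq_mul]
  rw [← this]
  refine Finset.sum_le_sum fun y' hy' => ?_
  simp only [Finset.mem_filter, Finset.mem_univ, true_and] at hy'
  rw [Finset.card_erase_of_mem (by simp [hy, hy'.2.symm])]
  exact Nat.sub_le_sub_right (hlow y' hy'.1) 1

/-- An involution of a Moore graph of degree 57 has exactly 56 fixed vertices. -/
lemma IsMoore.card_fixed_involution (h : IsMoore G) (hd : G.IsRegularOfDegree 57) [Nonempty V]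
    {σ : G ≃g G} (hσ : ∀ v, σ (σ v) = v) (hne : ∃ v, σ v ≠ v) :
    (Finset.univ.filter fun v => σ v = v).card = 56 := by
  by_cases hadj : ∃ x, G.Adj x (σ x)
  · obtain ⟨x, hx⟩ := hadj
    exact h.card_fixed_of_adj hd hσ hx
  · push Not at hadj
    exfalso
    obtain ⟨u, hu⟩ := hne
    obtain ⟨y, hy1, hy2, -⟩ := h.exists_fixed_neighbor hσ hu (hadj u)
    have h1 := h.card_fixed_of_not_adj hd hσ hadj hy1 hu hy2.symm
    have h2 := card_filter_fixed_split (G := G) σ hy1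
    have h3 := h.fixed_degree_le hd hσ hadj hy1 hu hy2.symm _ rfl
    -- Here s = 15, a square root of 4 · 57 - 3. With a = 57 + j fixed vertices, 8a - 65 must be a
    -- multiple of 15, so a ≡ 10 mod 15, which j ≤ 8 does not allow.
    obtain ⟨z, hz⟩ := h.exists_int_involution hd (s := 15) (by norm_num) (by norm_num) σ hσ
    rw [Finset.filter_false_of_mem (fun v _ => hadj v)] at hz
    generalize (Finset.univ.filter fun v => σ v = v).card = a at *
    generalize (Finset.univ.filter fun v => σ v = v ∧ G.Adj y v).card = j at *
    rw [h1] at h2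
    have hz' : (15 * z + 65 : ℝ) = 8 * a := by
      push_cast at hz
      norm_num at hz
      linarith
    have hz'' : 15 * z + 65 = 8 * (a : ℤ) := by exact_mod_cast hz'
    have hj : j ≤ 8 := by
      by_contra! hj
      have : 9 * 8 ≤ j * (j - 1) := Nat.mul_le_mul hj (by omega)
      omega
    omega

/-- An involution of a Moore graph of degree 57 is an odd permutation. -/
lemma IsMoore.sign_involution (h : IsMoore G) (hd : G.IsRegularOfDegree 57) [Nonempty V]
    {σ : G ≃g G} (hσ : orderOf σ.toEquiv = 2) :
    Equiv.Perm.sign (σ.toEquiv : Equiv.Perm V) = -1 := by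
  have hσ2 : ∀ v, σ (σ v) = v := by
    intro v
    have := pow_orderOf_eq_one (σ.toEquiv : Equiv.Perm V)
    rw [hσ, sq] at this
    exact congrArg (fun f : Equiv.Perm V => f v) this
  have hne : ∃ v, σ v ≠ v := by
    by_contra! hcon
    have : (σ.toEquiv : Equiv.Perm V) = 1 := Equiv.ext hcon
    rw [this, orderOf_one] at hσ
    norm_num at hσ
  have hfix := h.card_fixed_involution hd hσ2 hne
  have hsupp : (Equiv.Perm.support (σ.toEquiv : Equiv.Perm V)).card = 3194 := by
    have h1 : Equiv.Perm.support (σ.toEquiv : Equiv.Perm V) =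
        (Finset.univ.filter fun v => σ v = v)ᶜ := by
      ext v
      simp [Equiv.Perm.mem_support]
    rw [h1, Finset.card_compl, hfix, h.card_eq hd]
  obtain ⟨n, hn⟩ := Equiv.Perm.cycleType_prime_order (σ := σ.toEquiv) (by rw [hσ]; norm_num)
  rw [hσ] at hn
  have hsum := Equiv.Perm.sum_cycleType (σ.toEquiv : Equiv.Perm V)
  rw [hn, Multiset.sum_replicate, hsupp] at hsum
  -- The cycle type has n + 1 entries, so there are 3194/2 = 1597 transpositions, an odd number.
  have hn' : n = 1596 := by
    rw [smul_eq_mul] at hsum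
    omega
  rw [Equiv.Perm.sign_of_cycleType, hn, hn', Multiset.sum_replicate, Multiset.card_replicate]
  rw [Odd.neg_one_pow]
  decide

/-- There is no Moore graph of degree 57 whose complement is edge-transitive. -/
lemma IsMoore.degree_ne (h : IsMoore G) (hd : G.IsRegularOfDegree 57) [Nonempty V]
    (ht : IsEdgeTransitive Gᶜ) : False := by
  have hdvd := h.card_edges_dvd hd (by norm_num) ht
  have h4 : 4 ∣ Nat.card (G ≃g G) := dvd_trans (by norm_num) hdvd
  let ι : (G ≃g G) →* Equiv.Perm V :=
    { toFun := fun φ => φ.toEquiv, map_one' := rfl, map_mul' := fun _ _ => rfl }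
  have hι : Function.Injective ι := fun a b hab => RelIso.toEquiv_injective hab
  have : Finite (G ≃g G) := Finite.of_injective ι hι
  -- The even automorphisms have index at most 2 in a group of order divisible by 4, so by Cauchy
  -- some involution is even.
  let f : (G ≃g G) →* ℤˣ := Equiv.Perm.sign.comp ι
  have hcard : Nat.card f.ker * f.ker.index = Nat.card (G ≃g G) := Subgroup.card_mul_index _
  have hidx : f.ker.index ∣ 2 := by
    rw [Subgroup.index_ker]
    exact (Subgroup.card_subgroup_dvd_card f.range).trans
      (by rw [Nat.card_eq_fintype_card, Fintype.card_units_int])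
  have h2 : 2 ∣ Nat.card f.ker := by
    rw [← hcard] at h4
    obtain ⟨c, hc⟩ := hidx
    have h5 : 4 ∣ Nat.card f.ker * 2 := by
      rw [hc, ← mul_assoc]
      exact h4.mul_right c
    omega
  obtain ⟨⟨σ, hσ⟩, hord⟩ := exists_prime_orderOf_dvd_card' (G := f.ker) 2 h2
  have hord2 : orderOf σ = 2 := (Subgroup.orderOf_mk σ hσ).symm.trans hord
  have hord3 : orderOf σ.toEquiv = 2 := by
    rw [← hord2]
    exact orderOf_injective ι hι σ
  have hs := h.sign_involution hd hord3
  have hs' : Equiv.Perm.sign (σ.toEquiv : Equiv.Perm V) = 1 := hσ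
  rw [hs'] at hs
  exact absurd hs (by decide)

end

/-! ### Shift systems and their uniqueness -/

/-- The composition of two shift maps with total displacement `c`. -/
def shiftPath {p q : ℕ} (σ : ZMod p → Fin q → Fin q) (c e : ZMod p) (s : Fin q) : Fin q :=
  if e = c then σ c s else σ (c - e) (σ e s)

/-- The shift maps between the orbits of an automorphism of order `p` of a Moore graph of
degree `p`. -/
structure IsShiftSystem {p q : ℕ} (σ : ZMod p → Fin q → Fin q) : Prop where
  inv : ∀ c s, c ≠ 0 → σ (-c) (σ c s) = s
  inj : ∀ c s e e', c ≠ 0 → e ≠ 0 → e' ≠ 0 → shiftPath σ c e s = shiftPath σ c e' s → e = e'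

/-- If shift 1 fixed s, its inverse, shift 2, would too; then the direct step to orbit 2 and the
path through orbit 1 would end at the same vertex, a triangle. On two points, having no fixed point
means exchanging them. -/
lemma IsShiftSystem.eq_of_three {σ : ZMod 3 → Fin 2 → Fin 2} (h : IsShiftSystem σ) :
    ∀ c s, c ≠ 0 → σ c s = s + 1 := by
  have h2 : ∀ s t : Fin 2, t ≠ s → t = s + 1 := by decide
  have h1 : ∀ s, σ 1 s ≠ s := by
    intro s hs
    have h3 := h.inv 1 s (by decide)
    rw [hs] at h3
    have h4 := h.inj 2 s 1 2 (by decide) (by decide) (by decide) (by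
      simp only [shiftPath, if_true, if_neg (by decide : (1 : ZMod 3) ≠ 2)]
      rw [hs, show (2 - 1 : ZMod 3) = 1 by decide, hs, show (2 : ZMod 3) = -1 by decide, h3])
    exact absurd h4 (by decide)
  intro c s hc
  have hc' : c = 1 ∨ c = 2 := by revert c; decide
  rcases hc' with rfl | rfl
  · exact h2 _ _ (h1 s)
  · refine h2 _ _ fun hs => ?_
    have h3 := h.inv 2 s (by decide)
    rw [hs, show (-2 : ZMod 3) = 1 by decide] at h3
    exact h1 s h3

/-! ### Backtracking search for shift systems with seven shifts on six points

A partial shift system is coded by a number `N` whose base-7 digits are `0` for unknown values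
and `t + 1` for the value `t`. -/

/-- The digit coding the value of the shift `c` at `s`. -/
def digit (N c s : ℕ) : ℕ := Nat.mod (Nat.div N (Nat.pow 7 (Nat.add (Nat.mul 6 c) s))) 7

/-- Record that the shift `c` maps `s` to `t`. -/
def record (N c s t : ℕ) : ℕ := Nat.add N (Nat.mul (Nat.succ t) (Nat.pow 7 (Nat.add (Nat.mul 6 c) s)))

/-- The coded value at `s` of the composition of the shifts `e` and `c - e`. -/
def digitPath (N c e s : ℕ) : ℕ :=
  bif Nat.beq e c then digit N c s
  else match digit N e s with
    | 0 => 0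
    | t + 1 => digit N (Nat.mod (Nat.sub (Nat.add c 7) e) 7) t

/-- Whether the value of the shift `c` at `s` violates the injectivity condition. -/
def isBad (N c s : ℕ) : Bool :=
  [1, 2, 3, 4, 5, 6].any fun c' => match digitPath N c' c s with
    | 0 => false
    | v + 1 => [1, 2, 3, 4, 5, 6].any fun e =>
      ! Nat.beq e c && Nat.beq (digitPath N c' e s) (v + 1)

/-- Apply a function to a number after evaluating the number. -/
def evalThen (n : ℕ) (f : ℕ → Bool) : Bool :=
  match n with
  | 0 => f 0
  | m + 1 => f (m + 1)

/-- Exhaustive search: the labels in use are those below `k`, the values with index below `i` are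
known, and `leaf` recognizes the accepted partial systems. -/
def search (leaf : ℕ → Bool) : ℕ → ℕ → ℕ → ℕ → Bool
  | 0, _, _, N => leaf N
  | fuel + 1, i, k, N =>
    leaf N ||
    match digit N (i % 6 + 1) (i / 6) with
    | _ + 1 => evalThen (i + 1) fun i' => search leaf fuel i' k N
    | 0 => Nat.ble (i / 6 + 1) k && (List.range (min (k + 1) 6)).all fun t =>
      match digit N (6 - i % 6) t with
      | r + 1 => ! Nat.beq r (i / 6)
      | 0 => evalThen (record (record N (i % 6 + 1) (i / 6) t) (6 - i % 6) t (i / 6)) fun N' =>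
        isBad N' (i % 6 + 1) (i / 6) || evalThen (i + 1) fun i' => evalThen (max k (t + 1)) fun k' =>
          search leaf fuel i' k' N'

lemma evalThen_eq (n : ℕ) (f : ℕ → Bool) : evalThen n f = f n := by
  cases n <;> rfl

lemma digit_eq (N c s : ℕ) : digit N c s = N / 7 ^ (6 * c + s) % 7 := rfl

lemma record_eq (N c s t : ℕ) : record N c s t = N + (t + 1) * 7 ^ (6 * c + s) := rfl

lemma digit_record_self {N c s t : ℕ} (h : digit N c s = 0) (ht : t < 6) :
    digit (record N c s t) c s = t + 1 := by
  rw [digit_eq] at h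
  rw [digit_eq, record_eq, Nat.add_mul_div_right _ _ (by positivity)]
  omega

lemma digit_record_of_ne {N c s t c' s' : ℕ} (h : digit N c s = 0) (ht : t < 6)
    (hne : 6 * c + s ≠ 6 * c' + s') : digit (record N c s t) c' s' = digit N c' s' := by
  rw [digit_eq] at h
  simp only [digit_eq, record_eq]
  generalize 6 * c + s = i at *
  generalize 6 * c' + s' = j at *
  rcases Nat.lt_or_gt_of_ne hne with hij | hij
  · obtain ⟨m, rfl⟩ := Nat.exists_eq_add_of_lt hij
    have hp : 7 ^ (i + m + 1) = 7 ^ i * (7 * 7 ^ m) := by ring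
    rw [hp, ← Nat.div_div_eq_div_mul, ← Nat.div_div_eq_div_mul, ← Nat.div_div_eq_div_mul,
      ← Nat.div_div_eq_div_mul, Nat.add_mul_div_right _ _ (by positivity)]
    congr 2
    omega
  · obtain ⟨m, rfl⟩ := Nat.exists_eq_add_of_lt hij
    have hp : (t + 1) * 7 ^ (j + m + 1) = ((t + 1) * 7 ^ m * 7) * 7 ^ j := by ring
    rw [hp, Nat.add_mul_div_right _ _ (by positivity), Nat.add_mul_mod_self_right]

/-- The number `N` codes values of the shift system `σ` under the injective labelling `ℓ` of `k`
points. -/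
structure Codes (σ : ZMod 7 → Fin 6 → Fin 6) (ℓ : ℕ → Fin 6) (k N : ℕ) : Prop where
  inj : ∀ a < k, ∀ b < k, ℓ a = ℓ b → a = b
  val : ∀ c s t, c < 7 → s < 6 → digit N c s = t + 1 → s < k ∧ t < k ∧ σ c (ℓ s) = ℓ t

section

variable {σ : ZMod 7 → Fin 6 → Fin 6} {ℓ : ℕ → Fin 6} {k N : ℕ}

lemma Codes.record (h : Codes σ ℓ k N) (hk : k ≤ 6) {c s t : ℕ} (hd : digit N c s = 0)
    (hs : s < k) (ht : t < k) (hval : σ c (ℓ s) = ℓ t) : Codes σ ℓ k (record N c s t) := by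
  refine ⟨h.inj, fun c' s' t' hc' hs' hd' => ?_⟩
  by_cases heq : 6 * c + s = 6 * c' + s'
  · obtain ⟨rfl, rfl⟩ : c' = c ∧ s' = s := by omega
    rw [digit_record_self hd (by omega)] at hd'
    obtain rfl : t' = t := by omega
    exact ⟨hs, ht, hval⟩
  · rw [digit_record_of_ne hd (by omega) heq] at hd'
    exact h.val c' s' t' hc' hs' hd'

lemma mem_one_to_six {c : ℕ} : c ∈ [1, 2, 3, 4, 5, 6] ↔ 1 ≤ c ∧ c < 7 := by
  simp only [List.mem_cons, List.not_mem_nil, or_false]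
  omega

lemma natCast_zmod_seven_inj : ∀ c < 7, ∀ e < 7, ((c : ℕ) : ZMod 7) = (e : ℕ) → c = e := by
  decide

lemma natCast_sub_zmod_seven :
    ∀ c < 7, ∀ e < 7, (((c + 7 - e) % 7 : ℕ) : ZMod 7) = (c : ℕ) - (e : ℕ) := by
  decide

lemma Codes.digitPath (h : Codes σ ℓ k N) (hk : k ≤ 6) {c e s v : ℕ} (hc : c < 7) (he : e < 7)
    (hs : s < 6) (hd : digitPath N c e s = v + 1) :
    v < k ∧ shiftPath σ c e (ℓ s) = ℓ v := by
  unfold RainbowInduced.digitPath at hd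
  unfold shiftPath
  by_cases hec : e = c
  · subst hec
    rw [Nat.beq_refl, cond_true] at hd
    rw [if_pos rfl]
    exact (h.val e s v he hs hd).2
  · have hb : Nat.beq e c = false := by
      rw [← Bool.not_eq_true, Nat.beq_eq]
      exact hec
    rw [hb, cond_false] at hd
    rw [if_neg (fun hh => hec (natCast_zmod_seven_inj e he c hc hh))]
    split at hd
    · omega
    · rename_i t ht
      obtain ⟨h1, h2, h3⟩ := h.val e s t he hs ht
      obtain ⟨h4, h5, h6⟩ := h.val ((c + 7 - e) % 7) t v (Nat.mod_lt _ (by norm_num)) (by omega) hd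
      rw [natCast_sub_zmod_seven c hc e he] at h6
      rw [h3, h6]
      exact ⟨h5, rfl⟩

/-- Two coded paths with the same total displacement, start and end but different first steps
contradict injectivity. Only paths starting with the step (c, s) are compared; missing other
conflicts merely weakens the pruning. -/
lemma Codes.not_isBad (h : Codes σ ℓ k N) (hσ : IsShiftSystem σ) (hk : k ≤ 6) {c s : ℕ}
    (hc1 : 1 ≤ c) (hc : c < 7) (hs : s < 6) : isBad N c s = false := by
  rw [← Bool.not_eq_true]
  intro hbad
  have hne0 : ∀ c, 1 ≤ c → c < 7 → ((c : ℕ) : ZMod 7) ≠ 0 := by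
    intro c h1 h2 h3
    have := natCast_zmod_seven_inj c h2 0 (by norm_num) (by rw [h3]; rfl)
    omega
  simp only [isBad, List.any_eq_true, mem_one_to_six] at hbad
  obtain ⟨c', ⟨hc'1, hc'⟩, hb⟩ := hbad
  split at hb
  · exact absurd hb (by simp)
  · rename_i v hv
    simp only [List.any_eq_true, mem_one_to_six, Bool.and_eq_true] at hb
    obtain ⟨e, ⟨he1, he⟩, hec, hev⟩ := hb
    have h1 := h.digitPath hk hc' hc hs hv
    have h2 := h.digitPath hk hc' he hs (Nat.eq_of_beq_eq_true hev)
    have h3 := hσ.inj c' (ℓ s) e c (hne0 _ hc'1 hc') (hne0 _ he1 he) (hne0 _ hc1 hc)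
      (h2.2.trans h1.2.symm)
    rw [natCast_zmod_seven_inj e he c hc h3, Nat.beq_refl] at hec
    exact absurd hec (by simp)

/-- Symmetry breaking: a value not yet labelled may be given the next free label k, so only min (k +
1) 6 candidates need be tried. -/
lemma Codes.exists_label (h : Codes σ ℓ k N) (hk : k ≤ 6) (x : Fin 6) :
    ∃ ℓ' t, t < min (k + 1) 6 ∧ ℓ' t = x ∧ (∀ a < k, ℓ' a = ℓ a) ∧ max k (t + 1) ≤ 6 ∧
      Codes σ ℓ' (max k (t + 1)) N := by
  by_cases hx : ∃ t < k, ℓ t = x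
  · obtain ⟨t, ht, rfl⟩ := hx
    refine ⟨ℓ, t, by omega, rfl, fun _ _ => rfl, by omega, ?_⟩
    rw [max_eq_left (by omega)]
    exact h
  · push Not at hx
    have hk6 : k < 6 := by
      refine lt_of_le_of_ne hk ?_
      rintro rfl
      have hinj : Function.Injective fun a : Fin 6 => ℓ a := fun a b hab =>
        Fin.ext (h.inj a a.2 b b.2 hab)
      obtain ⟨a, ha⟩ := Finite.surjective_of_injective hinj x
      exact hx a a.2 ha
    refine ⟨Function.update ℓ k x, k, by omega, by simp, fun a ha => by simp [ha.ne], by omega, ?_⟩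
    rw [max_eq_right (by omega)]
    have hlt : ∀ a < k, Function.update ℓ k x a = ℓ a := fun a ha => by simp [ha.ne]
    refine ⟨fun a ha b hb hab => ?_, fun c s t hc hs hd => ?_⟩
    · rcases Nat.lt_succ_iff_lt_or_eq.1 ha with ha | rfl <;>
        rcases Nat.lt_succ_iff_lt_or_eq.1 hb with hb | rfl
      · rw [hlt a ha, hlt b hb] at hab
        exact h.inj a ha b hb hab
      · rw [hlt a ha, Function.update_self] at hab
        exact absurd hab (hx a ha)
      · rw [hlt b hb, Function.update_self] at hab
        exact absurd hab.symm (hx b hb)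
      · rfl
    · obtain ⟨h1, h2, h3⟩ := h.val c s t hc hs hd
      rw [hlt s h1, hlt t h2]
      exact ⟨by omega, by omega, h3⟩

/-- The search follows the actual system σ: at each step some branch t agrees with σ under a
suitable labelling, that branch is not pruned, and so it must end in an accepted leaf. Index i
stands for shift i % 6 + 1 at the point i / 6; its inverse is shift 6 - i % 6, and there are 36
entries. -/
lemma search_sound (hσ : IsShiftSystem σ) {P : Prop} {leaf : ℕ → Bool}
    (hleaf : ∀ ℓ k N, k ≤ 6 → Codes σ ℓ k N → leaf N = true → P) :
    ∀ fuel i k N ℓ, search leaf fuel i k N = true → i + fuel ≤ 36 → k ≤ 6 → Codes σ ℓ k N → P := by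
  intro fuel
  induction fuel with
  | zero => exact fun i k N ℓ hs _ hk hN => hleaf ℓ k N hk hN hs
  | succ fuel ih =>
    intro i k N ℓ hs hi hk hN
    rw [search, Bool.or_eq_true] at hs
    rcases hs with hs | hs
    · exact hleaf ℓ k N hk hN hs
    split at hs
    · rw [evalThen_eq] at hs
      exact ih _ _ _ ℓ hs (by omega) hk hN
    · rename_i hd
      rw [Bool.and_eq_true, Nat.ble_eq, List.all_eq_true] at hs
      obtain ⟨hsk, hall⟩ := hs
      obtain ⟨ℓ', t, ht, hx, hℓ, hk', hN'⟩ :=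
        hN.exists_label hk (σ ((i % 6 + 1 : ℕ) : ZMod 7) (ℓ (i / 6)))
      rw [← hℓ _ (by omega)] at hx
      have hb := hall t (List.mem_range.2 ht)
      have hneg : ((6 - i % 6 : ℕ) : ZMod 7) = -((i % 6 + 1 : ℕ) : ZMod 7) := by
        have h1 : ((i % 6 + 1 : ℕ) : ZMod 7) + ((6 - i % 6 : ℕ) : ZMod 7) = 0 := by
          rw [← Nat.cast_add, show i % 6 + 1 + (6 - i % 6) = 7 by omega]
          rfl
        exact (neg_eq_of_add_eq_zero_right h1).symm
      have hc0 : ((i % 6 + 1 : ℕ) : ZMod 7) ≠ 0 := by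
        intro h3
        have := natCast_zmod_seven_inj (i % 6 + 1) (by omega) 0 (by norm_num) (by rw [h3]; rfl)
        omega
      have hinv : σ ((6 - i % 6 : ℕ) : ZMod 7) (ℓ' t) = ℓ' (i / 6) := by
        rw [hneg, hx, hσ.inv _ _ hc0]
      split at hb
      · rename_i r hr
        obtain ⟨h1, h2, h3⟩ := hN'.val _ _ _ (by omega) (by omega) hr
        rw [hinv] at h3
        have := hN'.inj _ (by omega) _ h2 h3
        rw [this, Nat.beq_refl] at hb
        exact absurd hb (by simp)
      · rename_i hr
        have hN1 := hN'.record hk' hd (by omega) (by omega) hx.symm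
        have hN2 := hN1.record hk' (c := 6 - i % 6) (s := t) (t := i / 6) (by
          rw [digit_record_of_ne hd (by omega) (by omega)]
          exact hr) (by omega) (by omega) hinv
        simp only [evalThen_eq] at hb
        rw [hN2.not_isBad hσ hk' (by omega) (by omega) (by omega), Bool.false_or] at hb
        exact ih _ _ _ ℓ' hb (by omega) hk' hN2

lemma search_fixed_point :
    search (fun N => [0, 1, 2, 3, 4, 5].any fun s => Nat.beq (digit N 1 s) (s + 1)) 36 0 1 0 =
      true := by
  decide +kernel

/-- The first search accepts a branch as soon as shift 1 visibly fixes a point. Giving such a point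
the label 0 normalizes the second search enough for a single complete code to remain. -/
lemma IsShiftSystem.exists_fixed (hσ : IsShiftSystem σ) : ∃ x, σ 1 x = x := by
  refine search_sound hσ (fun ℓ k N hk hN hl => ?_) 36 0 1 0 (fun _ => 0) search_fixed_point
    (by norm_num) (by norm_num) ⟨fun a ha b hb _ => by omega, fun c s t _ _ hd => ?_⟩
  · rw [List.any_eq_true] at hl
    obtain ⟨s, hs, hd⟩ := hl
    have hs6 : s < 6 := by
      simp only [List.mem_cons, List.not_mem_nil, or_false] at hs
      omega
    have := (hN.val 1 s s (by norm_num) hs6 (Nat.eq_of_beq_eq_true hd)).2.2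
    exact ⟨ℓ s, by simpa using this⟩
  · rw [digit_eq, Nat.zero_div, Nat.zero_mod] at hd
    omega

/-- The code of a complete shift system. -/
def shiftCode : ℕ := 152511474685436472834149365604838678

/-- The shift system of the Hoffman–Singleton graph. -/
def stdShift (c : ZMod 7) (s : Fin 6) : Fin 6 := Fin.ofNat 6 (digit shiftCode c.val s - 1)

/-- The initial records say that shift 1 and its inverse, shift 6, fix label 0. -/
lemma search_complete :
    search (fun N => Nat.beq N shiftCode) 36 0 1 (record (record 0 1 0 0) 6 0 0) = true := by
  decide +kernel

/-- Up to relabelling there is only one shift system. -/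
lemma IsShiftSystem.exists_equiv (hσ : IsShiftSystem σ) :
    ∃ ℓ : Fin 6 ≃ Fin 6, ∀ c s, c ≠ 0 → σ c (ℓ s) = ℓ (stdShift c s) := by
  obtain ⟨x, hx⟩ := hσ.exists_fixed
  have hx6 : σ 6 x = x := by
    have := hσ.inv 1 x (by decide)
    rwa [hx] at this
  have h0 : Codes σ (fun _ => x) 1 0 := ⟨fun a ha b hb _ => by omega, fun c s t _ _ hd => by
    rw [digit_eq, Nat.zero_div, Nat.zero_mod] at hd
    omega⟩
  have h1 := h0.record (by norm_num) (c := 1) (s := 0) (t := 0) (by decide) (by norm_num)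
    (by norm_num) (by simpa using hx)
  have h2 := h1.record (by norm_num) (c := 6) (s := 0) (t := 0) (by decide) (by norm_num)
    (by norm_num) (by simpa using hx6)
  refine search_sound hσ (fun ℓ k N hk hN hl => ?_) 36 0 1 _ _ search_complete
    (by norm_num) (by norm_num) h2
  obtain rfl := Nat.eq_of_beq_eq_true hl
  have hdig : ∀ c : ZMod 7, ∀ s : Fin 6, c ≠ 0 →
      digit shiftCode c.val s = (stdShift c s : ℕ) + 1 := by decide +kernel
  have hval : ∀ c : ZMod 7, ∀ s : Fin 6, c ≠ 0 → (s : ℕ) < k ∧ σ c (ℓ s) = ℓ (stdShift c s) := by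
    intro c s hc
    obtain ⟨h3, -, h5⟩ := hN.val c.val s _ (ZMod.val_lt c) s.2 (hdig c s hc)
    rw [ZMod.natCast_zmod_val] at h5
    exact ⟨h3, h5⟩
  have hk6 : 5 < k := (hval 1 5 (by decide)).1
  have hinj : Function.Injective fun a : Fin 6 => ℓ a := fun a b hab =>
    Fin.ext (hN.inj a (by omega) b (by omega) hab)
  exact ⟨Equiv.ofBijective _ (Finite.injective_iff_bijective.1 hinj), fun c s hc =>
    (hval c s hc).2⟩

end

/-- Adjacency in the graph with vertices `v` (`none`), `aᵢ` (`some (i, none)`) and `bᵢₛ`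
(`some (i, some s)`) determined by a shift system. -/
def shiftAdj {p q : ℕ} (σ : ZMod p → Fin q → Fin q) :
    Option (ZMod p × Option (Fin q)) → Option (ZMod p × Option (Fin q)) → Bool
  | none, none => false
  | none, some (_, none) => true
  | none, some (_, some _) => false
  | some (_, none), none => true
  | some (_, some _), none => false
  | some (_, none), some (_, none) => false
  | some (i, none), some (j, some _) => i == j
  | some (i, some _), some (j, none) => i == j
  | some (i, some s), some (j, some t) => i != j && σ (j - i) s == t

/-! ### Coordinates from an automorphism of prime order -/

section

variable {V : Type*} [Fintype V] [DecidableEq V] {G : SimpleGraph V} [DecidableRel G.Adj]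

omit [DecidableRel G.Adj] in
lemma exists_zmod_automorphisms {p : ℕ} [Fact p.Prime] (hdvd : p ∣ Nat.card (G ≃g G)) :
    ∃ γ : ZMod p → (G ≃g G), (∀ i j v, γ (i + j) v = γ i (γ j v)) ∧ (∀ v, γ 0 v = v) ∧
      (∃ v, γ 1 v ≠ v) := by
  have hfin : Finite (G ≃g G) :=
    Finite.of_injective (fun φ : G ≃g G => φ.toEquiv) RelIso.toEquiv_injective
  obtain ⟨g, hg⟩ := exists_prime_orderOf_dvd_card' p hdvd
  have hp1 : 1 < p := (Fact.out : p.Prime).one_lt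
  refine ⟨fun i => g ^ i.val, fun i j v => ?_, fun v => by simp, ?_⟩
  · have h1 : g ^ (i + j).val = g ^ i.val * g ^ j.val := by
      have h2 := pow_mod_orderOf g (i.val + j.val)
      rw [hg] at h2
      rw [ZMod.val_add, h2, pow_add]
    exact congrArg (fun φ : G ≃g G => φ v) h1
  · by_contra! hcon
    have : g = 1 := by
      ext v
      have h1 := hcon v
      rwa [ZMod.val_one'' hp1.ne', pow_one] at h1
    rw [this, orderOf_one] at hg
    omega

omit [Fintype V] [DecidableEq V] [DecidableRel G.Adj] in
-- In a group of prime order a point stabilizer that is not everything is trivial.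
lemma injective_of_moved {p : ℕ} [Fact p.Prime] {γ : ZMod p → (G ≃g G)}
    (hadd : ∀ i j v, γ (i + j) v = γ i (γ j v)) (h0 : ∀ v, γ 0 v = v) {w : V} {c : ZMod p}
    (hw : γ c w ≠ w) : Function.Injective fun i => γ i w := by
  have key : ∀ k, k ≠ 0 → γ k w ≠ w := by
    intro k hk hkw
    have hn : ∀ n : ℕ, γ (n * k) w = w := by
      intro n
      induction n with
      | zero => simp [h0]
      | succ n ih =>
        rw [Nat.cast_succ, add_mul, one_mul, hadd, hkw, ih]
    have := hn (c * k⁻¹).val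
    rw [ZMod.natCast_zmod_val, mul_assoc, inv_mul_cancel₀ hk, mul_one] at this
    exact hw this
  intro i j hij
  by_contra hne
  refine key (-j + i) (fun hh => hne ?_) ?_
  · rw [neg_add_eq_zero] at hh
    exact hh.symm
  · have hij : γ i w = γ j w := hij
    rw [hadd, hij, ← hadd, neg_add_cancel, h0]

/-- The automorphism fixes a vertex v and permutes its p neighbors in a single cycle, the orbit of
a. The remaining q neighbors b_s of a and their translates are the other vertices. For c ≠ 0, b_s
has one common neighbor with the c-translate of a, which is the c-translate of some b_t; this t is σ
c s. Uniqueness of common neighbors and the absence of triangles become the axioms of a shift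
system. -/
lemma IsMoore.exists_coordinates {p q : ℕ} [Fact p.Prime] (hpq : p = q + 1) (h : IsMoore G)
    (hd : G.IsRegularOfDegree p) [Nonempty V] (hdvd : p ∣ Nat.card (G ≃g G)) :
    ∃ σ : ZMod p → Fin q → Fin q, IsShiftSystem σ ∧
      ∃ f : Option (ZMod p × Option (Fin q)) ≃ V, ∀ x y,
        G.Adj (f x) (f y) ↔ shiftAdj σ x y = true := by
  obtain ⟨γ, hadd, h0, hmove⟩ := exists_zmod_automorphisms hdvd
  have hn := h.card_eq hd
  have hadj : ∀ i v w, G.Adj (γ i v) (γ i w) ↔ G.Adj v w := fun i v w => (γ i).map_adj_iff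
  have hneg : ∀ i v, γ (-i) (γ i v) = v := fun i v => by rw [← hadd, neg_add_cancel, h0]
  have hneg' : ∀ i v, γ i (γ (-i) v) = v := fun i v => by rw [← hadd, add_neg_cancel, h0]
  -- a fixed vertex
  obtain ⟨v, hv⟩ : ∃ v, ∀ i, γ i v = v := by
    have hp : p.Prime := Fact.out
    have hpow : ∀ (n : ℕ) v, ((γ 1).toEquiv ^ n : Equiv.Perm V) v = γ n v := by
      intro n
      induction n with
      | zero => simp [h0]
      | succ n ih =>
        intro v
        rw [pow_succ, Equiv.Perm.mul_apply, ih, Nat.cast_succ, hadd]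
        rfl
    -- The number of vertices p² + 1 is prime to p.
    obtain ⟨v, hv⟩ := Equiv.Perm.exists_fixed_point_of_prime (p := p) (n := 1)
      (σ := (γ 1).toEquiv) (by
        rw [hn, Nat.dvd_add_right (Dvd.intro_left p rfl), Nat.dvd_one]
        exact hp.one_lt.ne') (by
        ext v
        rw [hpow, pow_one, ZMod.natCast_self, h0]
        rfl)
    refine ⟨v, fun i => ?_⟩
    by_contra hi
    have h1 : γ 1 v = γ 0 v := by
      rw [h0]
      exact hv
    exact one_ne_zero (injective_of_moved hadd h0 hi h1)
  have hvadj : ∀ i w, G.Adj v (γ i w) ↔ G.Adj v w := fun i w => by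
    conv_lhs => rw [← hv i]
    rw [hadj]
  -- a moved neighbor
  obtain ⟨a, hva, c, hac⟩ : ∃ a, G.Adj v a ∧ ∃ c, γ c a ≠ a := by
    by_contra! hcon
    obtain ⟨w, hw⟩ := hmove
    by_cases hwv : w = v
    · exact hw (hwv ▸ hv 1)
    by_cases hvw : G.Adj v w
    · exact hw (hcon w hvw 1)
    obtain ⟨a, ha1, ha2⟩ := h.exists_common v w (Ne.symm hwv) hvw
    -- If all neighbors of v were fixed, the orbit of a moved w would put p vertices among the p - 1
    -- neighbors of a other than v.
    have hsub : Finset.univ.image (fun i => γ i w) ⊆ (G.neighborFinset a).erase v := by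
      intro x hx
      obtain ⟨i, -, rfl⟩ := Finset.mem_image.1 hx
      rw [Finset.mem_erase, mem_neighborFinset]
      refine ⟨?_, ?_⟩
      · intro hh
        apply hwv
        rw [← hneg i w, hh, hv]
      · conv_lhs => rw [← hcon a ha1 i]
        rw [hadj]
        exact ha2.symm
    have hle := Finset.card_le_card hsub
    rw [Finset.card_image_of_injective _ (injective_of_moved hadd h0 hw), Finset.card_univ,
      ZMod.card, Finset.card_erase_of_mem (by rw [mem_neighborFinset]; exact ha1.symm),
      card_neighborFinset_eq_degree, hd] at hle
    omega
  have hainj := injective_of_moved hadd h0 hac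
  have hasurj : ∀ w, G.Adj v w → ∃ i, γ i a = w := by
    have heq : Finset.univ.image (fun i => γ i a) = G.neighborFinset v := by
      refine Finset.eq_of_subset_of_card_le ?_ ?_
      · intro x hx
        obtain ⟨i, -, rfl⟩ := Finset.mem_image.1 hx
        rw [mem_neighborFinset, hvadj]
        exact hva
      · rw [Finset.card_image_of_injective _ hainj, Finset.card_univ, ZMod.card,
          card_neighborFinset_eq_degree, hd]
    intro w hw
    rw [← mem_neighborFinset, ← heq, Finset.mem_image] at hw
    obtain ⟨i, -, hi⟩ := hw
    exact ⟨i, hi⟩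
  have hcard : ((G.neighborFinset a).erase v).card = q := by
    rw [Finset.card_erase_of_mem (by rw [mem_neighborFinset]; exact hva.symm),
      card_neighborFinset_eq_degree, hd]
    omega
  obtain ⟨b, hbinj, hb, hbsurj⟩ : ∃ b : Fin q → V, Function.Injective b ∧
      (∀ s, G.Adj a (b s) ∧ b s ≠ v) ∧ ∀ w, G.Adj a w → w ≠ v → ∃ s, b s = w := by
    let e := (Finset.equivFinOfCardEq hcard).symm
    refine ⟨fun s => e s, fun s t hst => e.injective (Subtype.ext hst), fun s => ?_, fun w h1 h2 => ?_⟩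
    · have := (e s).2
      rw [Finset.mem_erase, mem_neighborFinset] at this
      exact ⟨this.2, this.1⟩
    · obtain ⟨s, hs⟩ := e.surjective ⟨w, by rw [Finset.mem_erase, mem_neighborFinset]; exact ⟨h2, h1⟩⟩
      exact ⟨s, congrArg Subtype.val hs⟩
  have hvb : ∀ i s, ¬ G.Adj v (γ i (b s)) := by
    intro i s
    rw [hvadj]
    exact fun hh => h.not_adj _ _ _ hva (hb s).1 hh
  have hvb' : ∀ i s, γ i (b s) ≠ v := by
    intro i s hh
    apply (hb s).2
    rw [← hneg i (b s), hh, hv]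
  have hva' : ∀ i, G.Adj v (γ i a) := fun i => (hvadj i a).2 hva
  have haa : ∀ i j, ¬ G.Adj (γ i a) (γ j a) := fun i j =>
    h.not_adj _ _ _ (hva' i).symm (hva' j)
  have hab : ∀ i j s, G.Adj (γ i a) (γ j (b s)) ↔ i = j := by
    intro i j s
    constructor
    · intro hh
      have h1 : G.Adj (γ j a) (γ j (b s)) := (hadj _ _ _).2 (hb s).1
      exact hainj (h.common_unique v (γ j (b s)) _ _ (hvb' j s).symm (hva' i) hh.symm (hva' j) h1.symm)
    · rintro rfl
      exact (hadj _ _ _).2 (hb s).1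
  have hbb : ∀ i s t, ¬ G.Adj (γ i (b s)) (γ i (b t)) := by
    intro i s t
    rw [hadj]
    exact h.not_adj _ _ _ (hb s).1.symm (hb t).1
  have hbi : ∀ i j s t, γ i (b s) = γ j (b t) → i = j ∧ s = t := by
    intro i j s t hh
    have h1 := (hab i i s).2 rfl
    rw [hh, hab] at h1
    subst h1
    exact ⟨rfl, hbinj ((γ i).injective hh)⟩
  -- the shift maps
  have hex : ∀ c s, ∃ t, c ≠ 0 → G.Adj (b s) (γ c (b t)) := by
    intro c s
    by_cases hc : c = 0
    · exact ⟨s, fun hh => absurd hc hh⟩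
    have h1 : ¬ G.Adj (b s) (γ c a) := by
      intro hh
      have := (hab c 0 s).1 (by rw [h0]; exact hh.symm)
      exact hc this
    have h2 : b s ≠ γ c a := by
      intro hh
      have := hva' c
      rw [← hh, ← h0 (b s)] at this
      exact hvb 0 s this
    obtain ⟨w, hw1, hw2⟩ := h.exists_common _ _ h2 h1
    have hwv : w ≠ v := by
      rintro rfl
      have := hw1.symm
      rw [← h0 (b s)] at this
      exact hvb 0 s this
    obtain ⟨t, ht⟩ := hbsurj (γ (-c) w) (by
      rw [← hneg c a, hadj]
      exact hw2) (fun hh => hwv (by rw [← hneg' c w, hh, hv]))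
    refine ⟨t, fun _ => ?_⟩
    rw [ht, hneg']
    exact hw1
  choose σ hσ using hex
  have huniq : ∀ c s t, c ≠ 0 → G.Adj (b s) (γ c (b t)) → σ c s = t := by
    intro c s t hc ht
    have h2 : b s ≠ γ c a := by
      intro hh
      have := hva' c
      rw [← hh, ← h0 (b s)] at this
      exact hvb 0 s this
    exact (hbi c c _ _ (h.common_unique _ _ _ _ h2 (hσ c s hc) ((hab c c _).2 rfl) ht
      ((hab c c _).2 rfl))).2
  refine ⟨σ, ⟨fun c s hc => ?_, fun c s e e' hc he he' hee => ?_⟩, ?_⟩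
  · refine huniq _ _ _ (neg_ne_zero.2 hc) ?_
    rw [← hadj c, hneg']
    exact (hσ c s hc).symm
  -- Two different first steps with the same end vertex give a triangle if one of them is the direct
  -- step e = c, and a 4-cycle otherwise.
  · have hpath : ∀ e, e ≠ 0 → e ≠ c → G.Adj (γ e (b (σ e s))) (γ c (b (shiftPath σ c e s))) := by
      intro e he hec
      have h1 := (hadj e _ _).2 (hσ (c - e) (σ e s) (sub_ne_zero.2 (Ne.symm hec)))
      rw [← hadd, add_sub_cancel] at h1
      rwa [shiftPath, if_neg hec]
    have hself : shiftPath σ c c s = σ c s := if_pos rfl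
    have hne : b s ≠ γ c (b (shiftPath σ c e s)) := by
      intro hh
      rw [← h0 (b s)] at hh
      exact hc (hbi _ _ _ _ hh).1.symm
    by_cases hec : e = c
    · by_cases hec' : e' = c
      · rw [hec, hec']
      · exfalso
        rw [hec, hself] at hee
        refine h.not_adj _ _ _ (hσ e' s he') (hpath e' he' hec') ?_
        rw [← hee]
        exact hσ c s hc
    · by_cases hec' : e' = c
      · exfalso
        rw [hec', hself] at hee
        refine h.not_adj _ _ _ (hσ e s he) (hpath e he hec) ?_
        rw [hee]
        exact hσ c s hc
      · have h1 := (hpath e he hec).symm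
        have h2 := (hpath e' he' hec').symm
        rw [← hee] at h2
        exact (hbi _ _ _ _ (h.common_unique _ _ _ _ hne (hσ e s he) h1 (hσ e' s he') h2)).1
  · let f : Option (ZMod p × Option (Fin q)) → V
      | none => v
      | some (i, none) => γ i a
      | some (i, some s) => γ i (b s)
    have hfinj : Function.Injective f := by
      rintro (_ | ⟨i, _ | s⟩) (_ | ⟨j, _ | t⟩) hij <;> simp only [f] at hij
      · rfl
      · exact absurd hij (hva' j).ne
      · exact absurd hij.symm (hvb' j t)
      · exact absurd hij.symm (hva' i).ne
      · rw [hainj hij]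
      · exact absurd (hij ▸ hva' i) (hvb j t)
      · exact absurd hij (hvb' i s)
      · exact absurd (hij.symm ▸ hva' j) (hvb i s)
      · obtain ⟨rfl, rfl⟩ := hbi _ _ _ _ hij
        rfl
    have hfsurj : Function.Surjective f := by
      intro w
      by_cases hwv : w = v
      · exact ⟨none, hwv.symm⟩
      by_cases hvw : G.Adj v w
      · obtain ⟨i, hi⟩ := hasurj w hvw
        exact ⟨some (i, none), hi⟩
      obtain ⟨x, hx1, hx2⟩ := h.exists_common v w (Ne.symm hwv) hvw
      obtain ⟨i, rfl⟩ := hasurj x hx1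
      obtain ⟨s, hs⟩ := hbsurj (γ (-i) w) (by
        rw [← hneg i a, hadj]
        exact hx2.symm) (fun hh => hwv (by rw [← hneg' i w, hh, hv]))
      refine ⟨some (i, some s), ?_⟩
      simp only [f]
      rw [hs, hneg']
    refine ⟨Equiv.ofBijective f (show Function.Bijective f from ⟨hfinj, hfsurj⟩), ?_⟩
    suffices hf : ∀ x y, G.Adj (f x) (f y) ↔ shiftAdj σ x y = true from hf
    rintro (_ | ⟨i, _ | s⟩) (_ | ⟨j, _ | t⟩) <;> simp only [f, shiftAdj]
    · simp
    · simpa using hva' j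
    · simpa using hvb j t
    · simpa using (hva' i).symm
    · simpa using haa i j
    · simpa using hab i j t
    · simpa [G.adj_comm] using hvb i s
    · rw [G.adj_comm, hab, beq_iff_eq]
      exact eq_comm
    · by_cases hij : i = j
      · subst hij
        simpa using hbb i s t
      · have hij' : j - i ≠ 0 := sub_ne_zero.2 (Ne.symm hij)
        have h1 : G.Adj (γ i (b s)) (γ j (b t)) ↔ G.Adj (b s) (γ (j - i) (b t)) := by
          rw [← hadj i (b s), ← hadd, add_sub_cancel]
        rw [h1]
        simp only [bne_iff_ne, Bool.and_eq_true, beq_iff_eq, ne_eq, hij, not_false_eq_true, true_and]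
        constructor
        · exact huniq _ _ _ hij'
        · rintro rfl
          exact hσ _ _ hij'

end

/-! ### Reduction to a base vertex -/

section

variable {V : Type*} {G : SimpleGraph V}

/-- An adjacency-preserving injective self-map of a finite graph is an automorphism. -/
noncomputable def autOfInjective [Finite V] (f : V → V) (hf : Function.Injective f)
    (hadj : ∀ x y, G.Adj (f x) (f y) ↔ G.Adj x y) : G ≃g G :=
  ⟨Equiv.ofBijective f (Finite.injective_iff_bijective.1 hf), fun {a b} => hadj a b⟩

lemma exists_iterate (φ : G ≃g G) (n : ℕ) : ∃ ψ : G ≃g G, ∀ x, ψ x = φ^[n] x := by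
  induction n with
  | zero => exact ⟨RelIso.refl _, fun _ => rfl⟩
  | succ n ih =>
    obtain ⟨ψ, hψ⟩ := ih
    exact ⟨φ.trans ψ, fun x => hψ (φ x)⟩

lemma isEdgeTransitive_compl_of_base (x₀ y₀ : V) (h1 : ∀ x, ∃ φ : G ≃g G, φ x₀ = x)
    (h2 : ∀ y, x₀ ≠ y → ¬ G.Adj x₀ y → ∃ φ : G ≃g G, φ x₀ = x₀ ∧ φ y₀ = y) :
    IsEdgeTransitive Gᶜ := by
  have key : ∀ x y, x ≠ y → ¬ G.Adj x y → ∃ φ : G ≃g G, φ x₀ = x ∧ φ y₀ = y := by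
    intro x y hxy hn
    obtain ⟨φ, rfl⟩ := h1 x
    obtain ⟨y, rfl⟩ := φ.surjective y
    obtain ⟨ψ, hψ1, hψ2⟩ := h2 y (fun hh => hxy (hh ▸ rfl)) (fun hh => hn (φ.map_adj_iff.2 hh))
    exact ⟨ψ.trans φ, by simp [hψ1], by simp [hψ2]⟩
  intro x₁ y₁ x₂ y₂ h1 h2
  rw [compl_adj] at h1 h2
  obtain ⟨φ, hφ1, hφ2⟩ := key _ _ h1.1 h1.2
  obtain ⟨ψ, hψ1, hψ2⟩ := key _ _ h2.1 h2.2
  refine ⟨complIso (φ.symm.trans ψ), Or.inl ⟨?_, ?_⟩⟩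
  · change ψ (φ.symm x₁) = x₂
    rw [← hφ1, RelIso.symm_apply_apply, hψ1]
  · change ψ (φ.symm y₁) = y₂
    rw [← hφ2, RelIso.symm_apply_apply, hψ2]

/-- Vertex-transitivity moves the first vertex of each condition to x₀, which keeps the finite
checks for the two concrete graphs small. -/
lemma isMoore_of_base (x₀ : V) (h1 : ∀ x, ∃ φ : G ≃g G, φ x₀ = x)
    (htri : ∀ b, G.Adj x₀ b → ∀ c, G.Adj b c → ¬ G.Adj x₀ c)
    (hcom : ∀ b, x₀ ≠ b → ¬ G.Adj x₀ b → ∃ c, G.Adj x₀ c ∧ G.Adj b c)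
    (huniq : ∀ c, G.Adj x₀ c → ∀ c', G.Adj x₀ c' → c ≠ c' → ∀ b, G.Adj b c → G.Adj b c' →
      x₀ = b) : IsMoore G := by
  refine ⟨fun a b c hab hbc hac => ?_, fun a b hab hn => ?_, fun a b c c' hab h2 h3 h4 h5 => ?_⟩
  · obtain ⟨φ, rfl⟩ := h1 a
    obtain ⟨b, rfl⟩ := φ.surjective b
    obtain ⟨c, rfl⟩ := φ.surjective c
    rw [φ.map_adj_iff] at hab hbc hac
    exact htri b hab c hbc hac
  · obtain ⟨φ, rfl⟩ := h1 a
    obtain ⟨b, rfl⟩ := φ.surjective b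
    rw [φ.map_adj_iff] at hn
    obtain ⟨c, hc1, hc2⟩ := hcom b (fun hh => hab (hh ▸ rfl)) hn
    exact ⟨φ c, φ.map_adj_iff.2 hc1, φ.map_adj_iff.2 hc2⟩
  · obtain ⟨φ, rfl⟩ := h1 a
    obtain ⟨b, rfl⟩ := φ.surjective b
    obtain ⟨c, rfl⟩ := φ.surjective c
    obtain ⟨c', rfl⟩ := φ.surjective c'
    rw [φ.map_adj_iff] at h2 h3 h4 h5
    by_contra hne
    exact hab (congrArg φ (huniq c h2 c' h4 (fun hh => hne (hh ▸ rfl)) b h3 h5))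

lemma isRegularOfDegree_of_base [Fintype V] [DecidableRel G.Adj] (x₀ : V)
    (h1 : ∀ x, ∃ φ : G ≃g G, φ x₀ = x) {d : ℕ} (hd : G.degree x₀ = d) :
    G.IsRegularOfDegree d := by
  intro x
  obtain ⟨φ, rfl⟩ := h1 x
  rw [← hd, φ.degree_eq]

end

/-! ### The Petersen graph -/

instance : DecidableRel petersen.Adj := fun s t => inferInstanceAs (Decidable (Disjoint s.1 t.1))

/-- The automorphism of the Petersen graph induced by a permutation of the ground set. -/
def petersenAut (π : Equiv.Perm (Fin 5)) : petersen ≃g petersen where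
  toFun s := ⟨s.1.map π.toEmbedding, by rw [Finset.card_map, s.2]⟩
  invFun s := ⟨s.1.map π.symm.toEmbedding, by rw [Finset.card_map, s.2]⟩
  left_inv s := by
    ext x
    simp
  right_inv s := by
    ext x
    simp
  map_rel_iff' := by
    intro s t
    exact Finset.disjoint_map _

lemma petersen_transitive (x : {s : Finset (Fin 5) // s.card = 2}) :
    ∃ φ : petersen ≃g petersen, φ ⟨{0, 1}, by decide⟩ = x := by
  have : ∀ x : {s : Finset (Fin 5) // s.card = 2}, ∃ a b c d : Fin 5,
      petersenAut (Equiv.swap a b * Equiv.swap c d) ⟨{0, 1}, by decide⟩ = x := by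
    decide +kernel
  obtain ⟨a, b, c, d, h⟩ := this x
  exact ⟨_, h⟩

lemma petersen_isMoore : IsMoore petersen :=
  isMoore_of_base _ petersen_transitive (by decide +kernel) (by decide +kernel)
    (by decide +kernel)

lemma petersen_isRegularOfDegree : petersen.IsRegularOfDegree 3 :=
  isRegularOfDegree_of_base _ petersen_transitive (by decide +kernel)

lemma petersen_isEdgeTransitive : IsEdgeTransitive petersenᶜ := by
  refine isEdgeTransitive_compl_of_base ⟨{0, 1}, by decide⟩ ⟨{0, 2}, by decide⟩
    petersen_transitive ?_
  have : ∀ y : {s : Finset (Fin 5) // s.card = 2}, ⟨{0, 1}, by decide⟩ ≠ y →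
      ¬ petersen.Adj ⟨{0, 1}, by decide⟩ y → ∃ a b c d : Fin 5,
      petersenAut (Equiv.swap a b * Equiv.swap c d) ⟨{0, 1}, by decide⟩ = ⟨{0, 1}, by decide⟩ ∧
      petersenAut (Equiv.swap a b * Equiv.swap c d) ⟨{0, 2}, by decide⟩ = y := by
    decide +kernel
  intro y h1 h2
  obtain ⟨a, b, c, d, h⟩ := this y h1 h2
  exact ⟨_, h⟩

/-! ### The Hoffman–Singleton graph -/

instance : DecidableRel hoffmanSingleton.Adj
  | Sum.inl (h, j), Sum.inl (h', j') =>
    inferInstanceAs (Decidable (h = h' ∧ (j' = j + 1 ∨ j = j' + 1)))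
  | Sum.inr (i, j), Sum.inr (i', j') =>
    inferInstanceAs (Decidable (i = i' ∧ (j' = j + 2 ∨ j = j' + 2)))
  | Sum.inl (h, j), Sum.inr (i, j') => inferInstanceAs (Decidable (j' = h * i + j))
  | Sum.inr (i, j'), Sum.inl (h, j) => inferInstanceAs (Decidable (j' = h * i + j))

/-- The vertices of the Hoffman–Singleton graph. -/
abbrev HSVertex := (ZMod 5 × ZMod 5) ⊕ (ZMod 5 × ZMod 5)

/-- An enumeration of the vertices of the Hoffman–Singleton graph. -/
def hsVertex (n : ℕ) : HSVertex :=
  if n < 25 then Sum.inl ((n / 5 : ℕ), (n : ℕ)) else Sum.inr ((n / 5 : ℕ), (n : ℕ))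

/-- The index of a vertex in the enumeration. -/
def hsIndex : HSVertex → ℕ
  | Sum.inl (h, j) => 5 * h.val + j.val
  | Sum.inr (i, j) => 25 + 5 * i.val + j.val

/-- The translation of the first coordinate of the pentagons. -/
def hsShiftP : HSVertex → HSVertex
  | Sum.inl (h, j) => Sum.inl (h + 1, j)
  | Sum.inr (i, j) => Sum.inr (i, j + i)

/-- The translation of the first coordinate of the pentagrams. -/
def hsShiftQ : HSVertex → HSVertex
  | Sum.inl (h, j) => Sum.inl (h, j - h)
  | Sum.inr (i, j) => Sum.inr (i + 1, j)

/-- The translation of the second coordinate. -/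
def hsRotate : HSVertex → HSVertex
  | Sum.inl (h, j) => Sum.inl (h, j + 1)
  | Sum.inr (i, j) => Sum.inr (i, j + 1)

/-- The map exchanging pentagons and pentagrams. -/
def hsSwap : HSVertex → HSVertex
  | Sum.inl (h, j) => Sum.inr (3 * h, 2 * j)
  | Sum.inr (i, j) => Sum.inl (i, 2 * j)

/-- The dilation of the first coordinates. -/
def hsDilate : HSVertex → HSVertex
  | Sum.inl (h, j) => Sum.inl (2 * h, j)
  | Sum.inr (i, j) => Sum.inr (3 * i, j)

/-- The reflection of the second coordinates. -/
def hsReflect : HSVertex → HSVertex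
  | Sum.inl (h, j) => Sum.inl (-h, -j)
  | Sum.inr (i, j) => Sum.inr (i, -j)

/-- An automorphism fixing a vertex and not preserving the pentagons. -/
def hsExotic (x : HSVertex) : HSVertex :=
  hsVertex ([0, 4, 29, 27, 25, 33, 11, 42, 18, 31, 21, 47, 8, 41, 43,
    32, 23, 36, 38, 6, 13, 46, 48, 16, 37, 30, 49, 9, 17, 5, 1, 3, 26, 2, 28, 45, 34, 24, 12, 20, 40, 39, 14, 7, 10, 35, 44, 19, 22, 15].getD (hsIndex x) 0)

lemma exists_hs_aut (f : HSVertex → HSVertex)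
    (hadj : ∀ x y, hoffmanSingleton.Adj (f x) (f y) ↔ hoffmanSingleton.Adj x y)
    (hf : ∀ x y, f x = f y → x = y) (n : ℕ) :
    ∃ φ : hoffmanSingleton ≃g hoffmanSingleton, ∀ x, φ x = f^[n] x :=
  exists_iterate (autOfInjective f hf hadj) n

lemma exists_hsShiftP (n : ℕ) :
    ∃ φ : hoffmanSingleton ≃g hoffmanSingleton, ∀ x, φ x = hsShiftP^[n] x :=
  exists_hs_aut hsShiftP (by decide +kernel) (by decide +kernel) n

lemma exists_hsShiftQ (n : ℕ) :
    ∃ φ : hoffmanSingleton ≃g hoffmanSingleton, ∀ x, φ x = hsShiftQ^[n] x :=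
  exists_hs_aut hsShiftQ (by decide +kernel) (by decide +kernel) n

lemma exists_hsRotate (n : ℕ) :
    ∃ φ : hoffmanSingleton ≃g hoffmanSingleton, ∀ x, φ x = hsRotate^[n] x :=
  exists_hs_aut hsRotate (by decide +kernel) (by decide +kernel) n

lemma exists_hsSwap (n : ℕ) :
    ∃ φ : hoffmanSingleton ≃g hoffmanSingleton, ∀ x, φ x = hsSwap^[n] x :=
  exists_hs_aut hsSwap (by decide +kernel) (by decide +kernel) n

lemma exists_hsDilate (n : ℕ) :
    ∃ φ : hoffmanSingleton ≃g hoffmanSingleton, ∀ x, φ x = hsDilate^[n] x :=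
  exists_hs_aut hsDilate (by decide +kernel) (by decide +kernel) n

lemma exists_hsReflect (n : ℕ) :
    ∃ φ : hoffmanSingleton ≃g hoffmanSingleton, ∀ x, φ x = hsReflect^[n] x :=
  exists_hs_aut hsReflect (by decide +kernel) (by decide +kernel) n

lemma exists_hsExotic (n : ℕ) :
    ∃ φ : hoffmanSingleton ≃g hoffmanSingleton, ∀ x, φ x = hsExotic^[n] x :=
  exists_hs_aut hsExotic (by decide +kernel) (by decide +kernel) n

lemma hoffmanSingleton_transitive (x : HSVertex) :
    ∃ φ : hoffmanSingleton ≃g hoffmanSingleton, φ (Sum.inl (0, 0)) = x := by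
  have : ∀ x : HSVertex, ∃ a b : Fin 5, ∃ c : Fin 5, ∃ e : Fin 2,
      hsShiftP^[a] (hsShiftQ^[b] (hsRotate^[c] (hsSwap^[e] (Sum.inl (0, 0))))) = x := by
    decide +kernel
  obtain ⟨a, b, c, e, h⟩ := this x
  obtain ⟨φ₁, h1⟩ := exists_hsShiftP a
  obtain ⟨φ₂, h2⟩ := exists_hsShiftQ b
  obtain ⟨φ₃, h3⟩ := exists_hsRotate c
  obtain ⟨φ₄, h4⟩ := exists_hsSwap e
  exact ⟨((φ₄.trans φ₃).trans φ₂).trans φ₁, by simp only [RelIso.trans_apply, h1, h2, h3, h4, h]⟩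

lemma hoffmanSingleton_isMoore : IsMoore hoffmanSingleton := by
  have hcom : ∀ b : HSVertex, Sum.inl (0, 0) = b ∨ hoffmanSingleton.Adj (Sum.inl (0, 0)) b ∨
      ∃ c : HSVertex, hoffmanSingleton.Adj (Sum.inl (0, 0)) c ∧ hoffmanSingleton.Adj b c := by
    decide +kernel
  exact isMoore_of_base _ hoffmanSingleton_transitive (by decide +kernel)
    (fun b h1 h2 => ((hcom b).resolve_left h1).resolve_left h2) (by decide +kernel)

lemma hoffmanSingleton_isRegularOfDegree : hoffmanSingleton.IsRegularOfDegree 7 :=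
  isRegularOfDegree_of_base _ hoffmanSingleton_transitive (by decide +kernel)

lemma hoffmanSingleton_isEdgeTransitive : IsEdgeTransitive hoffmanSingletonᶜ := by
  refine isEdgeTransitive_compl_of_base (Sum.inl (0, 0)) (Sum.inl (0, 2))
    hoffmanSingleton_transitive ?_
  -- All four maps fix the base vertex, and their products carry (0, 2) to each of its 42
  -- non-neighbors. The pentagon-breaking map is what links the orbits of the other three.
  have hex : ∀ y : HSVertex, Sum.inl (0, 0) ≠ y → ¬ hoffmanSingleton.Adj (Sum.inl (0, 0)) y →
      ∃ k : Fin 4, ∃ n : Fin 2, ∃ e : Fin 4, ∃ b : Fin 5,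
      hsShiftQ^[b] (hsDilate^[e] (hsReflect^[n] (hsExotic^[k] (Sum.inl (0, 2))))) = y := by
    decide +kernel
  intro y h1 h2
  obtain ⟨k, n, e, b, h⟩ := hex y h1 h2
  obtain ⟨φ₁, h1⟩ := exists_hsShiftQ b
  obtain ⟨φ₂, h2⟩ := exists_hsDilate e
  obtain ⟨φ₃, h3⟩ := exists_hsReflect n
  obtain ⟨φ₄, h4⟩ := exists_hsExotic k
  refine ⟨((φ₄.trans φ₃).trans φ₂).trans φ₁, ?_, ?_⟩
  · simp only [RelIso.trans_apply, h1, h2, h3, h4]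
    have e1 : hsExotic (Sum.inl (0, 0)) = Sum.inl (0, 0) := by decide +kernel
    have e2 : hsReflect (Sum.inl (0, 0)) = Sum.inl (0, 0) := by decide +kernel
    have e3 : hsDilate (Sum.inl (0, 0)) = Sum.inl (0, 0) := by decide +kernel
    have e4 : hsShiftQ (Sum.inl (0, 0)) = Sum.inl (0, 0) := by decide +kernel
    rw [Function.iterate_fixed e1, Function.iterate_fixed e2, Function.iterate_fixed e3,
      Function.iterate_fixed e4]
  · simp only [RelIso.trans_apply, h1, h2, h3, h4, h]

/-! ### Coordinates -/

/-- Relabelling the orbits. -/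
def relabel {p q : ℕ} (ℓ : Fin q ≃ Fin q) :
    Option (ZMod p × Option (Fin q)) ≃ Option (ZMod p × Option (Fin q)) :=
  Equiv.optionCongr (Equiv.prodCongr (Equiv.refl _) (Equiv.optionCongr ℓ))

lemma shiftAdj_relabel {p q : ℕ} {σ σ' : ZMod p → Fin q → Fin q} (ℓ : Fin q ≃ Fin q)
    (h : ∀ c s, c ≠ 0 → σ c (ℓ s) = ℓ (σ' c s)) (x y : Option (ZMod p × Option (Fin q))) :
    shiftAdj σ (relabel ℓ x) (relabel ℓ y) = shiftAdj σ' x y := by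
  rcases x with _ | ⟨i, _ | s⟩ <;> rcases y with _ | ⟨j, _ | t⟩ <;> try rfl
  change (i != j && σ (j - i) (ℓ s) == ℓ t) = (i != j && σ' (j - i) s == t)
  by_cases hij : i = j
  · simp [hij]
  · rw [h _ _ (sub_ne_zero.2 (Ne.symm hij))]
    congr 1
    rw [Bool.eq_iff_iff]
    simp

lemma nonempty_iso_of_coordinates {V U : Type*} {G : SimpleGraph V} {Γ : SimpleGraph U} {p q : ℕ}
    {σ σ' : ZMod p → Fin q → Fin q} (ℓ : Fin q ≃ Fin q)
    (h : ∀ c s, c ≠ 0 → σ c (ℓ s) = ℓ (σ' c s)) (f : Option (ZMod p × Option (Fin q)) ≃ V)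
    (hf : ∀ x y, G.Adj (f x) (f y) ↔ shiftAdj σ x y = true)
    (g : Option (ZMod p × Option (Fin q)) ≃ U)
    (hg : ∀ x y, Γ.Adj (g x) (g y) ↔ shiftAdj σ' x y = true) : Nonempty (G ≃g Γ) := by
  refine ⟨RelIso.symm ⟨g.symm.trans ((relabel ℓ).trans f), ?_⟩⟩
  intro a b
  obtain ⟨x, rfl⟩ := g.surjective a
  obtain ⟨y, rfl⟩ := g.surjective b
  simp only [Equiv.trans_apply, Equiv.symm_apply_apply]
  rw [hf, hg, shiftAdj_relabel ℓ h]

/-- Coordinates on the Petersen graph. -/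
def petersenCoord : Option (ZMod 3 × Option (Fin 2)) → {s : Finset (Fin 5) // s.card = 2}
  | none => ⟨{0, 1}, by decide⟩
  | some (0, none) => ⟨{2, 3}, by decide⟩
  | some (1, none) => ⟨{3, 4}, by decide⟩
  | some (2, none) => ⟨{2, 4}, by decide⟩
  | some (0, some 0) => ⟨{0, 4}, by decide⟩
  | some (0, some 1) => ⟨{1, 4}, by decide⟩
  | some (1, some 0) => ⟨{0, 2}, by decide⟩
  | some (1, some 1) => ⟨{1, 2}, by decide⟩
  | some (2, some 0) => ⟨{0, 3}, by decide⟩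
  | some (2, some 1) => ⟨{1, 3}, by decide⟩

/-- Coordinates on the Hoffman–Singleton graph. -/
def hsCoord (x : Option (ZMod 7 × Option (Fin 6))) : HSVertex :=
  hsVertex ([0, 1, 2, 26, 31, 36, 41, 46, 30, 32, 17, 9, 13, 21, 33, 45, 6, 47, 12, 24,
    18, 48, 35, 38, 19, 37, 22, 8, 11, 40, 14, 7, 23, 42, 43, 16, 4, 29, 3, 44, 34, 39, 49, 25, 27, 10, 20, 5, 28, 15].getD
    (match x with
      | none => 0
      | some (i, none) => 7 * i.val + 1
      | some (i, some s) => 7 * i.val + s.val + 2) 0)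

lemma petersen_coordinates : ∃ g : Option (ZMod 3 × Option (Fin 2)) ≃ _,
    ∀ x y, petersen.Adj (g x) (g y) ↔ shiftAdj (fun _ s => s + 1) x y = true := by
  have hbij : Function.Bijective petersenCoord := by
    rw [Fintype.bijective_iff_injective_and_card]
    exact ⟨by unfold Function.Injective; decide +kernel, by decide +kernel⟩
  refine ⟨Equiv.ofBijective _ hbij, ?_⟩
  change ∀ x y, petersen.Adj (petersenCoord x) (petersenCoord y) ↔ _
  decide +kernel

lemma hoffmanSingleton_coordinates : ∃ g : Option (ZMod 7 × Option (Fin 6)) ≃ _,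
    ∀ x y, hoffmanSingleton.Adj (g x) (g y) ↔ shiftAdj stdShift x y = true := by
  have hbij : Function.Bijective hsCoord := by
    rw [Fintype.bijective_iff_injective_and_card]
    exact ⟨by unfold Function.Injective; decide +kernel, by decide +kernel⟩
  refine ⟨Equiv.ofBijective _ hbij, ?_⟩
  change ∀ x y, hoffmanSingleton.Adj (hsCoord x) (hsCoord y) ↔ _
  decide +kernel

section

variable {V : Type*} [Fintype V] [DecidableEq V] {G : SimpleGraph V} [DecidableRel G.Adj]

lemma IsMoore.nonempty_iso_petersen (h : IsMoore G) (hd : G.IsRegularOfDegree 3) [Nonempty V]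
    (ht : IsEdgeTransitive Gᶜ) : Nonempty (G ≃g petersen) := by
  have : Fact (Nat.Prime 3) := ⟨by norm_num⟩
  -- There are 10 · 6 / 2 = 30 nonadjacent pairs.
  have hdvd : 3 ∣ Nat.card (G ≃g G) :=
    dvd_trans (by norm_num) (h.card_edges_dvd hd (by norm_num) ht)
  obtain ⟨σ, hσ, f, hf⟩ := h.exists_coordinates (q := 2) rfl hd hdvd
  obtain ⟨g, hg⟩ := petersen_coordinates
  exact nonempty_iso_of_coordinates (Equiv.refl _) hσ.eq_of_three f hf g hg

lemma IsMoore.nonempty_iso_hoffmanSingleton (h : IsMoore G) (hd : G.IsRegularOfDegree 7)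
    [Nonempty V] (ht : IsEdgeTransitive Gᶜ) : Nonempty (G ≃g hoffmanSingleton) := by
  have : Fact (Nat.Prime 7) := ⟨by norm_num⟩
  -- There are 50 · 42 / 2 = 1050 nonadjacent pairs.
  have hdvd : 7 ∣ Nat.card (G ≃g G) :=
    dvd_trans (by norm_num) (h.card_edges_dvd hd (by norm_num) ht)
  obtain ⟨σ, hσ, f, hf⟩ := h.exists_coordinates (q := 6) rfl hd hdvd
  obtain ⟨ℓ, hℓ⟩ := hσ.exists_equiv
  obtain ⟨g, hg⟩ := hoffmanSingleton_coordinates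
  exact nonempty_iso_of_coordinates ℓ hℓ f hf g hg

end

/-! ### Transport along isomorphisms -/

section

variable {V V' W : Type*} {G : SimpleGraph V} {G' : SimpleGraph V'} {H : SimpleGraph W}

lemma IsMoore.of_iso (h : IsMoore G) (e : G' ≃g G) : IsMoore G' := by
  refine ⟨fun a b c hab hbc hac => ?_, fun a b hab hn => ?_, fun a b c c' hab h2 h3 h4 h5 => ?_⟩
  · exact h.not_adj _ _ _ (e.map_adj_iff.2 hab) (e.map_adj_iff.2 hbc) (e.map_adj_iff.2 hac)
  · obtain ⟨c, hc1, hc2⟩ := h.exists_common (e a) (e b) (fun hh => hab (e.injective hh))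
      (fun hh => hn (e.map_adj_iff.1 hh))
    obtain ⟨c, rfl⟩ := e.surjective c
    exact ⟨c, e.map_adj_iff.1 hc1, e.map_adj_iff.1 hc2⟩
  · exact e.injective (h.common_unique (e a) (e b) _ _ (fun hh => hab (e.injective hh))
      (e.map_adj_iff.2 h2) (e.map_adj_iff.2 h3) (e.map_adj_iff.2 h4) (e.map_adj_iff.2 h5))

lemma deletePair_comm (a b : V) : Nonempty (deletePair G a b ≃g deletePair G b a) := by
  unfold deletePair
  rw [Set.pair_comm]
  exact ⟨RelIso.refl _⟩

lemma deletePair_iso_map (e : G ≃g G') (a b : V) :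
    Nonempty (deletePair G a b ≃g deletePair G' (e a) (e b)) := by
  refine ⟨⟨e.toEquiv.subtypeEquiv fun x => ?_, ?_⟩⟩
  · simp [e.injective.eq_iff]
  · intro x y
    exact e.map_adj_iff

lemma isDeletion_pair_iff [DecidableEq V] {a b : V} :
    IsDeletion G H {a, b} ↔ Nonempty (deletePair G a b ≃g H) := by
  unfold IsDeletion
  rw [Finset.coe_pair]

lemma IsEdgeTransitive.deletePair_iso (h : IsEdgeTransitive Gᶜ) {a b a' b' : V}
    (hab : a ≠ b) (hn : ¬ G.Adj a b) (hab' : a' ≠ b') (hn' : ¬ G.Adj a' b') :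
    Nonempty (deletePair G a b ≃g deletePair G a' b') := by
  obtain ⟨φ, hφ⟩ := h a b a' b' ((compl_adj _ _ _).2 ⟨hab, hn⟩) ((compl_adj _ _ _).2 ⟨hab', hn'⟩)
  have key : ∃ ψ : G ≃g G, ∀ x, ψ x = φ x := by
    refine ⟨⟨φ.toEquiv, ?_⟩, fun _ => rfl⟩
    intro x y
    have := φ.map_adj_iff (v := x) (w := y)
    rw [compl_adj, compl_adj, φ.injective.ne_iff] at this
    by_cases hxy : x = y
    · subst hxy
      simp
    · have h2 := not_congr this
      simp only [hxy, ne_eq, not_false_eq_true, true_and, not_not] at h2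
      exact h2
  obtain ⟨ψ, hψ⟩ := key
  obtain ⟨f⟩ := deletePair_iso_map ψ a b
  rcases hφ with ⟨h1, h2⟩ | ⟨h1, h2⟩
  · rw [hψ, hψ, h1, h2] at f
    exact ⟨f⟩
  · rw [hψ, hψ, h1, h2] at f
    obtain ⟨g⟩ := deletePair_comm (G := G) b' a'
    exact ⟨f.trans g⟩

lemma IsEdgeTransitive.isDeletion_of_iso {U : Type*} {Γ : SimpleGraph U} [DecidableEq V]
    (h : IsEdgeTransitive Γᶜ) {u v : U} (huv : u ≠ v) (hn : ¬ Γ.Adj u v) (e : G ≃g Γ)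
    (f : H ≃g deletePair Γ u v) (a b : V) (hab : a ≠ b) (hab' : ¬ G.Adj a b) :
    IsDeletion G H {a, b} := by
  obtain ⟨e₁⟩ := deletePair_iso_map e a b
  obtain ⟨e₂⟩ := h.deletePair_iso (fun hh => hab (e.injective hh))
    (fun hh => hab' (e.map_adj_iff.1 hh)) huv hn
  exact isDeletion_pair_iff.2 ⟨(e₁.trans e₂).trans f.symm⟩

end

/-! ### The exceptional graphs -/

section

variable {W : Type*} {H : SimpleGraph W}

/-- Every graph on three vertices is exceptional. -/
lemma inFInfty_of_card_eq_three [Fintype W] (hW : Fintype.card W = 3) : InFInfty H := by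
  have e : W ≃ Fin 3 := Fintype.equivFinOfCardEq hW
  have aux : ∀ {K : SimpleGraph (Fin 3)} (σ : Fin 3 ≃ Fin 3),
      (∀ i j : Fin 3, i < j → (K.Adj (σ i) (σ j) ↔ H.Adj (e.symm i) (e.symm j))) →
      Nonempty (H ≃g K) := by
    intro K σ hK
    refine ⟨⟨e.trans σ, ?_⟩⟩
    intro x y
    obtain ⟨i, rfl⟩ := e.symm.surjective x
    obtain ⟨j, rfl⟩ := e.symm.surjective y
    simp only [Equiv.trans_apply, Equiv.apply_symm_apply]
    rcases lt_trichotomy i j with h | rfl | h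
    · exact hK i j h
    · simp
    · rw [K.adj_comm, H.adj_comm]
      exact hK j i h
  have aux' : ∀ {K : SimpleGraph (Fin 3)} (σ : Fin 3 ≃ Fin 3),
      ((K.Adj (σ 0) (σ 1) ↔ H.Adj (e.symm 0) (e.symm 1)) ∧
        (K.Adj (σ 0) (σ 2) ↔ H.Adj (e.symm 0) (e.symm 2)) ∧
        (K.Adj (σ 1) (σ 2) ↔ H.Adj (e.symm 1) (e.symm 2))) → Nonempty (H ≃g K) := by
    intro K σ hK
    refine aux σ fun i j hij => ?_
    fin_cases i <;> fin_cases j <;> first | exact absurd hij (by decide) | skip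
    · exact hK.1
    · exact hK.2.1
    · exact hK.2.2
  -- With one or two edges, the permutation moves the isolated vertex or the center of the path to
  -- 0.
  by_cases h1 : H.Adj (e.symm 0) (e.symm 1) <;> by_cases h2 : H.Adj (e.symm 0) (e.symm 2) <;>
    by_cases h3 : H.Adj (e.symm 1) (e.symm 2)
  · exact Or.inl ⟨3, by norm_num, Or.inl (aux' (Equiv.refl _) (by simp [h1, h2, h3]))⟩
  · exact Or.inr (Or.inl ⟨2, le_rfl, Or.inl (aux' (Equiv.refl _) (by simp [h1, h2, h3]))⟩)
  · exact Or.inr (Or.inl ⟨2, le_rfl, Or.inl (aux' (Equiv.swap 0 1)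
      (by simp only [h1, h2, h3]; decide))⟩)
  · exact Or.inr (Or.inl ⟨2, le_rfl, Or.inr (aux' (Equiv.swap 0 2)
      (by simp only [h1, h2, h3]; decide))⟩)
  · exact Or.inr (Or.inl ⟨2, le_rfl, Or.inl (aux' (Equiv.swap 0 2)
      (by simp only [h1, h2, h3]; decide))⟩)
  · exact Or.inr (Or.inl ⟨2, le_rfl, Or.inr (aux' (Equiv.swap 0 1)
      (by simp only [h1, h2, h3]; decide))⟩)
  · exact Or.inr (Or.inl ⟨2, le_rfl, Or.inr (aux' (Equiv.refl _)
      (by simp only [h1, h2, h3]; decide))⟩)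
  · exact Or.inl ⟨3, by norm_num, Or.inr (aux' (Equiv.refl _) (by simp [h1, h2, h3]))⟩

lemma exists_swap_top (k : ℕ) (x y : Fin k) :
    ∃ φ : (⊤ : SimpleGraph (Fin k)) ≃g ⊤, φ x = y :=
  ⟨⟨Equiv.swap x y, (Equiv.swap x y).injective.ne_iff⟩,
    Equiv.swap_apply_left x y⟩

lemma exists_swap_starGraph {α : Type*} [DecidableEq α] {r x y : α} (hx : x ≠ r) (hy : y ≠ r) :
    ∃ φ : starGraph r ≃g starGraph r, φ x = y := by
  refine ⟨⟨Equiv.swap x y, ?_⟩, Equiv.swap_apply_left x y⟩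
  intro a b
  have key : ∀ c, Equiv.swap x y c = r ↔ c = r := by
    intro c
    rw [← Equiv.eq_symm_apply, Equiv.symm_swap, Equiv.swap_apply_of_ne_of_ne hx.symm hy.symm]
  simp only [starGraph_adj, key, (Equiv.swap x y).injective.ne_iff]

variable [Fintype W] [DecidableRel H.Adj]

lemma degree_eq_of_iso {U : Type*} {K : SimpleGraph U} (e : H ≃g K) {x y : W}
    (h : ∃ φ : K ≃g K, φ (e x) = e y) : H.degree x = H.degree y := by
  obtain ⟨φ, hφ⟩ := h
  have : ((e.trans φ).trans e.symm) x = y := by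
    simp only [RelIso.trans_apply, hφ, RelIso.symm_apply_apply]
  rw [← this, Iso.degree_eq]

lemma degree_eq_of_iso_compl {U : Type*} {K : SimpleGraph U} (e : H ≃g Kᶜ) {x y : W}
    (h : ∃ φ : K ≃g K, φ (e x) = e y) : H.degree x = H.degree y := by
  obtain ⟨φ, hφ⟩ := h
  exact degree_eq_of_iso e ⟨complIso φ, hφ⟩

/-- The degrees of `H` are `d - 2`, `d - 1` and `d`. -/
structure HasThreeDegrees (H : SimpleGraph W) [DecidableRel H.Adj] (d : ℕ) : Prop where
  le_add_two : ∀ w, d ≤ H.degree w + 2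
  le : ∀ w, H.degree w ≤ d
  exists_eq_sub_two : ∃ w, H.degree w + 2 = d
  exists_eq_sub_one : ∃ w, H.degree w + 1 = d
  exists_eq : ∃ w, H.degree w = d

/-- Complete graphs have one degree and stars at most two, because the vertices other than the
center are interchangeable; complements inherit this. Λ does have three degrees, which is why order
4 is excluded. -/
lemma HasThreeDegrees.not_inFInfty {d : ℕ} (h : HasThreeDegrees H d)
    (hW : Fintype.card W ≠ 4) : ¬ InFInfty H := by
  obtain ⟨x, hx⟩ := h.exists_eq_sub_two
  obtain ⟨y, hy⟩ := h.exists_eq_sub_one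
  obtain ⟨z, hz⟩ := h.exists_eq
  have star : ∀ {U : Type} (r : U) (f : W → U), Function.Injective f →
      (∀ a b, f a ≠ r → f b ≠ r → H.degree a = H.degree b) → False := by
    intro U r f hf hab
    have hxy : x ≠ y := by rintro rfl; omega
    have hxz : x ≠ z := by rintro rfl; omega
    have hyz : y ≠ z := by rintro rfl; omega
    by_cases h1 : f x = r
    · have := hab y z (fun hh => hxy (hf (h1.trans hh.symm)))
        (fun hh => hxz (hf (h1.trans hh.symm)))
      omega
    · by_cases h2 : f y = r
      · have := hab x z h1 (fun hh => hyz (hf (h2.trans hh.symm)))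
        omega
      · have := hab x y h1 h2
        omega
  rintro (⟨k, -, ⟨⟨e⟩⟩ | ⟨⟨e⟩⟩⟩ | ⟨m, -, ⟨⟨e⟩⟩ | ⟨⟨e⟩⟩⟩ | ⟨⟨e⟩⟩ | ⟨⟨e⟩⟩)
  · have := degree_eq_of_iso e (exists_swap_top k (e x) (e y))
    omega
  · have := degree_eq_of_iso_compl e (exists_swap_top k (e x) (e y))
    omega
  · exact star 0 e e.injective fun a b ha hb => degree_eq_of_iso e (exists_swap_starGraph ha hb)
  · exact star 0 e e.injective fun a b ha hb =>
      degree_eq_of_iso_compl e (exists_swap_starGraph ha hb)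
  · exact hW (Fintype.card_congr e.toEquiv)
  · exact hW (Fintype.card_congr e.toEquiv)

lemma HasThreeDegrees.hasConsecutiveDegrees {d : ℕ} (h : HasThreeDegrees H d) :
    HasConsecutiveDegrees H := by
  intro i hi hi'
  obtain ⟨x, hx⟩ := h.exists_eq_sub_two
  obtain ⟨y, hy⟩ := h.exists_eq_sub_one
  obtain ⟨z, hz⟩ := h.exists_eq
  have : Nonempty W := ⟨x⟩
  have h1 := H.maxDegree_le_of_forall_degree_le d h.le
  have h2 := H.le_minDegree_of_forall_le_degree (H.degree x) (fun w => by
    have := h.le_add_two w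
    omega)
  rcases (by omega : i + 2 = d ∨ i + 1 = d ∨ i = d) with hd | hd | hd
  · exact ⟨x, by omega⟩
  · exact ⟨y, by omega⟩
  · exact ⟨z, by omega⟩

lemma HasThreeDegrees.boundedBy {V : Type*} [Fintype V] {G : SimpleGraph V} [DecidableRel G.Adj]
    {d : ℕ} (h : HasThreeDegrees H d) (hd : G.IsRegularOfDegree d)
    (hcard : Fintype.card V = Fintype.card W + 2) : BoundedBy G H := by
  obtain ⟨x, hx⟩ := h.exists_eq_sub_two
  obtain ⟨z, hz⟩ := h.exists_eq
  have : Nonempty W := ⟨x⟩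
  have : Nonempty V := Fintype.card_pos_iff.1 (by omega)
  have h1 := H.maxDegree_le_of_forall_degree_le d h.le
  have h2 := H.le_minDegree_of_forall_le_degree (H.degree x) (fun w => by
    have := h.le_add_two w
    omega)
  have h3 := H.degree_le_maxDegree z
  have h4 := H.minDegree_le_degree x
  have h5 := hd.maxDegree_eq
  have h6 := hd.minDegree_eq
  exact ⟨by omega, by omega⟩

/-- Complementation reverses the three degrees; the largest becomes (k - 1) - (d - 2). -/
lemma HasThreeDegrees.of_compl [DecidableEq W] {d : ℕ} (h : HasThreeDegrees Hᶜ d) :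
    HasThreeDegrees H (Fintype.card W + 1 - d) := by
  have key : ∀ w, Hᶜ.degree w + H.degree w + 1 = Fintype.card W := fun w => by
    rw [degree_compl]
    have := H.degree_lt_card_verts w
    omega
  obtain ⟨x, hx⟩ := h.exists_eq_sub_two
  obtain ⟨y, hy⟩ := h.exists_eq_sub_one
  obtain ⟨z, hz⟩ := h.exists_eq
  refine ⟨fun w => ?_, fun w => ?_, ⟨z, ?_⟩, ⟨y, ?_⟩, ⟨x, ?_⟩⟩
  · have := key w
    have := h.le w
    omega
  · have := key w
    have := h.le_add_two w
    omega
  · have := key z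
    omega
  · have := key y
    omega
  · have := key x
    omega

end

/-! ### Moore graphs with isomorphic deletions -/

section

variable {V W : Type*} [Fintype V] [Fintype W] [DecidableEq V] {G : SimpleGraph V}
  {H : SimpleGraph W}

/-- Deleting the vertices `a` and `b` keeps all colors if each of the two has a partner of its
color outside of the pair; such a pair can always be chosen nonadjacent. -/
lemma IsMoore.arrows (h : IsMoore G) (hcard : Fintype.card V = Fintype.card W + 2)
    (hdel : ∀ a b, a ≠ b → ¬ G.Adj a b → IsDeletion G H {a, b}) : Arrows G H := by
  intro c hc
  by_contra hno
  -- If a and b have partners of their colors outside {a, b}, deleting both keeps all k colors on k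
  -- vertices, so the rest is rainbow. Without a rainbow copy, such a and b must be adjacent.
  have key : ∀ a b a' b', a' ≠ a → a' ≠ b → b' ≠ a → b' ≠ b → c a' = c a → c b' = c b →
      a ≠ b → G.Adj a b := by
    intro a b a' b' h1 h2 h3 h4 h5 h6 hab
    by_contra hn
    obtain ⟨e⟩ := isDeletion_pair_iff.1 (hdel a b hab hn)
    refine hno ⟨e.symm.toEmbedding.trans (Embedding.induce _), ?_⟩
    have hsurj : Function.Surjective
        (c ∘ (e.symm.toEmbedding.trans (Embedding.induce _) : H ↪g G)) := by
      intro i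
      have : ∃ v : V, v ≠ a ∧ v ≠ b ∧ c v = i := by
        obtain ⟨v, rfl⟩ := hc i
        by_cases hva : v = a
        · exact ⟨a', h1, h2, hva ▸ h5⟩
        by_cases hvb : v = b
        · exact ⟨b', h3, h4, hvb ▸ h6⟩
        exact ⟨v, hva, hvb, rfl⟩
      obtain ⟨v, hva, hvb, hv⟩ := this
      refine ⟨e ⟨v, by simp [hva, hvb]⟩, ?_⟩
      simp [hv]
    exact ((Fintype.bijective_iff_surjective_and_card _).2 ⟨hsurj, by simp⟩).1
  have hex : ∃ x y, c x = c y ∧ x ≠ y :=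
    Fintype.exists_ne_map_eq_of_card_lt c (by simp [hcard]) |>.imp fun x ⟨y, h1, h2⟩ => ⟨y, h2, h1⟩
  obtain ⟨x, y, hxy, hne⟩ := hex
  obtain ⟨z, hz, w, hw, hzw, hczw⟩ :=
    Finset.exists_ne_map_eq_of_card_lt_of_maps_to (s := Finset.univ.erase x)
      (t := (Finset.univ : Finset (Fin (Fintype.card W)))) (f := c)
      (by rw [Finset.card_erase_of_mem (Finset.mem_univ _), Finset.card_univ, Finset.card_univ,
        Fintype.card_fin]; omega) (fun _ _ => Finset.mem_univ _)
  have hzx := Finset.ne_of_mem_erase hz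
  have hwx := Finset.ne_of_mem_erase hw
  -- There are two more vertices than colors. Either three vertices share a color, and `key` makes
  -- them a triangle, or two disjoint pairs are monochromatic, and `key` makes all four cross pairs
  -- adjacent, a 4-cycle.
  have three : ∀ p q r : V, p ≠ q → q ≠ r → p ≠ r → c p = c q → c q = c r → False := by
    intro p q r hpq hqr hpr h1 h2
    exact h.not_adj p q r
      (key p q r r hpr.symm hqr.symm hpr.symm hqr.symm (h1.trans h2).symm h2.symm hpq)
      (key q r p p hpq hpr hpq hpr h1 (h1.trans h2) hqr)
      (key p r q q hpq.symm hqr hpq.symm hqr h1.symm h2 hpr)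
  by_cases hyz : y = z
  · subst hyz
    exact three x y w hne hzw hwx.symm hxy hczw
  by_cases hyw : y = w
  · subst hyw
    exact three x y z hne hzw.symm hzx.symm hxy hczw.symm
  refine hzw (h.common_unique x y z w hne ?_ ?_ ?_ ?_)
  · exact key x z y w hne.symm hyz hwx hzw.symm hxy.symm hczw.symm hzx.symm
  · exact key y z x w hne hzx.symm (Ne.symm hyw) hzw.symm hxy hczw.symm hyz
  · exact key x w y z hne.symm hyw hzx hzw hxy.symm hczw hwx.symm
  · exact key y w x z hne hwx.symm (Ne.symm hyz) hzw hxy hczw hyw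

variable [DecidableRel G.Adj] [DecidableRel H.Adj]

omit [DecidableEq V] in
lemma exists_adj_notMem {d : ℕ} (hd : G.IsRegularOfDegree d) (x : V) (S : Finset V)
    (hS : S.card < d) : ∃ y, G.Adj x y ∧ y ∉ S := by
  rw [← hd x, ← card_neighborFinset_eq_degree] at hS
  obtain ⟨y, hy, hyS⟩ := Finset.exists_mem_notMem_of_card_lt_card hS
  exact ⟨y, (mem_neighborFinset _ _ _).1 hy, hyS⟩

/-- The common neighbor c of a and b loses two neighbors, another neighbor x of a loses one, and a
neighbor y of x avoiding a and the common neighbor of x and b loses none. The last choice needs d ≥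
3. -/
lemma IsMoore.hasThreeDegrees {d : ℕ} (h : IsMoore G) (hd : G.IsRegularOfDegree d) (h3 : 3 ≤ d)
    {a b : V} (hab : a ≠ b) (hn : ¬ G.Adj a b) (hdel : IsDeletion G H {a, b}) :
    HasThreeDegrees H d := by
  obtain ⟨e⟩ := hdel
  have key : ∀ x, x ≠ a → x ≠ b → ∃ w, H.degree w +
      ((if G.Adj x a then 1 else 0) + if G.Adj x b then 1 else 0) = d := by
    intro x hxa hxb
    refine ⟨e ⟨x, by simp [hxa, hxb]⟩, ?_⟩
    have h1 := degree_eq_degIn_add (G := G) {a, b} x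
    rw [hd x, degIn_pair hab] at h1
    rw [degree_apply_isDeletion]
    exact (add_comm _ _).trans h1.symm
  have hle : ∀ w, H.degree w ≤ d ∧ d ≤ H.degree w + 2 := by
    intro w
    obtain ⟨⟨x, hx⟩, rfl⟩ := e.surjective w
    have h1 := degree_eq_degIn_add (G := G) {a, b} x
    rw [hd x, degIn_pair hab] at h1
    rw [degree_apply_isDeletion]
    change degIn G {a, b}ᶜ x ≤ d ∧ d ≤ degIn G {a, b}ᶜ x + 2
    split_ifs at h1 <;> exact ⟨by omega, by omega⟩
  obtain ⟨c, hac, hbc⟩ := h.exists_common a b hab hn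
  obtain ⟨x, hax, hxc⟩ := exists_adj_notMem hd a {c} (by rw [Finset.card_singleton]; omega)
  rw [Finset.mem_singleton] at hxc
  have hxb : ¬ G.Adj x b := fun hh => hxc (h.common_unique a b x c hab hax hh.symm hac hbc)
  have hxb' : x ≠ b := fun hh => hn (hh ▸ hax)
  obtain ⟨u, hxu, hbu⟩ := h.exists_common x b hxb' hxb
  obtain ⟨y, hxy, hy⟩ := exists_adj_notMem hd x {a, u}
    (lt_of_le_of_lt (Finset.card_insert_le _ _) (by rw [Finset.card_singleton]; omega))
  simp only [Finset.mem_insert, Finset.mem_singleton, not_or] at hy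
  have hya : ¬ G.Adj y a := fun hh => h.not_adj a x y hax hxy hh.symm
  have hyb : ¬ G.Adj y b := fun hh =>
    hy.2 (h.common_unique x b y u hxb' hxy hh.symm hxu hbu)
  have hyb' : y ≠ b := fun hh => hxb (hh ▸ hxy)
  refine ⟨fun w => (hle w).2, fun w => (hle w).1, ?_, ?_, ?_⟩
  · obtain ⟨w, hw⟩ := key c hac.ne' hbc.ne'
    rw [if_pos hac.symm, if_pos hbc.symm] at hw
    exact ⟨w, hw⟩
  · obtain ⟨w, hw⟩ := key x hax.ne' hxb'
    rw [if_pos hax.symm, if_neg hxb] at hw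
    exact ⟨w, hw⟩
  · obtain ⟨w, hw⟩ := key y hy.1 hyb'
    rw [if_neg hya, if_neg hyb] at hw
    exact ⟨w, hw⟩

end

/-! ### The classification -/

section

variable {V W : Type*} [Fintype V] [Fintype W] {G : SimpleGraph V} {H : SimpleGraph W}
  [DecidableRel G.Adj] [DecidableRel H.Adj] {d : ℕ}

lemma IsMoore.exists_not_adj [DecidableEq V] (h : IsMoore G) (hd : G.IsRegularOfDegree d)
    (h2 : 2 ≤ d) [Nonempty V] : ∃ a b, a ≠ b ∧ ¬ G.Adj a b := by
  obtain ⟨x⟩ := ‹Nonempty V›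
  obtain ⟨a, ha, -⟩ := exists_adj_notMem hd x ∅ (by rw [Finset.card_empty]; omega)
  obtain ⟨b, hb, hba⟩ := exists_adj_notMem hd x {a} (by rw [Finset.card_singleton]; omega)
  rw [Finset.mem_singleton] at hba
  exact ⟨a, b, Ne.symm hba, fun hab => h.not_adj x a b ha hab hb⟩

omit [Fintype V] [Fintype W] [DecidableRel G.Adj] [DecidableRel H.Adj] in
lemma IsDeletion.iso_of_iso {U : Type*} {Γ : SimpleGraph U} [DecidableEq V]
    (ht : IsEdgeTransitive Γᶜ) {u v : U} (huv : u ≠ v) (hn : ¬ Γ.Adj u v) (e : G ≃g Γ) {a b : V}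
    (hab : a ≠ b) (hab' : ¬ G.Adj a b) (h : IsDeletion G H {a, b}) :
    Nonempty (H ≃g deletePair Γ u v) := by
  obtain ⟨f⟩ := isDeletion_pair_iff.1 h
  obtain ⟨e₁⟩ := deletePair_iso_map e a b
  obtain ⟨e₂⟩ := ht.deletePair_iso (fun hh => hab (e.injective hh))
    (fun hh => hab' (e.map_adj_iff.1 hh)) huv hn
  exact ⟨(f.symm.trans e₁).trans e₂⟩

lemma petersen_not_adj :
    (⟨{0, 1}, by decide⟩ : {s : Finset (Fin 5) // s.card = 2}) ≠ ⟨{0, 2}, by decide⟩ ∧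
      ¬ petersen.Adj ⟨{0, 1}, by decide⟩ ⟨{0, 2}, by decide⟩ := by
  decide +kernel

lemma hoffmanSingleton_not_adj : (Sum.inl (0, 0) : HSVertex) ≠ Sum.inl (0, 2) ∧
    ¬ hoffmanSingleton.Adj (Sum.inl (0, 0)) (Sum.inl (0, 2)) := by
  decide +kernel

omit [Fintype W] [DecidableRel H.Adj] in
/-- A regular Moore graph all of whose deletions of two nonadjacent vertices are isomorphic is the
pentagon, the Petersen graph or the Hoffman–Singleton graph. -/
lemma IsMoore.classification [DecidableEq V] [Nonempty V] (h : IsMoore G)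
    (hd : G.IsRegularOfDegree d) (h2 : 2 ≤ d)
    (hdel : ∀ a b, a ≠ b → ¬ G.Adj a b → IsDeletion G H {a, b}) :
    Fintype.card V = 5 ∨ (Nonempty (G ≃g petersen) ∧ Nonempty (H ≃g petersen')) ∨
      (Nonempty (G ≃g hoffmanSingleton) ∧ Nonempty (H ≃g hoffmanSingleton')) := by
  have ht := h.isEdgeTransitive_compl hd h2 hdel
  obtain ⟨a, b, hab, hn⟩ := h.exists_not_adj hd h2
  rcases h.degree_cases hd h2 with rfl | rfl | rfl | rfl
  · exact Or.inl (h.card_eq hd)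
  · obtain ⟨e⟩ := h.nonempty_iso_petersen hd ht
    exact Or.inr (Or.inl ⟨⟨e⟩, (hdel a b hab hn).iso_of_iso petersen_isEdgeTransitive
      petersen_not_adj.1 petersen_not_adj.2 e hab hn⟩)
  · obtain ⟨e⟩ := h.nonempty_iso_hoffmanSingleton hd ht
    exact Or.inr (Or.inr ⟨⟨e⟩, (hdel a b hab hn).iso_of_iso hoffmanSingleton_isEdgeTransitive
      hoffmanSingleton_not_adj.1 hoffmanSingleton_not_adj.2 e hab hn⟩)
  · exact (h.degree_ne hd ht).elim

/-- `G` is `d`-regular and arrows `H`, which has two vertices less and the three degrees `d - 2`,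
`d - 1` and `d`; the remaining bounds make the notion invariant under complementation. -/
def IsMoorePair (G : SimpleGraph V) (H : SimpleGraph W) [DecidableRel G.Adj]
    [DecidableRel H.Adj] (d : ℕ) : Prop :=
  Fintype.card V = Fintype.card W + 2 ∧ 8 ≤ Fintype.card W ∧ 2 ≤ d ∧
    d + 3 ≤ Fintype.card V ∧ Arrows G H ∧ G.IsRegularOfDegree d ∧ HasThreeDegrees H d

lemma isMoorePair_of_iso {U : Type*} [Fintype U] {Γ : SimpleGraph U} [DecidableRel Γ.Adj]
    (hΓ : IsMoore Γ) (hd : Γ.IsRegularOfDegree d) (h3 : 3 ≤ d) (ht : IsEdgeTransitive Γᶜ)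
    {u v : U} (huv : u ≠ v) (hn : ¬ Γ.Adj u v) (e : G ≃g Γ) (f : H ≃g deletePair Γ u v) :
    IsMoorePair G H d := by
  classical
  have hG : IsMoore G := hΓ.of_iso e
  have hGd : G.IsRegularOfDegree d := fun x => by rw [← e.degree_eq, hd]
  have : Nonempty V := ⟨e.symm u⟩
  have hcard := hG.card_eq hGd
  have hdel := ht.isDeletion_of_iso huv hn e f
  obtain ⟨a, b, hab, hnab⟩ := hG.exists_not_adj hGd (by omega)
  have hW := (hdel a b hab hnab).card_add
  rw [Finset.card_pair hab] at hW
  -- This yields k = d² - 1 ≥ 8 and n = d² + 1 ≥ d + 3.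
  have : 3 * d ≤ d * d := Nat.mul_le_mul_right d h3
  exact ⟨by omega, by omega, by omega, by omega, hG.arrows (by omega) hdel, hGd,
    hG.hasThreeDegrees hGd h3 hab hnab (hdel a b hab hnab)⟩

lemma IsMoorePair.of_compl [DecidableEq V] [DecidableEq W] (h : IsMoorePair Gᶜ Hᶜ d) :
    IsMoorePair G H (Fintype.card V - 1 - d) := by
  obtain ⟨h1, h2, h3, h4, h5, h6, h7⟩ := h
  refine ⟨h1, h2, by omega, by omega, ?_, fun v => ?_, ?_⟩
  · have := h5.compl
    rwa [compl_compl, compl_compl] at this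
  · have := h6 v
    rw [degree_compl] at this
    have := G.degree_lt_card_verts v
    omega
  · have := h7.of_compl
    rwa [show Fintype.card W + 1 - d = Fintype.card V - 1 - d by omega] at this

lemma nonempty_compl_iso_iff {V W : Type*} {G : SimpleGraph V} {K : SimpleGraph W} :
    Nonempty (Gᶜ ≃g K) ↔ Nonempty (G ≃g Kᶜ) := by
  constructor <;> rintro ⟨e⟩ <;> have e := complIso e <;> rw [compl_compl] at e <;> exact ⟨e⟩

lemma exists_isMoorePair
    (h : ((Nonempty (G ≃g petersen) ∧ Nonempty (H ≃g petersen')) ∨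
      (Nonempty (G ≃g hoffmanSingleton) ∧ Nonempty (H ≃g hoffmanSingleton')))) :
    ∃ d, IsMoorePair G H d := by
  rcases h with ⟨⟨e⟩, ⟨f⟩⟩ | ⟨⟨e⟩, ⟨f⟩⟩
  · exact ⟨3, isMoorePair_of_iso petersen_isMoore petersen_isRegularOfDegree le_rfl
      petersen_isEdgeTransitive petersen_not_adj.1 petersen_not_adj.2 e f⟩
  · exact ⟨7, isMoorePair_of_iso hoffmanSingleton_isMoore hoffmanSingleton_isRegularOfDegree
      (by norm_num) hoffmanSingleton_isEdgeTransitive hoffmanSingleton_not_adj.1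
      hoffmanSingleton_not_adj.2 e f⟩

end

end RainbowInduced

theorem lemma4 :
    (∀ {V : Type*} {W : Type*} [Fintype V] [Fintype W]
        (G : SimpleGraph V) (H : SimpleGraph W) [DecidableRel G.Adj] [DecidableRel H.Adj],
        3 ≤ Fintype.card W →
        ((Fintype.card W + 2 ≤ Fintype.card V ∧
            RainbowInduced.Arrows G H ∧
            RainbowInduced.BoundedBy G H ∧
            ¬ RainbowInduced.InFInfty H ∧
            RainbowInduced.HasConsecutiveDegrees H ∧
            ∃ d : ℕ, 2 ≤ d ∧ G.IsRegularOfDegree d) ↔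
          ((Nonempty (G ≃g RainbowInduced.petersen) ∧
              Nonempty (H ≃g RainbowInduced.petersen')) ∨
            (Nonempty (G ≃g RainbowInduced.petersenᶜ) ∧
              Nonempty (H ≃g RainbowInduced.petersen'ᶜ)) ∨
            (Nonempty (G ≃g RainbowInduced.hoffmanSingleton) ∧
              Nonempty (H ≃g RainbowInduced.hoffmanSingleton')) ∨
            (Nonempty (G ≃g RainbowInduced.hoffmanSingletonᶜ) ∧
              Nonempty (H ≃g RainbowInduced.hoffmanSingleton'ᶜ))))) ∧
    RainbowInduced.IsEdgeTransitive RainbowInduced.petersenᶜ ∧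
    RainbowInduced.IsEdgeTransitive RainbowInduced.hoffmanSingletonᶜ ∧
    (∀ u v, u ≠ v → ¬ RainbowInduced.petersen.Adj u v →
      Nonempty (RainbowInduced.deletePair RainbowInduced.petersen u v ≃g
        RainbowInduced.petersen')) ∧
    (∀ u v, u ≠ v → ¬ RainbowInduced.hoffmanSingleton.Adj u v →
      Nonempty (RainbowInduced.deletePair RainbowInduced.hoffmanSingleton u v ≃g
        RainbowInduced.hoffmanSingleton')) := by
  refine ⟨?_, RainbowInduced.petersen_isEdgeTransitive,
    RainbowInduced.hoffmanSingleton_isEdgeTransitive,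
    fun u v huv hn => RainbowInduced.petersen_isEdgeTransitive.deletePair_iso huv hn
      RainbowInduced.petersen_not_adj.1 RainbowInduced.petersen_not_adj.2,
    fun u v huv hn => RainbowInduced.hoffmanSingleton_isEdgeTransitive.deletePair_iso huv hn
      RainbowInduced.hoffmanSingleton_not_adj.1 RainbowInduced.hoffmanSingleton_not_adj.2⟩
  intro V W _ _ G H _ _ hW
  classical
  constructor
  · rintro ⟨hcard, ha, hb, hF, hc, d, h2, hd⟩
    obtain ⟨hVW, hco, ⟨hM, hdel⟩ | ⟨hM, hdel⟩⟩ :=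
      RainbowInduced.isMoore_of_arrows (by omega) hcard ha hb hc hd
    · have : Nonempty V := Fintype.card_pos_iff.1 (by omega)
      rcases hM.classification hd h2 hdel with h5 | h | h
      -- The pentagon would give k = 3.
      · exact (hF (RainbowInduced.inFInfty_of_card_eq_three (by omega))).elim
      · exact Or.inl h
      · exact Or.inr (Or.inr (Or.inl h))
    · have : Nonempty V := Fintype.card_pos_iff.1 (by omega)
      have hd' := hd.compl
      -- The classification is applied to the complement, whose degree is at least m = 2 by
      -- boundedness.
      have h2' := hco (Classical.arbitrary V)
      rw [hd'] at h2'
      rcases hM.classification hd' h2' hdel with h5 | h | h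
      · exact (hF (RainbowInduced.inFInfty_of_card_eq_three (by omega))).elim
      · rw [RainbowInduced.nonempty_compl_iso_iff, RainbowInduced.nonempty_compl_iso_iff] at h
        exact Or.inr (Or.inl h)
      · rw [RainbowInduced.nonempty_compl_iso_iff, RainbowInduced.nonempty_compl_iso_iff] at h
        exact Or.inr (Or.inr (Or.inr h))
  · intro h
    have hpair : ∃ d, RainbowInduced.IsMoorePair G H d := by
      rcases h with h | h | h | h
      · exact RainbowInduced.exists_isMoorePair (Or.inl h)
      · rw [← RainbowInduced.nonempty_compl_iso_iff, ← RainbowInduced.nonempty_compl_iso_iff] at h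
        obtain ⟨d, hd⟩ := RainbowInduced.exists_isMoorePair (Or.inl h)
        exact ⟨_, hd.of_compl⟩
      · exact RainbowInduced.exists_isMoorePair (Or.inr h)
      · rw [← RainbowInduced.nonempty_compl_iso_iff, ← RainbowInduced.nonempty_compl_iso_iff] at h
        obtain ⟨d, hd⟩ := RainbowInduced.exists_isMoorePair (Or.inr h)
        exact ⟨_, hd.of_compl⟩
    obtain ⟨d, h1, h2, h3, -, h5, h6, h7⟩ := hpair
    exact ⟨by omega, h5, h7.boundedBy h6 h1, h7.not_inFInfty (by omega),
      h7.hasConsecutiveDegrees, d, h3, h6⟩
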